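/- All groups are finite. For a finite group $G$ let $m_2(G)$ be its $2$-rank (the largest $r$ such that $G$ has an elementary abelian subgroup of order $2^r$), and let $\mathcal{A}_2(G)$ be the poset of nontrivial elementary abelian $2$-subgroups of $G$, ordered by inclusion. The group $G$ satisfies $(\mathcal{QD})_2$ if $\widetilde{H}_{m_2(G)-1}(\mathcal{A}_2(G);\mathbb{Q})\neq 0$. A $2$-extension of a finite group $K$ is a split extension $KB$ of $K$ by a (possibly trivial) elementary abelian $2$-group $B$ that induces outer automorphisms on $K$, i.e. conjugation embeds $B$ into $\mathrm{Aut}(K)$ with image meeting $\mathrm{Inn}(K)$ trivially. For $K\cong \mathrm{PSL}_2(q)$ or $\mathrm{PGL}_2(q)$, a field automorphism of order $2$ of $K$ is an automorphism of order $2$ that is $\mathrm{Aut}(K)$-conjugate to the one induced by a nontrivial automorphism of the field $\mathbb{F}_q$. **Proposition 4.2.** Let $q\neq 3$ be a power of an odd prime. (a) Let $L\cong \mathrm{PSL}_2(q)$. Every $2$-extension $LB$ of $L$ satisfies $(\mathcal{QD})_2$, with the following exceptions, which do fail $(\mathcal{QD})_2$: 1. $q=5$ and $B=1$; 2. $q=9$,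 $B\neq 1$, and $B$ induces field automorphisms of order $2$ on $L$ (that is, every nontrivial element of $B$ does). (b) Let $K\cong \mathrm{PGL}_2(q)$. Every $2$-extension $KB$ of $K$ satisfies $(\mathcal{QD})_2$, except when $q=9$, $B\neq 1$, and $B$ induces field automorphisms of order $2$ on $K$; in that case $(\mathcal{QD})_2$ fails. -/

import Mathlib

open scoped MatrixGroups

namespace Quillen

universe u v

section Homology

variable (P : Type u) [PartialOrder P]

/-- The simplicial chains over `ℚ` of the order complex of the poset `P`. The basis of `Chains P n` is
the set of strictly increasing chains `x₀ < ⋯ < xₙ₋₁` with `n` elements, that is, the set of simplices of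
dimension `n - 1`; for `n = 0` this is the empty simplex, so that the complex is augmented. -/
abbrev Chains (n : ℕ) : Type u := (Fin n ↪o P) →₀ ℚ

/-- The boundary map `∂ (x₀ < ⋯ < xₙ) = ∑ᵢ (-1)ⁱ (x₀ < ⋯ < x̂ᵢ < ⋯ < xₙ)`. For `n = 0` it is the
augmentation. -/
noncomputable def boundary (n : ℕ) : Chains P (n + 1) →ₗ[ℚ] Chains P n :=
  Finsupp.linearCombination ℚ fun s : Fin (n + 1) ↪o P =>
    ∑ i : Fin (n + 1), Finsupp.single ((Fin.succAboveOrderEmb i).trans s) ((-1 : ℚ) ^ (i : ℕ))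

/-- The boundary of a boundary is zero. -/
theorem boundary_boundary (n : ℕ) :
    boundary P n ∘ₗ boundary P (n + 1) = 0 := by
  ext s : 2
  simp only [LinearMap.comp_apply, Finsupp.lsingle_apply, boundary,
    Finsupp.linearCombination_single, one_smul, map_sum, LinearMap.zero_apply, Finset.smul_sum,
    Finsupp.smul_single, smul_eq_mul]
  rw [← Finset.sum_product']
  refine Finset.sum_involution (fun ij _ => (ij.1.succAbove ij.2, ij.2.predAbove ij.1)) ?_ ?_ ?_ ?_
  · rintro ⟨i, j⟩ -
    have h : (Fin.succAboveOrderEmb (j.predAbove i)).trans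
        ((Fin.succAboveOrderEmb (i.succAbove j)).trans s) =
        (Fin.succAboveOrderEmb j).trans ((Fin.succAboveOrderEmb i).trans s) := by
      ext k
      simp [Fin.succAbove_succAbove_succAbove_predAbove]
    simp only [h]
    rw [← Finsupp.single_add, ← pow_add, ← pow_add, Finsupp.single_eq_zero]
    have := Fin.neg_one_pow_succAbove_add_predAbove (R := ℚ) i j
    rw [this]; simp
  · rintro ⟨i, j⟩ - - h
    exact Fin.succAbove_ne _ _ (Prod.mk.inj h).1
  · simp
  · rintro ⟨i, j⟩ -
    simp [Fin.succAbove_succAbove_predAbove, Fin.predAbove_predAbove_succAbove]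

/-- The cycles of dimension `n - 1` of the augmented complex. -/
noncomputable def cycles : (n : ℕ) → Submodule ℚ (Chains P n)
  | 0 => ⊤
  | n + 1 => LinearMap.ker (boundary P n)

/-- The reduced homology `H̃ₙ₋₁(P; ℚ)` of (the order complex of) the poset `P`: cycles modulo
boundaries. The argument is the degree plus one, so `n = 0` is degree `-1`. -/
abbrev ReducedHomology (n : ℕ) : Type u :=
  cycles P n ⧸ (LinearMap.range (boundary P n)).submoduleOf (cycles P n)

end Homology

section Groups

variable (p : ℕ) {G : Type u} [Group G]

/-- The subgroup `A` is an elementary abelian `p`-group (possibly trivial). -/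
def IsElemAbelian (A : Subgroup G) : Prop :=
  (∀ a ∈ A, ∀ b ∈ A, a * b = b * a) ∧ ∀ a ∈ A, a ^ p = 1

/-- The Quillen poset `𝒜ₚ(G)` of the nontrivial elementary abelian `p`-subgroups of `G`, ordered by
inclusion. -/
abbrev QuillenPoset (G : Type u) [Group G] : Type u :=
  {A : Subgroup G // IsElemAbelian p A ∧ A ≠ ⊥}

/-- The `p`-rank `mₚ(G)`: the largest `r` such that the finite group `G` has an elementary abelian
subgroup of order `p ^ r`. -/
noncomputable def pRank (G : Type u) [Group G] : ℕ :=
  sSup {r : ℕ | ∃ A : Subgroup G, IsElemAbelian p A ∧ Nat.card A = p ^ r}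

/-- The Quillen dimension property `(𝒬𝒟)ₚ` of the finite group `G`: the reduced rational homology of
`𝒜ₚ(G)` in degree `mₚ(G) - 1` is non-zero. -/
def QuillenDimension (G : Type u) [Group G] : Prop :=
  Nontrivial (ReducedHomology (QuillenPoset p G) (pRank p G))

/-- `G = LB` is a `p`-extension of its normal subgroup `L`: a split extension of `L` by an elementary
abelian `p`-subgroup `B` (possibly trivial) that induces outer automorphisms on `L`, that is, `B` embeds
into `Aut(L)` by conjugation and the image meets `Inn(L)` trivially. -/
structure IsPExtension (L B : Subgroup G) [L.Normal] : Prop where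
  split : Subgroup.IsComplement' L B
  elemAbelian : IsElemAbelian p B
  outer : ∀ b ∈ B, (MulAut.conjNormal b : MulAut L) ∈ (MulAut.conj : L →* MulAut L).range → b = 1

end Groups

section FieldAutomorphisms

variable {F : Type u} [Field F]

/-- The automorphism of `SL₂(F)` that applies the field automorphism `σ` to the matrix entries. -/
def slFieldAut (σ : F ≃+* F) : MulAut SL(2, F) where
  toFun := Matrix.SpecialLinearGroup.map (σ : F →+* F)
  invFun := Matrix.SpecialLinearGroup.map (σ.symm : F →+* F)
  left_inv g := by ext i j; simp
  right_inv g := by ext i j; simp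
  map_mul' := map_mul _

/-- The automorphism of `PSL₂(F)` that applies the field automorphism `σ` to the matrix entries. -/
def pslFieldAut (σ : F ≃+* F) : MulAut PSL(2, F) :=
  QuotientGroup.congr _ _ (slFieldAut σ)
    (Subgroup.characteristic_iff_map_eq.mp inferInstance (slFieldAut σ))

/-- The automorphism of `GL₂(F)` that applies the field automorphism `σ` to the matrix entries. -/
def glFieldAut (σ : F ≃+* F) : MulAut (GL (Fin 2) F) where
  toFun := Matrix.GeneralLinearGroup.map (σ : F →+* F)
  invFun := Matrix.GeneralLinearGroup.map (σ.symm : F →+* F)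
  left_inv g := by ext i j; simp
  right_inv g := by ext i j; simp
  map_mul' := map_mul _

/-- The automorphism of `PGL₂(F)` that applies the field automorphism `σ` to the matrix entries. -/
def pglFieldAut (σ : F ≃+* F) : MulAut PGL(2, F) :=
  QuotientGroup.congr _ _ (glFieldAut σ)
    (Subgroup.characteristic_iff_map_eq.mp inferInstance (glFieldAut σ))

/-- Given the automorphisms `fieldAut σ` of `K` that come from the automorphisms `σ` of the ground field,
`t` is a field automorphism of order two of `K`: it has order two and is conjugate in `Aut(K)` to
`fieldAut σ` for a nontrivial `σ`. -/
def IsFieldInvolution {K : Type v} [Group K] (fieldAut : (F ≃+* F) → MulAut K) (t : MulAut K) : Prop :=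
  orderOf t = 2 ∧ ∃ σ : F ≃+* F, σ ≠ 1 ∧ IsConj (fieldAut σ) t

/-- The subgroup `B` is nontrivial and each of its nontrivial elements acts by conjugation on the normal
subgroup `L`, identified with `K` by means of `e`, as a field automorphism of order two. -/
def InducesFieldInvolutions {K : Type v} [Group K] (fieldAut : (F ≃+* F) → MulAut K)
    {G : Type*} [Group G] (L B : Subgroup G) [L.Normal] (e : L ≃* K) : Prop :=
  B ≠ ⊥ ∧ ∀ b ∈ B, b ≠ 1 → IsFieldInvolution fieldAut (MulAut.congr e (MulAut.conjNormal b))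

end FieldAutomorphisms

end Quillen

/-! No chain has more members than the rank, so in top degree there are no boundaries and `(𝒬𝒟)₂`
says that a nonzero top-dimensional cycle exists (`quillenDimension_iff`). Such a cycle survives
every embedding into a group of the same rank (`QuillenDimension.of_injective`).

Both `PSL₂(q)` and `PGL₂(q)` have automorphism group `PΓL₂(q)` (`exists_pslAutEquiv`,
`exists_pglAutEquiv`), so a 2-extension embeds in `PΓL₂(q)`. Its image is `PSL₂(q)`, `PGL₂(q)`, or a
group between `PSL₂(q)⟨σ⟩` and `PGL₂(q)⟨σ⟩`, where `σ` is the field involution. The last two both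
have rank 3. Hence for the groups between them nonvanishing need only be shown for the smaller one,
and vanishing only for the larger one.

In rank 2 the complex is the graph of involutions and four-groups. If every involution lies in two
four-groups, there are more edges than vertices, hence a cycle (`quillenDimension_of_two_le`); this
covers `PGL₂(q)` for `q ≥ 5` and `PSL₂(q)` for `q ≥ 7`. In `PSL₂(5)` every involution lies in one
four-group only, so the graph is a forest.

In rank 3 with `q = q₀² ≠ 9`, each outer involution `t` and flag `z ∈ V` centralized by `t` give a
subdivided triangle. Its boundary splits into terms depending only on `(V, z)`, `(t, z)` and `(V,
t)`. The number of flags is at least the total number of such pairs and one linear condition is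
redundant, so some nonzero combination of triangles is a cycle (`quillenDimension_of_outer`). The
count uses that `z` commutes with at most `2q₀` outer involutions and lies in at least `(q - 1) / 4`
four-groups; it works exactly from `q₀ = 5` on.

For `q = 9` every outer involution is conjugate to `σ`, whose centralizer in `PGL₂(9)` is `PGL₂(3) ≅
S₄`. The graph of involutions and four-groups of `S₄` is a tree, and peeling off its leaves forces
every cycle to vanish (`not_quillenDimension_of_outer`). -/

namespace Quillen

universe u v

/-! ### Faces, boundaries and top-dimensional cycles -/

section Homology

variable {P : Type u} [PartialOrder P] {Q : Type v} [PartialOrder Q]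

/-- The face of the chain `s` that omits its `i`-th element. -/
def face {n : ℕ} (i : Fin (n + 1)) (s : Fin (n + 1) ↪o P) : Fin n ↪o P :=
  (Fin.succAboveOrderEmb i).trans s

theorem face_apply {n : ℕ} (i : Fin (n + 1)) (s : Fin (n + 1) ↪o P) (k : Fin n) :
    face i s k = s (i.succAbove k) := rfl

theorem boundary_single {n : ℕ} (s : Fin (n + 1) ↪o P) (a : ℚ) :
    boundary P n (Finsupp.single s a) =
      ∑ i : Fin (n + 1), Finsupp.single (face i s) (a * (-1 : ℚ) ^ (i : ℕ)) := by
  simp [boundary, Finset.smul_sum, face]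

open Classical in
theorem boundary_apply {n : ℕ} (c : Chains P (n + 1)) (e : Fin n ↪o P) :
    boundary P n c e = c.sum fun s a =>
      ∑ i : Fin (n + 1), if face i s = e then a * (-1 : ℚ) ^ (i : ℕ) else 0 := by
  induction c using Finsupp.induction_linear with
  | zero => simp
  | add f g hf hg =>
    rw [map_add, Finsupp.add_apply, hf, hg, Finsupp.sum_add_index']
    · simp
    · intro s a b
      rw [← Finset.sum_add_distrib]
      refine Finset.sum_congr rfl fun i _ => ?_
      split_ifs <;> ring
  | single s a =>
    rw [boundary_single, Finsupp.sum_single_index (by simp), Finsupp.finsetSum_apply]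
    refine Finset.sum_congr rfl fun i _ => ?_
    rw [Finsupp.single_apply]

/-- If the position of an element in a chain is determined by the element, a cycle vanishes at
the chain `s` as soon as it vanishes at all other chains that share a given face with `s`. -/
theorem apply_eq_zero_of_boundary_eq_zero {n : ℕ} (rk : P → ℕ)
    (hrk : ∀ (s : Fin (n + 1) ↪o P) i, rk (s i) = i + 1) {c : Chains P (n + 1)}
    (hc : boundary P n c = 0) (s : Fin (n + 1) ↪o P) (j : Fin (n + 1))
    (h : ∀ s', face j s' = face j s → s' ≠ s → c s' = 0) : c s = 0 := by
  classical
  -- The ranks that occur in a face reveal which position was omitted.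
  have hij : ∀ (s' : Fin (n + 1) ↪o P) i, face i s' = face j s → i = j := by
    intro s' i hi
    apply Fin.succAbove_left_injective
    funext k
    have h1 := congrArg (fun e : Fin n ↪o P => rk (e k)) hi
    simp only [face_apply, hrk] at h1
    exact Fin.ext (by omega)
  have h0 := boundary_apply c (face j s)
  rw [hc, Finsupp.sum_eq_single s] at h0
  · rw [Finset.sum_eq_single j] at h0
    · simpa using h0
    · intro i _ hi
      rw [if_neg fun h' => hi (hij s i h')]
    · simp
  · intro s' hs' hne
    refine Finset.sum_eq_zero fun i _ => ?_
    split_ifs with hi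
    · obtain rfl := hij s' i hi
      exact absurd (h s' hi hne) hs'
    · rfl
  · simp

/-- Without longer chains the space of boundaries is zero, so homology is the cycle space itself. -/
theorem nontrivial_reducedHomology_iff (n : ℕ) [IsEmpty (Fin (n + 1) ↪o P)] :
    Nontrivial (ReducedHomology P n) ↔ ∃ c ∈ cycles P n, c ≠ 0 := by
  have h0 : LinearMap.range (boundary P n) = ⊥ := by
    rw [LinearMap.range_eq_bot]
    exact LinearMap.ext fun x => by rw [Subsingleton.elim x 0, map_zero, map_zero]
  rw [ReducedHomology, Submodule.Quotient.nontrivial_iff, h0, Submodule.submoduleOf, Ne,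
    Submodule.eq_top_iff']
  simp

/-- The chain map induced by an order embedding. -/
noncomputable def chainsMap (f : P ↪o Q) (n : ℕ) : Chains P n →ₗ[ℚ] Chains Q n :=
  Finsupp.lmapDomain ℚ ℚ fun s => s.trans f

theorem chainsMap_injective (f : P ↪o Q) (n : ℕ) : Function.Injective (chainsMap f n) :=
  Finsupp.mapDomain_injective fun s t h => by
    ext i
    exact f.injective (congrArg (fun e : Fin n ↪o Q => e i) h)

theorem boundary_chainsMap (f : P ↪o Q) (n : ℕ) (c : Chains P (n + 1)) :
    boundary Q n (chainsMap f (n + 1) c) = chainsMap f n (boundary P n c) := by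
  induction c using Finsupp.induction_linear with
  | zero => simp
  | add a b ha hb => simp only [map_add, ha, hb]
  | single s a =>
    rw [boundary_single, chainsMap, Finsupp.lmapDomain_apply, Finsupp.mapDomain_single,
      boundary_single, map_sum]
    refine Finset.sum_congr rfl fun i _ => ?_
    rw [chainsMap, Finsupp.lmapDomain_apply, Finsupp.mapDomain_single]
    rfl

theorem chainsMap_mem_cycles (f : P ↪o Q) {n : ℕ} {c : Chains P n} (hc : c ∈ cycles P n) :
    chainsMap f n c ∈ cycles Q n := by
  cases n with
  | zero => trivial
  | succ n =>
    change boundary Q n _ = 0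
    rw [boundary_chainsMap, show boundary P n c = 0 from hc, map_zero]

end Homology

/-! ### Elementary abelian subgroups, the 2-rank and chains of full length -/

section Groups

variable {G : Type u} [Group G] {G' : Type v} [Group G']

theorem IsElemAbelian.map {p : ℕ} {A : Subgroup G} (hA : IsElemAbelian p A) (f : G →* G') :
    IsElemAbelian p (A.map f) := by
  constructor
  · rintro _ ⟨a, ha, rfl⟩ _ ⟨b, hb, rfl⟩
    rw [← map_mul, hA.1 a ha b hb, map_mul]
  · rintro _ ⟨a, ha, rfl⟩
    rw [← map_pow, hA.2 a ha, map_one]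

theorem IsElemAbelian.mono {p : ℕ} {A B : Subgroup G} (hA : IsElemAbelian p A) (h : B ≤ A) :
    IsElemAbelian p B :=
  ⟨fun a ha b hb => hA.1 a (h ha) b (h hb), fun a ha => hA.2 a (h ha)⟩

theorem isElemAbelian_two_of_sq {A : Subgroup G} (hA : ∀ a ∈ A, a ^ 2 = 1) :
    IsElemAbelian 2 A := by
  refine ⟨fun a ha b hb => ?_, hA⟩
  have h1 := hA a ha
  have h2 := hA b hb
  have h3 := hA _ (A.mul_mem ha hb)
  rw [sq] at h1 h2 h3
  have h4 : a⁻¹ = a := inv_eq_of_mul_eq_one_left h1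
  have h5 : b⁻¹ = b := inv_eq_of_mul_eq_one_left h2
  have h6 : (a * b)⁻¹ = a * b := inv_eq_of_mul_eq_one_left h3
  rw [← h6, mul_inv_rev, h4, h5]

/-- The order embedding of Quillen posets induced by an injective homomorphism. -/
def quillenMap (p : ℕ) (f : G →* G') (hf : Function.Injective f) :
    QuillenPoset p G ↪o QuillenPoset p G' where
  toFun A := ⟨A.1.map f, A.2.1.map f, fun h => A.2.2 ((Subgroup.map_eq_bot_iff_of_injective _ hf).1 h)⟩
  inj' _ _ h := Subtype.ext (Subgroup.map_injective hf (congrArg Subtype.val h))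
  map_rel_iff' := Subgroup.map_le_map_iff_of_injective hf

theorem IsElemAbelian.exists_card [Finite G] {A : Subgroup G} (hA : IsElemAbelian 2 A) :
    ∃ r, Nat.card A = 2 ^ r :=
  IsPGroup.iff_card.1 fun a => ⟨1, Subtype.ext (by simpa using hA.2 a a.2)⟩

theorem bddAbove_pRank [Finite G] :
    BddAbove {r : ℕ | ∃ A : Subgroup G, IsElemAbelian 2 A ∧ Nat.card A = 2 ^ r} := by
  refine ⟨Nat.card G, ?_⟩
  rintro r ⟨A, -, hA⟩
  have h1 : 2 ^ r ≤ Nat.card G := hA ▸ Subgroup.card_le_card_group A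
  exact (Nat.lt_two_pow_self).le.trans h1

theorem card_le_two_pow_pRank [Finite G] {A : Subgroup G} (hA : IsElemAbelian 2 A) :
    Nat.card A ≤ 2 ^ pRank 2 G := by
  obtain ⟨r, hr⟩ := hA.exists_card
  rw [hr]
  exact Nat.pow_le_pow_right two_pos (le_csSup bddAbove_pRank ⟨A, hA, hr⟩)

theorem pRank_eq [Finite G] {r : ℕ} (h : ∃ A : Subgroup G, IsElemAbelian 2 A ∧ Nat.card A = 2 ^ r)
    (h' : ∀ A : Subgroup G, IsElemAbelian 2 A → Nat.card A ≤ 2 ^ r) : pRank 2 G = r := by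
  refine le_antisymm (csSup_le ⟨r, h⟩ ?_) (le_csSup bddAbove_pRank h)
  rintro k ⟨A, hA, hk⟩
  exact (Nat.pow_le_pow_iff_right (by norm_num)).1 (hk ▸ h' A hA)

theorem exists_card_eq_two_pow_pRank (G : Type u) [Group G] [Finite G] :
    ∃ A : Subgroup G, IsElemAbelian 2 A ∧ Nat.card A = 2 ^ pRank 2 G :=
  Nat.sSup_mem (s := {r : ℕ | ∃ A : Subgroup G, IsElemAbelian 2 A ∧ Nat.card A = 2 ^ r})
    ⟨0, ⊥, ⟨by simp, by simp⟩, by simp⟩ bddAbove_pRank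

theorem pRank_le_of_injective [Finite G] [Finite G'] (f : G →* G') (hf : Function.Injective f) :
    pRank 2 G ≤ pRank 2 G' := by
  obtain ⟨A, hA, hc⟩ := exists_card_eq_two_pow_pRank G
  refine le_csSup bddAbove_pRank ⟨A.map f, hA.map f, ?_⟩
  rw [← hc, Subgroup.card_map_of_injective hf]

/-- The rank of an elementary abelian subgroup. -/
noncomputable def rk (A : QuillenPoset 2 G) : ℕ := Nat.log 2 (Nat.card A.1)

theorem card_eq_two_pow_rk [Finite G] (A : QuillenPoset 2 G) : Nat.card A.1 = 2 ^ rk A := by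
  obtain ⟨r, hr⟩ := A.2.1.exists_card
  rw [rk, hr, Nat.log_pow (by norm_num)]

theorem rk_strictMono [Finite G] : StrictMono (rk (G := G)) := by
  intro A B h
  have h1 : Nat.card A.1 < Nat.card B.1 :=
    lt_of_le_of_ne (Subgroup.card_le_of_le h.le) fun hc =>
      h.ne (Subtype.ext (Subgroup.eq_of_le_of_card_ge h.le hc.ge))
  rw [card_eq_two_pow_rk, card_eq_two_pow_rk] at h1
  exact (Nat.pow_lt_pow_iff_right (by norm_num)).1 h1

theorem rk_pos [Finite G] (A : QuillenPoset 2 G) : 0 < rk A := by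
  rw [Nat.pos_iff_ne_zero]
  intro h
  have h1 := card_eq_two_pow_rk A
  rw [h, pow_zero] at h1
  exact A.2.2 (Subgroup.card_eq_one.1 h1)

theorem rk_le [Finite G] (A : QuillenPoset 2 G) : rk A ≤ pRank 2 G :=
  (Nat.pow_le_pow_iff_right (by norm_num)).1 (card_eq_two_pow_rk A ▸ card_le_two_pow_pRank A.2.1)

theorem lt_rk_apply [Finite G] {n : ℕ} (s : Fin n ↪o QuillenPoset 2 G) (i : Fin n) :
    (i : ℕ) < rk (s i) := by
  obtain ⟨k, hk⟩ := i
  induction k with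
  | zero => exact rk_pos _
  | succ k ih =>
    have h1 := rk_strictMono (s.strictMono (show (⟨k, by omega⟩ : Fin n) < ⟨k + 1, hk⟩ by simp))
    have h2 := ih (by omega)
    simp only at h1 h2 ⊢
    omega

theorem isEmpty_chains [Finite G] : IsEmpty (Fin (pRank 2 G + 1) ↪o QuillenPoset 2 G) :=
  ⟨fun s => by
    have h1 := lt_rk_apply s (Fin.last _)
    have h2 := rk_le (s (Fin.last _))
    simp at h1
    omega⟩

/-- Ranks grow strictly along a chain, from at least 1 to at most the 2-rank, so a chain of full
length skips no rank. This is what makes `apply_eq_zero_of_boundary_eq_zero` applicable. -/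
theorem rk_apply [Finite G] {n : ℕ} (hn : pRank 2 G = n + 1)
    (s : Fin (n + 1) ↪o QuillenPoset 2 G) (i : Fin (n + 1)) : rk (s i) = i + 1 := by
  have key : ∀ d, d ≤ n → ∀ i : Fin (n + 1), (i : ℕ) + d = n → rk (s i) + d ≤ n + 1 := by
    intro d
    induction d with
    | zero => exact fun _ i _ => (rk_le _).trans hn.le
    | succ d ih =>
      intro hd i hi
      have h1 := ih (by omega) ⟨i + 1, by omega⟩ (by simp only; omega)
      have h2 := rk_strictMono (s.strictMono (show i < ⟨i + 1, by omega⟩ by simp [Fin.lt_def]))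
      omega
  have h1 := key (n - i) (by omega) i (by omega)
  have h2 := lt_rk_apply s i
  omega

theorem quillenDimension_iff [Finite G] :
    QuillenDimension 2 G ↔ ∃ c ∈ cycles (QuillenPoset 2 G) (pRank 2 G), c ≠ 0 := by
  have := isEmpty_chains (G := G)
  exact nontrivial_reducedHomology_iff _

theorem quillenDimension_iff_boundary [Finite G] {n : ℕ} (hn : pRank 2 G = n + 1) :
    QuillenDimension 2 G ↔
      ∃ c : Chains (QuillenPoset 2 G) (n + 1), boundary _ n c = 0 ∧ c ≠ 0 := by
  rw [quillenDimension_iff, hn]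
  rfl

/-- The chain map of an embedding is injective, and equality of ranks ensures that the image cycle
again lies in top degree, where it cannot be a boundary. -/
theorem QuillenDimension.of_injective [Finite G] [Finite G'] (f : G →* G')
    (hf : Function.Injective f) (hr : pRank 2 G = pRank 2 G') (h : QuillenDimension 2 G) :
    QuillenDimension 2 G' := by
  rw [quillenDimension_iff] at h ⊢
  obtain ⟨c, hc, h0⟩ := h
  rw [← hr]
  refine ⟨chainsMap (quillenMap 2 f hf) _ c, chainsMap_mem_cycles _ hc, ?_⟩
  rwa [Ne, map_eq_zero_iff _ (chainsMap_injective _ _)]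

theorem pRank_congr [Finite G] [Finite G'] (e : G ≃* G') : pRank 2 G = pRank 2 G' :=
  le_antisymm (pRank_le_of_injective e.toMonoidHom e.injective)
    (pRank_le_of_injective e.symm.toMonoidHom e.symm.injective)

theorem quillenDimension_congr [Finite G] [Finite G'] (e : G ≃* G') :
    QuillenDimension 2 G ↔ QuillenDimension 2 G' :=
  ⟨.of_injective e.toMonoidHom e.injective (pRank_congr e),
    .of_injective e.symm.toMonoidHom e.symm.injective (pRank_congr e).symm⟩

end Groups

/-! ### Explicit chains of two and three members -/

section Chains

variable {P : Type u} [PartialOrder P]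

/-- The chain `a < b`. -/
def chainPair {a b : P} (h : a < b) : Fin 2 ↪o P :=
  OrderEmbedding.ofStrictMono ![a, b] (by
    rw [Fin.strictMono_iff_lt_succ]
    intro i
    fin_cases i
    exact h)

/-- The chain `a < b < c`. -/
def chainTriple {a b c : P} (h : a < b) (h' : b < c) : Fin 3 ↪o P :=
  OrderEmbedding.ofStrictMono ![a, b, c] (by
    rw [Fin.strictMono_iff_lt_succ]
    intro i
    fin_cases i
    · exact h
    · exact h')

theorem boundary_chainTriple {a b c : P} (h : a < b) (h' : b < c) :
    boundary P 2 (Finsupp.single (chainTriple h h') 1) =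
      Finsupp.single (chainPair h') 1 - Finsupp.single (chainPair (h.trans h')) 1 +
        Finsupp.single (chainPair h) 1 := by
  have h0 : face 0 (chainTriple h h') = chainPair h' := by
    ext i; fin_cases i <;> rfl
  have h1 : face 1 (chainTriple h h') = chainPair (h.trans h') := by
    ext i; fin_cases i <;> rfl
  have h2 : face 2 (chainTriple h h') = chainPair h := by
    ext i; fin_cases i <;> rfl
  rw [boundary_single, Fin.sum_univ_three, h0, h1, h2]
  simp [sub_eq_add_neg]

end Chains

/-! ### Rank two: the graph of involutions and four-groups -/

section Groups

variable {G : Type u} [Group G]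

/-- The element `z` has order two. -/
def IsInvol (z : G) : Prop := z ^ 2 = 1 ∧ z ≠ 1

/-- The subgroup `V` is elementary abelian of order four. -/
def IsFour (V : Subgroup G) : Prop := IsElemAbelian 2 V ∧ Nat.card V = 4

theorem IsInvol.mul_self {z : G} (hz : IsInvol z) : z * z = 1 := by rw [← sq, hz.1]

theorem mem_zpowers_iff_of_sq {z x : G} (hz : z ^ 2 = 1) :
    x ∈ Subgroup.zpowers z ↔ x = 1 ∨ x = z := by
  constructor
  · rintro ⟨k, rfl⟩
    rcases Int.even_or_odd' k with ⟨m, rfl | rfl⟩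
    · left
      simp only [zpow_mul]
      rw [show z ^ (2 : ℤ) = 1 by exact_mod_cast hz, one_zpow]
    · right
      simp only [zpow_add, zpow_mul]
      rw [show z ^ (2 : ℤ) = 1 by exact_mod_cast hz, one_zpow, one_mul, zpow_one]
  · rintro (rfl | rfl)
    · exact one_mem _
    · exact Subgroup.mem_zpowers _

theorem isElemAbelian_zpowers {z : G} (hz : z ^ 2 = 1) : IsElemAbelian 2 (Subgroup.zpowers z) :=
  isElemAbelian_two_of_sq fun a ha => by
    rcases (mem_zpowers_iff_of_sq hz).1 ha with rfl | rfl
    · exact one_pow 2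
    · exact hz

/-- The vertex of the Quillen poset given by an involution. -/
def vertex {z : G} (hz : IsInvol z) : QuillenPoset 2 G :=
  ⟨Subgroup.zpowers z, isElemAbelian_zpowers hz.1, by rw [Ne, Subgroup.zpowers_eq_bot]; exact hz.2⟩

theorem zpowers_injOn {z z' : G} (hz : IsInvol z) (hz' : IsInvol z')
    (h : Subgroup.zpowers z = Subgroup.zpowers z') : z = z' := by
  have h1 : z ∈ Subgroup.zpowers z' := h ▸ Subgroup.mem_zpowers z
  exact ((mem_zpowers_iff_of_sq hz'.1).1 h1).resolve_left hz.2

theorem card_zpowers {z : G} (hz : IsInvol z) : Nat.card (Subgroup.zpowers z) = 2 := by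
  rw [Nat.card_zpowers]
  exact orderOf_eq_prime hz.1 hz.2

/-- The vertex of the Quillen poset given by a subgroup of order four. -/
def IsFour.vertex {V : Subgroup G} (hV : IsFour V) : QuillenPoset 2 G :=
  ⟨V, hV.1, fun h => by have := hV.2; rw [h] at this; simp at this⟩

theorem IsFour.isInvol {V : Subgroup G} (hV : IsFour V) {z : G} (hz : z ∈ V) (h1 : z ≠ 1) :
    IsInvol z := ⟨hV.1.2 z hz, h1⟩

theorem IsFour.card_ne_one {V : Subgroup G} (hV : IsFour V) :
    Nat.card {z : G // z ∈ V ∧ z ≠ 1} = 3 := by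
  have : Finite V := Nat.finite_of_card_ne_zero (by rw [hV.2]; norm_num)
  have h1 : Nat.card {z : V // z ≠ 1} = 3 := by
    have := Fintype.ofFinite V
    classical
    rw [Nat.card_eq_fintype_card, Fintype.card_subtype_compl, Fintype.card_subtype_eq,
      ← Nat.card_eq_fintype_card, hV.2]
  rw [← h1]
  exact Nat.card_congr
    { toFun := fun z => ⟨⟨z.1, z.2.1⟩, fun h => z.2.2 (congrArg Subtype.val h)⟩
      invFun := fun z => ⟨z.1.1, z.1.2, fun h => z.2 (Subtype.ext h)⟩
      left_inv := fun _ => rfl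
      right_inv := fun _ => rfl }

theorem IsFour.zpowers_lt {V : Subgroup G} (hV : IsFour V) {z : G} (hz : z ∈ V) (h1 : z ≠ 1) :
    Subgroup.zpowers z < V := by
  refine lt_of_le_of_ne ((Subgroup.zpowers_le).2 hz) fun h => ?_
  have h2 := card_zpowers (hV.isInvol hz h1)
  rw [h, hV.2] at h2
  norm_num at h2

theorem exists_eq_vertex [Finite G] {A : QuillenPoset 2 G} (hA : rk A = 1) :
    ∃ z, ∃ hz : IsInvol z, A = vertex hz := by
  obtain ⟨⟨z, hzA⟩, hz'⟩ := Subgroup.ne_bot_iff_exists_ne_one.1 A.2.2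
  have hz : z ≠ 1 := fun h => hz' (Subtype.ext h)
  have hi : IsInvol z := ⟨A.2.1.2 z hzA, hz⟩
  refine ⟨z, hi, Subtype.ext (Subgroup.eq_of_le_of_card_ge ((Subgroup.zpowers_le).2 hzA) ?_).symm⟩
  rw [card_zpowers hi, card_eq_two_pow_rk, hA, pow_one]

theorem isFour_of_rk [Finite G] {A : QuillenPoset 2 G} (hA : rk A = 2) : IsFour A.1 :=
  ⟨A.2.1, by rw [card_eq_two_pow_rk, hA]; norm_num⟩

instance finite_chains {P : Type u} [PartialOrder P] [Finite P] (n : ℕ) : Finite (Fin n ↪o P) :=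
  Finite.of_injective (fun s : Fin n ↪o P => (s : Fin n → P)) DFunLike.coe_injective

/-- With `E` edges there are at most `E / 2` involutions, each lying on two edges or more, and at
most `E / 3` four-groups, each containing three involutions. So there are at most `5E / 6` vertices.
-/
theorem card_chains_one_lt [Finite G] (hr : pRank 2 G = 2) (hne : ∃ z : G, IsInvol z)
    (h : ∀ z : G, IsInvol z → ∃ V W : Subgroup G, IsFour V ∧ IsFour W ∧ z ∈ V ∧ z ∈ W ∧ V ≠ W) :
    Nat.card (Fin 1 ↪o QuillenPoset 2 G) < Nat.card (Fin 2 ↪o QuillenPoset 2 G) := by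
  classical
  have hfin : Finite (QuillenPoset 2 G) := inferInstance
  have := Fintype.ofFinite (QuillenPoset 2 G)
  set E : Finset (QuillenPoset 2 G × QuillenPoset 2 G) :=
    Finset.univ.filter fun x => x.1 < x.2 with hE
  have hP : Nat.card (Fin 1 ↪o QuillenPoset 2 G) ≤ Fintype.card (QuillenPoset 2 G) := by
    rw [← Nat.card_eq_fintype_card]
    refine Nat.card_le_card_of_injective (fun s => s 0) fun s t hst => ?_
    ext i : 1
    rw [Subsingleton.elim i 0]
    exact hst
  have hEc : E.card ≤ Nat.card (Fin 2 ↪o QuillenPoset 2 G) := by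
    rw [← Nat.card_eq_finsetCard]
    refine Nat.card_le_card_of_injective
      (fun x => chainPair (Finset.mem_filter.1 x.2).2) fun x y hxy => ?_
    exact Subtype.ext (Prod.ext (congrArg (fun s : Fin 2 ↪o QuillenPoset 2 G => s 0) hxy)
      (congrArg (fun s : Fin 2 ↪o QuillenPoset 2 G => s 1) hxy))
  set P1 : Finset (QuillenPoset 2 G) := Finset.univ.filter fun A => rk A = 1 with hP1
  set P2 : Finset (QuillenPoset 2 G) := Finset.univ.filter fun A => rk A = 2 with hP2
  have hEmem : ∀ x ∈ E, x.1 ∈ P1 ∧ x.2 ∈ P2 := by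
    intro x hx
    have h0 := rk_strictMono (Finset.mem_filter.1 hx).2
    have h1 := rk_pos x.1
    have h2 := rk_le x.2
    simp only [hP1, hP2, Finset.mem_filter, Finset.mem_univ, true_and]
    omega
  have hsum : Fintype.card (QuillenPoset 2 G) ≤ P1.card + P2.card := by
    rw [← Finset.card_univ]
    refine (Finset.card_le_card fun A _ => ?_).trans (Finset.card_union_le P1 P2)
    have h1 := rk_pos A
    have h2 := rk_le A
    simp only [hP1, hP2, Finset.mem_filter, Finset.mem_univ, true_and, Finset.mem_union]
    omega
  have hE1 : P1.card * 2 ≤ E.card := by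
    rw [Finset.card_eq_sum_card_fiberwise (f := Prod.fst) (t := P1) fun x hx => (hEmem x hx).1]
    refine Finset.card_nsmul_le_sum _ _ 2 fun A hA => ?_
    obtain ⟨z, hz, rfl⟩ := exists_eq_vertex (Finset.mem_filter.1 hA).2
    obtain ⟨V, W, hV, hW, hzV, hzW, hVW⟩ := h z hz
    have hne : (vertex hz, hV.vertex) ≠ (vertex hz, hW.vertex) := fun h' =>
      hVW (congrArg (fun x : QuillenPoset 2 G × QuillenPoset 2 G => x.2.1) h')
    refine (Finset.card_pair hne).symm.le.trans (Finset.card_le_card fun x hx => ?_)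
    simp only [Finset.mem_insert, Finset.mem_singleton] at hx
    simp only [hE, Finset.mem_filter, Finset.mem_univ, true_and]
    rcases hx with rfl | rfl
    · exact ⟨hV.zpowers_lt hzV hz.2, rfl⟩
    · exact ⟨hW.zpowers_lt hzW hz.2, rfl⟩
  have hE2 : P2.card * 3 ≤ E.card := by
    rw [Finset.card_eq_sum_card_fiberwise (f := Prod.snd) (t := P2) fun x hx => (hEmem x hx).2]
    refine Finset.card_nsmul_le_sum _ _ 3 fun A hA => ?_
    have hV := isFour_of_rk (Finset.mem_filter.1 hA).2
    rw [← hV.card_ne_one, ← Nat.card_eq_finsetCard]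
    refine Nat.card_le_card_of_injective (fun z => ⟨(vertex (hV.isInvol z.2.1 z.2.2), A), ?_⟩) ?_
    · simp only [hE, Finset.mem_filter, Finset.mem_univ, true_and, and_true]
      exact hV.zpowers_lt z.2.1 z.2.2
    · intro z z' hzz
      have := congrArg (fun x => x.1.1.1) hzz
      exact Subtype.ext (zpowers_injOn (hV.isInvol z.2.1 z.2.2) (hV.isInvol z'.2.1 z'.2.2) this)
  have hpos : 0 < Fintype.card (QuillenPoset 2 G) := by
    obtain ⟨z, hz⟩ := hne
    exact Fintype.card_pos_iff.2 ⟨vertex hz⟩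
  omega

/-- With more edges than vertices, the boundary map has a kernel for dimension reasons. -/
theorem quillenDimension_of_two_le [Finite G] (hr : pRank 2 G = 2) (hne : ∃ z : G, IsInvol z)
    (h : ∀ z : G, IsInvol z → ∃ V W : Subgroup G, IsFour V ∧ IsFour W ∧ z ∈ V ∧ z ∈ W ∧ V ≠ W) :
    QuillenDimension 2 G := by
  have h1 := card_chains_one_lt hr hne h
  have : Finite (QuillenPoset 2 G) := inferInstance
  have := fun n => Fintype.ofFinite (Fin n ↪o QuillenPoset 2 G)
  rw [Nat.card_eq_fintype_card, Nat.card_eq_fintype_card] at h1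
  have h2 : LinearMap.ker (boundary (QuillenPoset 2 G) 1) ≠ ⊥ := by
    apply LinearMap.ker_ne_bot_of_finrank_lt
    rwa [Module.finrank_finsupp_self, Module.finrank_finsupp_self]
  obtain ⟨c, hc, h0⟩ := (Submodule.ne_bot_iff _).1 h2
  exact (quillenDimension_iff_boundary (n := 1) hr).2 ⟨c, hc, h0⟩

/-- Every involution is on at most one edge, and a cycle vanishes on an edge with a free end. -/
theorem not_quillenDimension_of_unique [Finite G] (hr : pRank 2 G = 2)
    (h : ∀ z : G, IsInvol z → ∀ V W : Subgroup G, IsFour V → IsFour W → z ∈ V → z ∈ W → V = W) :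
    ¬ QuillenDimension 2 G := by
  rw [quillenDimension_iff_boundary (n := 1) hr]
  rintro ⟨c, hc, h0⟩
  refine h0 (Finsupp.ext fun s => ?_)
  refine apply_eq_zero_of_boundary_eq_zero rk (fun s i => rk_apply hr s i) hc s 1 fun s' hs' hne => ?_
  have e0 : s' 0 = s 0 := congrArg (fun e : Fin 1 ↪o QuillenPoset 2 G => e 0) hs'
  have hlt : ∀ r : Fin 2 ↪o QuillenPoset 2 G, r 0 < r 1 := fun r => r.strictMono (by decide)
  obtain ⟨z, hz, hzs⟩ := exists_eq_vertex (rk_apply hr s 0)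
  have hzm : ∀ r : Fin 2 ↪o QuillenPoset 2 G, r 0 = s 0 → z ∈ (r 1).1 := fun r hr' => by
    have h1 : (r 0).1 ≤ (r 1).1 := (hlt r).le
    rw [hr', hzs] at h1
    exact h1 (Subgroup.mem_zpowers z)
  have e1 : s' 1 = s 1 := Subtype.ext (h z hz _ _ (isFour_of_rk (rk_apply hr s' 1))
    (isFour_of_rk (rk_apply hr s 1)) (hzm s' e0) (hzm s rfl))
  refine absurd ?_ hne
  ext i : 1
  fin_cases i
  · exact e0
  · exact e1

end Groups

/-! ### Weights with vanishing sums along three fibrations -/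

section FiberSums

/-- On each fiber `f` is constant and factors out of a sum of weights that is zero. -/
theorem sum_smul_eq_zero_of_fiber_sums {E X M : Type*} [Fintype E] [Fintype X] [DecidableEq X]
    [AddCommGroup M] [Module ℚ M] {a : E → X} {w : E → ℚ}
    (h : ∀ x, ∑ e with a e = x, w e = 0) (f : E → M) (hf : ∀ e e', a e = a e' → f e = f e') :
    ∑ e, w e • f e = 0 := by
  rw [← Finset.sum_fiberwise Finset.univ a]
  refine Finset.sum_eq_zero fun x _ => ?_
  by_cases hx : ∃ e, a e = x
  · obtain ⟨e0, rfl⟩ := hx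
    rw [Finset.sum_congr rfl fun e he => by rw [hf e e0 (Finset.mem_filter.1 he).2],
      ← Finset.sum_smul, h, zero_smul]
  · rw [Finset.filter_false_of_mem fun e _ he => hx ⟨e, he⟩, Finset.sum_empty]

/-- The fiber sums along `a` and the fiber sums along `b` have the same total, so that one of these
linear conditions is redundant. -/
theorem exists_ne_zero_fiber_sums_eq_zero {E X Y Z : Type*} [Fintype E] [Fintype X] [Fintype Y]
    [Fintype Z] [DecidableEq X] [DecidableEq Y] [DecidableEq Z] (a : E → X) (b : E → Y) (d : E → Z)
    [Nonempty X] (h : Fintype.card X + Fintype.card Y + Fintype.card Z ≤ Fintype.card E) :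
    ∃ w : E → ℚ, w ≠ 0 ∧ (∀ x, ∑ e with a e = x, w e = 0) ∧ (∀ y, ∑ e with b e = y, w e = 0) ∧
      ∀ z, ∑ e with d e = z, w e = 0 := by
  obtain ⟨x0⟩ := ‹Nonempty X›
  -- The condition at `x0` is left out; this makes the target strictly smaller than the source even
  -- when `h` is an equality.
  let Φ : (E → ℚ) →ₗ[ℚ] ({x // x ≠ x0} → ℚ) × (Y → ℚ) × (Z → ℚ) :=
    LinearMap.prod (LinearMap.pi fun x => ∑ e with a e = x, LinearMap.proj e)
      (LinearMap.prod (LinearMap.pi fun y => ∑ e with b e = y, LinearMap.proj e)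
        (LinearMap.pi fun z => ∑ e with d e = z, LinearMap.proj e))
  have hker : LinearMap.ker Φ ≠ ⊥ := by
    apply LinearMap.ker_ne_bot_of_finrank_lt
    have hX : 0 < Fintype.card X := Fintype.card_pos_iff.2 ⟨x0⟩
    rw [Module.finrank_prod, Module.finrank_prod]
    simp only [Module.finrank_fintype_fun_eq_card, Fintype.card_subtype_compl,
      Fintype.card_subtype_eq]
    omega
  obtain ⟨w, hw, hw0⟩ := (Submodule.ne_bot_iff _).1 hker
  have hΦ : Φ w = 0 := hw
  have ha : ∀ x, x ≠ x0 → ∑ e with a e = x, w e = 0 := fun x hx => by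
    simpa [Φ] using congrFun (congrArg Prod.fst hΦ) ⟨x, hx⟩
  have hb : ∀ y, ∑ e with b e = y, w e = 0 := fun y => by
    simpa [Φ] using congrFun (congrArg (fun p => p.2.1) hΦ) y
  have hd : ∀ z, ∑ e with d e = z, w e = 0 := fun z => by
    simpa [Φ] using congrFun (congrArg (fun p => p.2.2) hΦ) z
  refine ⟨w, hw0, fun x => ?_, hb, hd⟩
  by_cases hx : x = x0
  · have h1 : ∑ x, ∑ e with a e = x, w e = ∑ y, ∑ e with b e = y, w e := by
      rw [Finset.sum_fiberwise, Finset.sum_fiberwise]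
    rw [Finset.sum_eq_zero fun y _ => hb y, Finset.sum_eq_single x0 (fun x _ hx => ha x hx)
      (by simp)] at h1
    rw [hx, h1]
  · exact ha x hx

end FiberSums

theorem chainPair_congr {P : Type u} [PartialOrder P] {a b a' b' : P} (ha : a = a') (hb : b = b')
    (h : a < b) (h' : a' < b') : chainPair h = chainPair h' := by
  subst ha hb
  rfl

/-! ### Rank three: cycles made of triangles over outer involutions -/

section Groups

variable {G : Type u} [Group G]

/-- The subgroup generated by `B` and an involution `t` that centralizes `B`. -/
def adjoin (t : G) (B : Subgroup G) (ht : t ^ 2 = 1) (hc : ∀ b ∈ B, Commute t b) :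
    Subgroup G where
  carrier := {x | ∃ b ∈ B, x = b ∨ x = t * b}
  one_mem' := ⟨1, one_mem _, Or.inl rfl⟩
  mul_mem' := by
    have htt : t * t = 1 := by rw [← sq, ht]
    rintro _ _ ⟨b, hb, rfl | rfl⟩ ⟨c, hc', rfl | rfl⟩
    · exact ⟨_, mul_mem hb hc', Or.inl rfl⟩
    · exact ⟨_, mul_mem hb hc', Or.inr (by rw [← mul_assoc, ← (hc _ hb).eq, mul_assoc])⟩
    · exact ⟨_, mul_mem hb hc', Or.inr (by rw [mul_assoc])⟩
    · exact ⟨_, mul_mem hb hc', Or.inl (by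
        rw [(hc _ hb).eq, mul_assoc, ← mul_assoc t, htt, one_mul])⟩
  inv_mem' := by
    have htt : t⁻¹ = t := inv_eq_of_mul_eq_one_left (by rw [← sq, ht])
    rintro _ ⟨b, hb, rfl | rfl⟩
    · exact ⟨_, inv_mem hb, Or.inl rfl⟩
    · exact ⟨_, inv_mem hb, Or.inr (by rw [mul_inv_rev, htt, (hc _ (inv_mem hb)).eq])⟩

section adjoin

variable {t : G} {B : Subgroup G} {ht : t ^ 2 = 1} {hc : ∀ b ∈ B, Commute t b}

theorem mem_adjoin {x : G} : x ∈ adjoin t B ht hc ↔ ∃ b ∈ B, x = b ∨ x = t * b := Iff.rfl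

theorem le_adjoin : B ≤ adjoin t B ht hc := fun b hb => ⟨b, hb, Or.inl rfl⟩

theorem self_mem_adjoin : t ∈ adjoin t B ht hc := ⟨1, one_mem _, Or.inr (mul_one t).symm⟩

theorem isElemAbelian_adjoin (hB : IsElemAbelian 2 B) : IsElemAbelian 2 (adjoin t B ht hc) :=
  isElemAbelian_two_of_sq fun x hx => by
    obtain ⟨b, hb, rfl | rfl⟩ := hx
    · exact hB.2 _ hb
    · rw [(hc b hb).mul_pow, ht, hB.2 b hb, one_mul]

/-- The coset `tB` misses `N`, so `B` is recovered as the intersection of `⟨t⟩ × B` with `N`. -/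
theorem mem_of_mem_adjoin {N : Subgroup G} (hBN : B ≤ N) (htN : t ∉ N) {x : G}
    (hx : x ∈ adjoin t B ht hc) (hxN : x ∈ N) : x ∈ B := by
  obtain ⟨b, hb, rfl | rfl⟩ := hx
  · exact hb
  · exact absurd ((N.mul_mem_cancel_right (hBN hb)).1 hxN) htN

theorem adjoin_mono {C : Subgroup G} {hc' : ∀ b ∈ C, Commute t b} (h : B ≤ C) :
    adjoin t B ht hc ≤ adjoin t C ht hc' := fun _ ⟨b, hb, hx⟩ => ⟨b, h hb, hx⟩

theorem adjoin_injective {N C : Subgroup G} (hBN : B ≤ N) (hCN : C ≤ N) (htN : t ∉ N)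
    {hc' : ∀ b ∈ C, Commute t b} (h : adjoin t B ht hc = adjoin t C ht hc') : B = C :=
  le_antisymm (fun _ hx => mem_of_mem_adjoin hCN htN (h ▸ le_adjoin hx) (hBN hx))
    fun _ hx => mem_of_mem_adjoin hBN htN (h ▸ le_adjoin hx) (hCN hx)

theorem adjoin_congr {t' : G} {C : Subgroup G} (h : t = t') (hB : B = C) (ht : t ^ 2 = 1)
    (ht' : t' ^ 2 = 1) (hc : ∀ b ∈ B, Commute t b) (hc' : ∀ b ∈ C, Commute t' b) :
    adjoin t B ht hc = adjoin t' C ht' hc' := by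
  subst h hB
  rfl

/-- The vertex of the Quillen poset given by `⟨t⟩ × B`. -/
def adjoinVertex (ht' : IsInvol t) (hc : ∀ b ∈ B, Commute t b) (hB : IsElemAbelian 2 B) :
    QuillenPoset 2 G :=
  ⟨adjoin t B ht'.1 hc, isElemAbelian_adjoin hB, fun h => ht'.2 (by
    have : t ∈ adjoin t B ht'.1 hc := self_mem_adjoin
    rwa [h, Subgroup.mem_bot] at this)⟩

end adjoin

/-- A flag `⟨z⟩ < V` in `N` with an involution `t` outside of `N` that centralizes it. -/
structure OuterFlag (N : Subgroup G) where
  V : Subgroup G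
  le : V ≤ N
  four : IsFour V
  t : G
  notMem : t ∉ N
  invol : IsInvol t
  comm : ∀ v ∈ V, Commute t v
  z : G
  mem : z ∈ V
  ne : z ≠ 1

namespace OuterFlag

variable {N : Subgroup G} (e : OuterFlag N)

theorem invol_z : IsInvol e.z := e.four.isInvol e.mem e.ne

theorem comm_z : ∀ v ∈ Subgroup.zpowers e.z, Commute e.t v :=
  fun v hv => e.comm v ((Subgroup.zpowers_le).2 e.mem hv)

/-- In the vertices below, `A` and `T` stand for `⟨z⟩` and `⟨t⟩`, while `U = ⟨t, z⟩` and `W = ⟨t⟩ ×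
V` play the role of barycenters. -/
def vA : QuillenPoset 2 G := vertex e.invol_z

def vT : QuillenPoset 2 G := vertex e.invol

def vV : QuillenPoset 2 G := e.four.vertex

def vU : QuillenPoset 2 G := adjoinVertex e.invol e.comm_z (isElemAbelian_zpowers e.invol_z.1)

def vW : QuillenPoset 2 G := adjoinVertex e.invol e.comm e.four.1

theorem zpowers_le : Subgroup.zpowers e.z ≤ N := (Subgroup.zpowers_le).2 (e.le e.mem)

theorem vA_lt_vV : e.vA < e.vV := e.four.zpowers_lt e.mem e.ne

theorem vV_lt_vW : e.vV < e.vW :=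
  lt_of_le_of_ne (le_adjoin (ht := e.invol.1) (hc := e.comm)) fun h => e.notMem (e.le (by
    have h1 : e.V = adjoin e.t e.V e.invol.1 e.comm := congrArg Subtype.val h
    rw [h1]
    exact self_mem_adjoin))

theorem vA_lt_vU : e.vA < e.vU :=
  lt_of_le_of_ne (le_adjoin (ht := e.invol.1) (hc := e.comm_z)) fun h => e.notMem (e.zpowers_le (by
    have h1 : Subgroup.zpowers e.z = adjoin e.t _ e.invol.1 e.comm_z := congrArg Subtype.val h
    rw [h1]
    exact self_mem_adjoin))

theorem vU_lt_vW : e.vU < e.vW := by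
  refine lt_of_le_of_ne (adjoin_mono (ht := e.invol.1) (hc := e.comm_z) (hc' := e.comm)
    e.vA_lt_vV.le) fun h => e.vA_lt_vV.ne (Subtype.ext ?_)
  exact adjoin_injective (ht := e.invol.1) (hc := e.comm_z) (hc' := e.comm) e.zpowers_le e.le
    e.notMem (congrArg Subtype.val h)

theorem vT_lt_vU : e.vT < e.vU := by
  refine lt_of_le_of_ne ((Subgroup.zpowers_le).2 (self_mem_adjoin (ht := e.invol.1)
    (hc := e.comm_z))) fun h => ?_
  have h1 : Subgroup.zpowers e.t = adjoin e.t _ e.invol.1 e.comm_z := congrArg Subtype.val h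
  have h2 : e.z ∈ Subgroup.zpowers e.t := by
    rw [h1]
    exact le_adjoin (Subgroup.mem_zpowers _)
  rcases (mem_zpowers_iff_of_sq e.invol.1).1 h2 with h3 | h3
  · exact e.ne h3
  · exact e.notMem (h3 ▸ e.le e.mem)

/-- The subdivided triangle with vertices `t`, `z` and `V`. -/
noncomputable def triangle : Chains (QuillenPoset 2 G) 3 :=
  Finsupp.single (chainTriple e.vA_lt_vV e.vV_lt_vW) 1 -
    Finsupp.single (chainTriple e.vA_lt_vU e.vU_lt_vW) 1 +
    Finsupp.single (chainTriple e.vT_lt_vU e.vU_lt_vW) 1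

/-- The inner edges `A < W` and `U < W` cancel. The remaining terms are grouped so that each group
forgets one piece of the flag: the first depends on `(V, z)`, the second on `(t, z)`, the third on
`(V, t)`. -/
theorem boundary_triangle : boundary _ 2 e.triangle =
    Finsupp.single (chainPair e.vA_lt_vV) 1 +
      (Finsupp.single (chainPair e.vT_lt_vU) 1 - Finsupp.single (chainPair e.vA_lt_vU) 1) +
      (Finsupp.single (chainPair e.vV_lt_vW) 1 -
        Finsupp.single (chainPair (e.vT_lt_vU.trans e.vU_lt_vW)) 1) := by
  rw [triangle, map_add, map_sub, boundary_chainTriple, boundary_chainTriple, boundary_chainTriple]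
  abel

theorem ext' {e e' : OuterFlag N} (ht : e.t = e'.t) (hz : e.z = e'.z) (hV : e.V = e'.V) :
    e = e' := by
  cases e; cases e'
  simp only at ht hz hV
  subst ht hz hV
  rfl

/-- The chain `T < U < W` determines its flag: `T` gives `t`, and intersecting `U` and `W` with `N`
gives `⟨z⟩` and `V`. So the triangles are linearly independent and the weights can be read off. -/
theorem triangle_apply [DecidableEq (OuterFlag N)] (e e' : OuterFlag N) :
    e'.triangle (chainTriple e.vT_lt_vU e.vU_lt_vW) = if e' = e then 1 else 0 := by
  classical
  have hT : ∀ e' : OuterFlag N, e'.vA ≠ e.vT := fun e' h => by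
    have h1 : Subgroup.zpowers e'.z = Subgroup.zpowers e.t := congrArg Subtype.val h
    exact e.notMem (zpowers_injOn e'.invol_z e.invol h1 ▸ e'.le e'.mem)
  have h1 : chainTriple e'.vA_lt_vV e'.vV_lt_vW ≠ chainTriple e.vT_lt_vU e.vU_lt_vW := fun h =>
    hT e' (congrArg (fun s : Fin 3 ↪o QuillenPoset 2 G => s 0) h)
  have h2 : chainTriple e'.vA_lt_vU e'.vU_lt_vW ≠ chainTriple e.vT_lt_vU e.vU_lt_vW := fun h =>
    hT e' (congrArg (fun s : Fin 3 ↪o QuillenPoset 2 G => s 0) h)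
  rw [triangle, Finsupp.add_apply, Finsupp.sub_apply, Finsupp.single_apply, Finsupp.single_apply,
    Finsupp.single_apply, if_neg h1, if_neg h2, sub_zero, zero_add]
  refine if_congr ⟨fun h => ?_, fun h => by subst h; rfl⟩ rfl rfl
  have hTT : e'.vT = e.vT := congrArg (fun s : Fin 3 ↪o QuillenPoset 2 G => s 0) h
  have hUU : e'.vU = e.vU := congrArg (fun s : Fin 3 ↪o QuillenPoset 2 G => s 1) h
  have hWW : e'.vW = e.vW := congrArg (fun s : Fin 3 ↪o QuillenPoset 2 G => s 2) h
  have ht : e'.t = e.t := zpowers_injOn e'.invol e.invol (congrArg Subtype.val hTT)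
  have key : ∀ {B C : Subgroup G} {hB : ∀ b ∈ B, Commute e'.t b} {hC : ∀ b ∈ C, Commute e.t b},
      B ≤ N → C ≤ N → adjoin e'.t B e'.invol.1 hB = adjoin e.t C e.invol.1 hC → B = C := by
    intro B C hB hC hBN hCN h
    refine le_antisymm (fun x hx => ?_) fun x hx => ?_
    · exact mem_of_mem_adjoin hCN e.notMem (h ▸ le_adjoin hx) (hBN hx)
    · exact mem_of_mem_adjoin hBN e'.notMem (h ▸ le_adjoin hx) (hCN hx)
  refine ext' ht ?_ (key (hB := e'.comm) (hC := e.comm) e'.le e.le (congrArg Subtype.val hWW))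
  exact zpowers_injOn e'.invol_z e.invol_z (key (hB := e'.comm_z) (hC := e.comm_z) e'.zpowers_le
    e.zpowers_le (congrArg Subtype.val hUU))

theorem vA_congr {e e' : OuterFlag N} (hz : e.z = e'.z) : e.vA = e'.vA :=
  Subtype.ext (congrArg Subgroup.zpowers hz)

theorem vT_congr {e e' : OuterFlag N} (ht : e.t = e'.t) : e.vT = e'.vT :=
  Subtype.ext (congrArg Subgroup.zpowers ht)

theorem vV_congr {e e' : OuterFlag N} (hV : e.V = e'.V) : e.vV = e'.vV := Subtype.ext hV

theorem vU_congr {e e' : OuterFlag N} (ht : e.t = e'.t) (hz : e.z = e'.z) : e.vU = e'.vU :=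
  Subtype.ext (adjoin_congr ht (congrArg Subgroup.zpowers hz) e.invol.1 e'.invol.1 e.comm_z e'.comm_z)

theorem vW_congr {e e' : OuterFlag N} (ht : e.t = e'.t) (hV : e.V = e'.V) : e.vW = e'.vW :=
  Subtype.ext (adjoin_congr ht hV e.invol.1 e'.invol.1 e.comm e'.comm)

end OuterFlag

/-- The pairs of a four-group in `N` and an outer involution that centralizes it. -/
abbrev FourOuter (N : Subgroup G) : Type u :=
  Σ V : {V : Subgroup G // V ≤ N ∧ IsFour V},
    {t : G // t ∉ N ∧ IsInvol t ∧ ∀ v ∈ V.1, Commute t v}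

/-- The pairs of an involution in `N` and an outer involution that centralizes it. -/
abbrev InvolOuter (N : Subgroup G) : Type u :=
  Σ z : {z : G // z ∈ N ∧ IsInvol z}, {t : G // t ∉ N ∧ IsInvol t ∧ Commute t z.1}

/-- The pairs of a four-group in `N` and an involution in it. -/
abbrev FourInvol (N : Subgroup G) : Type u :=
  Σ V : {V : Subgroup G // V ≤ N ∧ IsFour V}, {z : G // z ∈ V.1 ∧ z ≠ 1}

/-- The data of an `OuterFlag` as a sigma type. -/
def outerFlagEquiv (N : Subgroup G) :
    OuterFlag N ≃ Σ x : FourOuter N, {z : G // z ∈ x.1.1 ∧ z ≠ 1} where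
  toFun e := ⟨⟨⟨e.V, e.le, e.four⟩, ⟨e.t, e.notMem, e.invol, e.comm⟩⟩, ⟨e.z, e.mem, e.ne⟩⟩
  invFun x := ⟨x.1.1.1, x.1.1.2.1, x.1.1.2.2, x.1.2.1, x.1.2.2.1, x.1.2.2.2.1, x.1.2.2.2.2,
    x.2.1, x.2.2.1, x.2.2.2⟩
  left_inv _ := rfl
  right_inv _ := rfl

/-- One outer involution `t` that centralizes `V` yields four of them, namely the elements of the
coset `tV`. -/
theorem four_mul_card_le [Finite G] {N : Subgroup G}
    (h : ∀ V : Subgroup G, V ≤ N → IsFour V →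
      ∃ t : G, t ∉ N ∧ IsInvol t ∧ ∀ v ∈ V, Commute t v) :
    4 * Nat.card {V : Subgroup G // V ≤ N ∧ IsFour V} ≤ Nat.card (FourOuter N) := by
  have := Fintype.ofFinite {V : Subgroup G // V ≤ N ∧ IsFour V}
  rw [Nat.card_sigma, mul_comm, Nat.card_eq_fintype_card, ← Finset.card_univ, ← smul_eq_mul]
  refine Finset.card_nsmul_le_sum _ _ 4 fun V _ => ?_
  obtain ⟨t, htN, ht, htc⟩ := h V.1 V.2.1 V.2.2
  rw [← V.2.2.2]
  refine Nat.card_le_card_of_injective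
    (fun v => ⟨t * v, fun h => htN ((N.mul_mem_cancel_right (V.2.1 v.2)).1 h), ⟨?_, fun h => ?_⟩,
      fun x hx => ?_⟩) fun v w hvw => ?_
  · rw [(htc v v.2).mul_pow, ht.1, V.2.2.1.2 v v.2, one_mul]
  · exact htN (eq_inv_of_mul_eq_one_left h ▸ N.inv_mem (V.2.1 v.2))
  · exact (htc x hx).mul_left (V.2.2.1.1 v v.2 x hx)
  · exact Subtype.ext (mul_left_cancel (congrArg Subtype.val hvw))

/-- Let `v` be the number of four-groups in `N` and `X` the number of pairs `(V, t)`. There are `3X`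
flags, `3v` pairs `(V, z)` and at most `5v` pairs `(z, t)`. Since `X ≥ 4v`, the number of conditions
`X + 5v + 3v` is at most `3X`. -/
theorem quillenDimension_of_outer [Finite G] (hr : pRank 2 G = 3) (N : Subgroup G) (M D : ℕ)
    (hne : ∃ z ∈ N, IsInvol z)
    (hV : ∀ V : Subgroup G, V ≤ N → IsFour V →
      ∃ t : G, t ∉ N ∧ IsInvol t ∧ ∀ v ∈ V, Commute t v)
    (hD : ∀ z ∈ N, IsInvol z → Nat.card {t : G // t ∉ N ∧ IsInvol t ∧ Commute t z} ≤ D)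
    (hM : ∀ z ∈ N, IsInvol z → M ≤ 4 * Nat.card {V : Subgroup G // (V ≤ N ∧ IsFour V) ∧ z ∈ V})
    (hMpos : 0 < M) (hMD : 12 * D ≤ 5 * M) : QuillenDimension 2 G := by
  classical
  have hfinE : Finite (OuterFlag N) := Finite.of_equiv _ (outerFlagEquiv N).symm
  have := Fintype.ofFinite (OuterFlag N)
  have := Fintype.ofFinite (FourOuter N)
  have := Fintype.ofFinite (InvolOuter N)
  have := Fintype.ofFinite (FourInvol N)
  have := Fintype.ofFinite {V : Subgroup G // V ≤ N ∧ IsFour V}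
  have := Fintype.ofFinite {z : G // z ∈ N ∧ IsInvol z}
  set n := Nat.card {z : G // z ∈ N ∧ IsInvol z} with hn
  set v := Nat.card {V : Subgroup G // V ≤ N ∧ IsFour V} with hv
  have cE : Nat.card (OuterFlag N) = 3 * Nat.card (FourOuter N) := by
    rw [Nat.card_congr (outerFlagEquiv N), Nat.card_sigma,
      Finset.sum_congr rfl fun x _ => x.1.2.2.card_ne_one]
    simp [mul_comm, Nat.card_eq_fintype_card]
  have cX : 4 * v ≤ Nat.card (FourOuter N) := four_mul_card_le hV
  have cY : Nat.card (InvolOuter N) ≤ n * D := by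
    rw [Nat.card_sigma, hn, Nat.card_eq_fintype_card, ← Finset.card_univ, ← smul_eq_mul]
    exact Finset.sum_le_card_nsmul _ _ D fun z _ => hD z.1 z.2.1 z.2.2
  have cZ : Nat.card (FourInvol N) = 3 * v := by
    rw [Nat.card_sigma, Finset.sum_congr rfl fun V _ => V.2.2.card_ne_one]
    simp [mul_comm, hv, Nat.card_eq_fintype_card]
  have cZ' : n * M ≤ 4 * Nat.card (FourInvol N) := by
    have h1 : Nat.card (Σ z : {z : G // z ∈ N ∧ IsInvol z},
        {V : Subgroup G // (V ≤ N ∧ IsFour V) ∧ z.1 ∈ V}) ≤ Nat.card (FourInvol N) := by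
      refine Nat.card_le_card_of_injective
        (fun x => ⟨⟨x.2.1, x.2.2.1⟩, ⟨x.1.1, x.2.2.2, x.1.2.2.2⟩⟩) ?_
      rintro ⟨⟨z, hz⟩, ⟨V, hV⟩⟩ ⟨⟨z', hz'⟩, ⟨V', hV'⟩⟩ h
      obtain rfl : V = V' := congrArg (fun x : FourInvol N => x.1.1) h
      have : z = z' := congrArg (fun x : FourInvol N => x.2.1) h
      subst this
      rfl
    refine le_trans ?_ (Nat.mul_le_mul_left 4 h1)
    rw [Nat.card_sigma, hn, Nat.card_eq_fintype_card, ← Finset.card_univ, ← smul_eq_mul,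
      Finset.mul_sum]
    exact Finset.card_nsmul_le_sum _ _ M fun z _ => hM z.1 z.2.1 z.2.2
  have hnpos : 0 < n := by
    obtain ⟨z, hzN, hz⟩ := hne
    exact Nat.card_pos_iff.2 ⟨⟨z, hzN, hz⟩, inferInstance⟩
  have hvpos : 0 < v := by
    have : 0 < n * M := Nat.mul_pos hnpos hMpos
    omega
  have hXne : Nonempty (FourOuter N) := by
    by_contra h
    rw [not_nonempty_iff] at h
    rw [Nat.card_of_isEmpty] at cX
    omega
  -- Counting incidences gives `n * M ≤ 12 * v`, hence `12 * n * D ≤ 5 * n * M ≤ 60 * v`.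
  have hle : n * D ≤ 5 * v := by nlinarith
  have hcard : Fintype.card (FourOuter N) + Fintype.card (InvolOuter N) +
      Fintype.card (FourInvol N) ≤ Fintype.card (OuterFlag N) := by
    simp only [← Nat.card_eq_fintype_card]
    omega
  obtain ⟨w, hw0, hwa, hwb, hwd⟩ := exists_ne_zero_fiber_sums_eq_zero
    (fun e : OuterFlag N => (⟨⟨e.V, e.le, e.four⟩, ⟨e.t, e.notMem, e.invol, e.comm⟩⟩ : FourOuter N))
    (fun e : OuterFlag N => (⟨⟨e.z, e.le e.mem, e.invol_z⟩,
      ⟨e.t, e.notMem, e.invol, e.comm _ e.mem⟩⟩ : InvolOuter N))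
    (fun e : OuterFlag N => (⟨⟨e.V, e.le, e.four⟩, ⟨e.z, e.mem, e.ne⟩⟩ : FourInvol N))
    hcard
  rw [quillenDimension_iff_boundary (n := 2) hr]
  refine ⟨∑ e, w e • e.triangle, ?_, fun h => hw0 (funext fun e => ?_)⟩
  · rw [map_sum]
    simp only [map_smul, OuterFlag.boundary_triangle, smul_add, Finset.sum_add_distrib]
    rw [sum_smul_eq_zero_of_fiber_sums hwd, sum_smul_eq_zero_of_fiber_sums hwb,
      sum_smul_eq_zero_of_fiber_sums hwa, add_zero, add_zero]
    · intro e e' h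
      have hV : e.V = e'.V := congrArg (fun x : FourOuter N => x.1.1) h
      have ht : e.t = e'.t := congrArg (fun x : FourOuter N => x.2.1) h
      rw [chainPair_congr (OuterFlag.vV_congr hV) (OuterFlag.vW_congr ht hV) e.vV_lt_vW e'.vV_lt_vW,
        chainPair_congr (OuterFlag.vT_congr ht) (OuterFlag.vW_congr ht hV)
          (e.vT_lt_vU.trans e.vU_lt_vW) (e'.vT_lt_vU.trans e'.vU_lt_vW)]
    · intro e e' h
      have hz : e.z = e'.z := congrArg (fun x : InvolOuter N => x.1.1) h
      have ht : e.t = e'.t := congrArg (fun x : InvolOuter N => x.2.1) h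
      rw [chainPair_congr (OuterFlag.vT_congr ht) (OuterFlag.vU_congr ht hz) e.vT_lt_vU e'.vT_lt_vU,
        chainPair_congr (OuterFlag.vA_congr hz) (OuterFlag.vU_congr ht hz) e.vA_lt_vU e'.vA_lt_vU]
    · intro e e' h
      have hV : e.V = e'.V := congrArg (fun x : FourInvol N => x.1.1) h
      have hz : e.z = e'.z := congrArg (fun x : FourInvol N => x.2.1) h
      rw [chainPair_congr (OuterFlag.vA_congr hz) (OuterFlag.vV_congr hV) e.vA_lt_vV e'.vA_lt_vV]
  · have h1 := DFunLike.congr_fun h (chainTriple e.vT_lt_vU e.vU_lt_vW)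
    rw [Finsupp.finsetSum_apply] at h1
    simpa [OuterFlag.triangle_apply] using h1

end Groups

/-! ### Rank three: vanishing of cycles by peeling off leaves -/

section Groups

variable {G : Type u} [Group G]

/-- As `N` has index at most two, multiplication by the common outer element `t` carries the part of
`E` outside `N` into `N`. -/
theorem le_of_inf_le {N E E' : Subgroup G} (hN : ∀ x y : G, x ∉ N → y ∉ N → x * y ∈ N) {t : G}
    (htN : t ∉ N) (htE : t ∈ E) (htE' : t ∈ E') (h : E ⊓ N ≤ E' ⊓ N) : E ≤ E' := by
  intro x hx
  by_cases hxN : x ∈ N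
  · exact (h ⟨hx, hxN⟩).1
  · exact (E'.mul_mem_cancel_left htE').1 (h ⟨mul_mem htE hx, hN _ _ htN hxN⟩).1

theorem eq_of_inf_eq {N E E' : Subgroup G} (hN : ∀ x y : G, x ∉ N → y ∉ N → x * y ∈ N) {t : G}
    (htN : t ∉ N) (htE : t ∈ E) (htE' : t ∈ E') (h : E ⊓ N = E' ⊓ N) : E = E' :=
  le_antisymm (le_of_inf_le hN htN htE htE' h.le) (le_of_inf_le hN htN htE' htE h.ge)

theorem card_eq_two_mul_card_inf {N E : Subgroup G}
    (hN : ∀ x ∈ E, ∀ y ∈ E, x ∉ N → y ∉ N → x * y ∈ N) (hE : ¬ E ≤ N) :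
    Nat.card E = 2 * Nat.card (E ⊓ N : Subgroup G) := by
  obtain ⟨t, htE, htN⟩ := SetLike.not_le_iff_exists.1 hE
  have h1 : (E ⊓ N).relIndex E = 2 := by
    rw [Subgroup.relIndex_eq_two_iff]
    refine ⟨t, htE, fun b hb => ?_⟩
    by_cases hbN : b ∈ N
    · exact Or.inr ⟨⟨hb, hbN⟩, fun h => htN ((N.mul_mem_cancel_left hbN).1 h.2)⟩
    · exact Or.inl ⟨⟨mul_mem hb htE, hN _ hb _ htE hbN htN⟩, fun h => hbN h.2⟩
  have h2 := Subgroup.relIndex_mul_relIndex ⊥ (E ⊓ N) E bot_le inf_le_left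
  rw [Subgroup.relIndex_bot_left, Subgroup.relIndex_bot_left, h1] at h2
  rw [← h2, mul_comm]

/-- The commuting graph of the four-groups in `N` that are centralized by `t` and their involutions
is a tree: the involutions in `S` are leaves, and every four-group different from `V₀` has at most
one involution that is not a leaf. -/
def ForestAt (N : Subgroup G) (t : G) : Prop :=
  ∃ (S : Set G) (V₀ : Subgroup G),
    (∀ z ∈ S, ∀ V W : Subgroup G, V ≤ N → W ≤ N → IsFour V → IsFour W →
      (∀ v ∈ V, Commute t v) → (∀ w ∈ W, Commute t w) → z ∈ V → z ∈ W → V = W) ∧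
    ∀ V : Subgroup G, V ≤ N → IsFour V → (∀ v ∈ V, Commute t v) → V ≠ V₀ →
      ∀ z ∈ V, ∀ z' ∈ V, z ≠ 1 → z' ≠ 1 → z ≠ z' → z ∈ S ∨ z' ∈ S

/-- Intersecting with `N` identifies the chains above `⟨t⟩` with the edges of the graph in `ForestAt
N t`. A cycle is shown to vanish in turn on chains starting outside `N`, on chains whose second
member is outside `N`, and on the rest, each time using a face that no chain outside the classes
already settled shares. -/
theorem not_quillenDimension_of_outer [Finite G] (hr : pRank 2 G = 3) (N : Subgroup G)
    (hN : ∀ x y : G, x ∉ N → y ∉ N → x * y ∈ N)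
    (hN4 : ∀ A : Subgroup G, A ≤ N → IsElemAbelian 2 A → Nat.card A ≤ 4)
    (h : ∀ t, t ∉ N → IsInvol t → ForestAt N t) :
    ¬ QuillenDimension 2 G := by
  rw [quillenDimension_iff_boundary (n := 2) hr]
  rintro ⟨c, hc, h0⟩
  have die := fun s j => apply_eq_zero_of_boundary_eq_zero rk (fun s i => rk_apply hr s i) hc s j
  have hcard : ∀ (s : Fin 3 ↪o QuillenPoset 2 G) i, Nat.card (s i).1 = 2 ^ ((i : ℕ) + 1) :=
    fun s i => by rw [card_eq_two_pow_rk, rk_apply hr s i]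
  have hmono : ∀ (s : Fin 3 ↪o QuillenPoset 2 G) {i j : Fin 3}, i ≤ j → (s i).1 ≤ (s j).1 :=
    fun s i j hij => s.monotone hij
  have hext : ∀ {s s' : Fin 3 ↪o QuillenPoset 2 G}, s' 0 = s 0 → s' 1 = s 1 → s' 2 = s 2 →
      s' = s := by
    intro s s' e0 e1 e2
    ext i : 1
    fin_cases i
    · exact e0
    · exact e1
    · exact e2
  have f0 : ∀ {s s' : Fin 3 ↪o QuillenPoset 2 G}, face 0 s' = face 0 s →
      s' 1 = s 1 ∧ s' 2 = s 2 := fun hf =>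
    ⟨congrArg (fun e : Fin 2 ↪o QuillenPoset 2 G => e 0) hf,
      congrArg (fun e : Fin 2 ↪o QuillenPoset 2 G => e 1) hf⟩
  have f1 : ∀ {s s' : Fin 3 ↪o QuillenPoset 2 G}, face 1 s' = face 1 s →
      s' 0 = s 0 ∧ s' 2 = s 2 := fun hf =>
    ⟨congrArg (fun e : Fin 2 ↪o QuillenPoset 2 G => e 0) hf,
      congrArg (fun e : Fin 2 ↪o QuillenPoset 2 G => e 1) hf⟩
  have f2 : ∀ {s s' : Fin 3 ↪o QuillenPoset 2 G}, face 2 s' = face 2 s →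
      s' 0 = s 0 ∧ s' 1 = s 1 := fun hf =>
    ⟨congrArg (fun e : Fin 2 ↪o QuillenPoset 2 G => e 0) hf,
      congrArg (fun e : Fin 2 ↪o QuillenPoset 2 G => e 1) hf⟩
  -- chains that start outside of `N`
  have hT : ∀ s : Fin 3 ↪o QuillenPoset 2 G, ¬ (s 0).1 ≤ N → c s = 0 := by
    intro s₀ hs₀
    obtain ⟨t, ht, hst⟩ := exists_eq_vertex (rk_apply hr s₀ 0)
    have htN : t ∉ N := fun h' => hs₀ (by rw [hst]; exact (Subgroup.zpowers_le).2 h')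
    obtain ⟨S, V₀, hS, hV₀⟩ := h t htN ht
    have htm : ∀ {s : Fin 3 ↪o QuillenPoset 2 G}, s 0 = s₀ 0 → ∀ i, t ∈ (s i).1 := by
      intro s hs i
      have h1 := hmono s (Fin.zero_le i)
      rw [hs, hst] at h1
      exact h1 (Subgroup.mem_zpowers t)
    have hnle : ∀ {s : Fin 3 ↪o QuillenPoset 2 G}, s 0 = s₀ 0 → ∀ i, ¬ (s i).1 ≤ N :=
      fun hs i hi => htN (hi (htm hs i))
    have hfour : ∀ {s : Fin 3 ↪o QuillenPoset 2 G}, s 0 = s₀ 0 →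
        IsFour ((s 2).1 ⊓ N) ∧ ∀ v ∈ (s 2).1 ⊓ N, Commute t v := by
      intro s hs
      refine ⟨⟨(s 2).2.1.mono inf_le_left, ?_⟩, fun v hv => (s 2).2.1.1 t (htm hs 2) v hv.1⟩
      have h1 := card_eq_two_mul_card_inf (fun x _ y _ => hN x y) (hnle hs 2)
      rw [hcard, show 2 ^ (((2 : Fin 3) : ℕ) + 1) = 8 from rfl] at h1
      omega
    have hz : ∀ {s : Fin 3 ↪o QuillenPoset 2 G}, s 0 = s₀ 0 →
        ∃ z, IsInvol z ∧ (s 1).1 ⊓ N = Subgroup.zpowers z := by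
      intro s hs
      have h1 := card_eq_two_mul_card_inf (fun x _ y _ => hN x y) (hnle hs 1)
      rw [hcard, show 2 ^ (((1 : Fin 3) : ℕ) + 1) = 4 from rfl] at h1
      have h2 : ((s 1).1 ⊓ N) ≠ ⊥ := fun h2 => by
        rw [h2, Subgroup.card_bot] at h1
        omega
      obtain ⟨z, hz, hz'⟩ := exists_eq_vertex (A := ⟨(s 1).1 ⊓ N, (s 1).2.1.mono inf_le_left, h2⟩)
        (by rw [rk, Nat.log_eq_iff (by norm_num)]; simp only; omega)
      exact ⟨z, hz, congrArg Subtype.val hz'⟩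
    have e1 : ∀ {s s' : Fin 3 ↪o QuillenPoset 2 G}, s 0 = s₀ 0 → s' 0 = s₀ 0 →
        (s' 1).1 ⊓ N = (s 1).1 ⊓ N → s' 1 = s 1 := fun hs hs' he =>
      Subtype.ext (eq_of_inf_eq hN htN (htm hs' 1) (htm hs 1) he)
    have e2 : ∀ {s s' : Fin 3 ↪o QuillenPoset 2 G}, s 0 = s₀ 0 → s' 0 = s₀ 0 →
        (s' 2).1 ⊓ N = (s 2).1 ⊓ N → s' 2 = s 2 := fun hs hs' he =>
      Subtype.ext (eq_of_inf_eq hN htN (htm hs' 2) (htm hs 2) he)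
    have hzm : ∀ {s : Fin 3 ↪o QuillenPoset 2 G} {z : G}, (s 1).1 ⊓ N = Subgroup.zpowers z →
        z ∈ (s 2).1 ⊓ N := by
      intro s z hzs
      have h1 : z ∈ (s 1).1 ⊓ N := hzs ▸ Subgroup.mem_zpowers z
      exact ⟨hmono s (by decide) h1.1, h1.2⟩
    -- A leaf `z` lies in a single four-group, so no other chain has the same first two members.
    have step1 : ∀ (s : Fin 3 ↪o QuillenPoset 2 G), s 0 = s₀ 0 → ∀ z ∈ S,
        (s 1).1 ⊓ N = Subgroup.zpowers z → c s = 0 := by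
      intro s hs z hzS hzs
      refine die s 2 fun s' hf hne => absurd (hext (f2 hf).1 (f2 hf).2 (e2 hs ?_ ?_)) hne
      · exact (f2 hf).1.trans hs
      · have hs' := (f2 hf).1.trans hs
        refine hS z hzS _ _ inf_le_right inf_le_right (hfour hs').1 (hfour hs).1 (hfour hs').2
          (hfour hs).2 (hzm ?_) (hzm hzs)
        rw [(f2 hf).2, hzs]
    -- If `z` is not a leaf, all other involutions of this four-group are, and the chains through
    -- them are settled.
    have step2 : ∀ (s : Fin 3 ↪o QuillenPoset 2 G), s 0 = s₀ 0 → (s 2).1 ⊓ N ≠ V₀ → c s = 0 := by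
      intro s hs hsV
      obtain ⟨z, hzi, hzs⟩ := hz hs
      by_cases hzS : z ∈ S
      · exact step1 s hs z hzS hzs
      refine die s 1 fun s' hf hne => ?_
      have hs' := (f1 hf).1.trans hs
      obtain ⟨z', hzi', hzs'⟩ := hz hs'
      by_cases hzz : z = z'
      · exact absurd (hext (f1 hf).1 (e1 hs hs' (by rw [hzs, hzs', hzz])) (f1 hf).2) hne
      have hm' : z' ∈ (s 2).1 ⊓ N := (f1 hf).2 ▸ hzm hzs'
      exact step1 s' hs' z' ((hV₀ _ inf_le_right (hfour hs).1 (hfour hs).2 hsV z (hzm hzs) z' hm'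
        hzi.2 hzi'.2 hzz).resolve_left hzS) hzs'
    -- For the central four-group `V₀`, any other chain with the same first two members ends in a
    -- different four-group and is settled.
    by_cases hV : (s₀ 2).1 ⊓ N = V₀
    · refine die s₀ 2 fun s' hf hne => step2 s' (f2 hf).1 fun hV' => hne ?_
      exact hext (f2 hf).1 (f2 hf).2 (e2 rfl (f2 hf).1 (hV'.trans hV.symm))
    · exact step2 s₀ rfl hV
  -- A first member inside `N` must be the intersection of the second one with `N`; all other
  -- choices start outside `N`.
  have hA : ∀ s : Fin 3 ↪o QuillenPoset 2 G, ¬ (s 1).1 ≤ N → c s = 0 := by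
    intro s hs1
    by_cases hs0 : (s 0).1 ≤ N
    · refine die s 0 fun s' hf hne => hT s' fun hs0' => hne (hext ?_ (f0 hf).1 (f0 hf).2)
      have hinf : ∀ r : Fin 3 ↪o QuillenPoset 2 G, r 1 = s 1 → (r 0).1 ≤ N →
          (r 0).1 = (s 1).1 ⊓ N := by
        intro r hr1 hr0
        refine Subgroup.eq_of_le_of_card_ge (le_inf (hr1 ▸ hmono r (by decide)) hr0) ?_
        have h1 := card_eq_two_mul_card_inf (fun x _ y _ => hN x y) hs1
        rw [hcard] at h1
        rw [hcard]
        norm_num at h1 ⊢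
        omega
      exact Subtype.ext ((hinf s' (f0 hf).1 hs0').trans (hinf s rfl hs0).symm)
    · exact hT s hs0
  refine h0 (Finsupp.ext fun s => ?_)
  -- Likewise a second member inside `N` must be the intersection of the third one with `N`, which
  -- has order 4.
  by_cases hs1 : (s 1).1 ≤ N
  · have hs2 : ¬ (s 2).1 ≤ N := fun h' => by
      have h1 := hN4 _ h' (s 2).2.1
      rw [hcard] at h1
      norm_num at h1
    refine die s 1 fun s' hf hne => hA s' fun hs1' => hne (hext (f1 hf).1 ?_ (f1 hf).2)
    have hinf : ∀ r : Fin 3 ↪o QuillenPoset 2 G, r 2 = s 2 → (r 1).1 ≤ N →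
        (r 1).1 = (s 2).1 ⊓ N := by
      intro r hr2 hr1
      refine Subgroup.eq_of_le_of_card_ge (le_inf (hr2 ▸ hmono r (by decide)) hr1) ?_
      have h1 := card_eq_two_mul_card_inf (fun x _ y _ => hN x y) hs2
      rw [hcard] at h1
      rw [hcard]
      norm_num at h1 ⊢
      omega
    exact Subtype.ext ((hinf s' (f1 hf).2 hs1').trans (hinf s rfl hs1).symm)
  · exact hA s hs1

end Groups

open Matrix.ProjGenLinGroup (mk)

/-! ### Involutions of `PGL₂` as traceless matrices, and the subgroup `PSL₂` -/

section PGL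

variable {F : Type u} [Field F]

theorem mk_eq_mk_iff_exists_smul {g h : GL (Fin 2) F} :
    mk g = mk h ↔ ∃ c : F, (h : Matrix (Fin 2) (Fin 2) F) = c • (g : Matrix (Fin 2) (Fin 2) F) := by
  rw [Matrix.ProjGenLinGroup.mk_eq_mk_iff]
  constructor
  · rintro ⟨u, rfl⟩
    refine ⟨u, ?_⟩
    ext i j
    fin_cases i <;> fin_cases j <;> simp [Matrix.mul_apply, mul_comm]
  · rintro ⟨c, hc⟩
    have hc0 : c ≠ 0 := by
      rintro rfl
      have := h.det_ne_zero
      rw [hc] at this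
      simp at this
    refine ⟨Units.mk0 c hc0, ?_⟩
    ext i j
    rw [hc]
    fin_cases i <;> fin_cases j <;> simp [Matrix.mul_apply, mul_comm]

theorem mk_eq_one_iff_apply {g : GL (Fin 2) F} :
    mk g = 1 ↔ g 0 1 = 0 ∧ g 1 0 = 0 ∧ g 0 0 = g 1 1 := by
  rw [eq_comm, ← map_one mk, mk_eq_mk_iff_exists_smul]
  constructor
  · rintro ⟨c, hc⟩
    simp [hc]
  · rintro ⟨h1, h2, h3⟩
    refine ⟨g 0 0, ?_⟩
    ext i j
    fin_cases i <;> fin_cases j <;> simp [h1, h2, h3]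

theorem mk_eq_mk_of_smul {g h : GL (Fin 2) F} (c : F)
    (H : ∀ i j, h i j = c * g i j) : mk g = mk h :=
  mk_eq_mk_iff_exists_smul.2 ⟨c, by ext i j; exact H i j⟩

/-- By Cayley–Hamilton `g² = tr(g) g - det(g)`, which is scalar exactly if `g` is scalar or
traceless. An invertible scalar is not traceless as `2 ≠ 0`. -/
theorem isInvol_mk_iff (h2 : (2 : F) ≠ 0) {g : GL (Fin 2) F} :
    IsInvol (mk g) ↔ g 0 0 + g 1 1 = 0 := by
  have hsq : mk g ^ 2 = 1 ↔ g 0 1 * (g 0 0 + g 1 1) = 0 ∧ g 1 0 * (g 0 0 + g 1 1) = 0 ∧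
      (g 0 0 - g 1 1) * (g 0 0 + g 1 1) = 0 := by
    rw [sq, ← map_mul, mk_eq_one_iff_apply]
    simp only [Matrix.GeneralLinearGroup.coe_mul, Matrix.mul_apply, Fin.sum_univ_two]
    constructor
    · rintro ⟨h1, h2, h3⟩
      exact ⟨by linear_combination h1, by linear_combination h2, by linear_combination h3⟩
    · rintro ⟨h1, h2, h3⟩
      exact ⟨by linear_combination h1, by linear_combination h2, by linear_combination h3⟩
  rw [IsInvol, hsq, Ne, mk_eq_one_iff_apply]
  constructor
  · rintro ⟨⟨h3, h4, h5⟩, h6⟩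
    by_contra h
    simp only [mul_eq_zero, h, or_false] at h3 h4 h5
    exact h6 ⟨h3, h4, sub_eq_zero.1 h5⟩
  · intro h
    refine ⟨by simp [h], fun ⟨h3, h4, h5⟩ => ?_⟩
    have h6 : g 0 0 = 0 := by
      have : 2 * g 0 0 = 0 := by linear_combination h + h5
      exact (mul_eq_zero.1 this).resolve_left h2
    have h7 := g.det_ne_zero
    rw [Matrix.det_fin_two, h3, h6] at h7
    simp at h7

theorem IsInvol.mul_isInvol {G : Type*} [Group G] {z y : G} (hz : IsInvol z) (hy : IsInvol y)
    (hne : z ≠ y) (hc : Commute z y) : IsInvol (z * y) :=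
  ⟨by rw [hc.mul_pow, hz.1, hy.1, one_mul], fun h => hne (by
    rw [mul_eq_one_iff_eq_inv] at h
    rw [h]
    exact inv_eq_of_mul_eq_one_left hy.mul_self)⟩

/-- Distinct commuting involutions of `PGL₂` are orthogonal for the trace form. -/
theorem trace_mul_eq_zero (h2 : (2 : F) ≠ 0) {g h : GL (Fin 2) F} (hg : IsInvol (mk g))
    (hh : IsInvol (mk h)) (hne : mk g ≠ mk h) (hc : Commute (mk g) (mk h)) :
    g 0 0 * h 0 0 + g 0 1 * h 1 0 + g 1 0 * h 0 1 + g 1 1 * h 1 1 = 0 := by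
  have h1 := hg.mul_isInvol hh hne hc
  rw [← map_mul, isInvol_mk_iff h2] at h1
  simp only [Matrix.GeneralLinearGroup.coe_mul, Matrix.mul_apply, Fin.sum_univ_two] at h1
  linear_combination h1

theorem commute_mk_of_trace {g h : GL (Fin 2) F} (hg : g 0 0 + g 1 1 = 0) (hh : h 0 0 + h 1 1 = 0)
    (ht : g 0 0 * h 0 0 + g 0 1 * h 1 0 + g 1 0 * h 0 1 + g 1 1 * h 1 1 = 0) :
    Commute (mk g) (mk h) := by
  change mk g * mk h = mk h * mk g
  rw [← map_mul, ← map_mul]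
  refine mk_eq_mk_of_smul (-1) fun i j => ?_
  have hg' : g 1 1 = - g 0 0 := by linear_combination hg
  have hh' : h 1 1 = - h 0 0 := by linear_combination hh
  rw [hg', hh'] at ht
  fin_cases i <;> fin_cases j <;>
    simp only [Matrix.GeneralLinearGroup.coe_mul, Matrix.mul_apply, Fin.sum_univ_two, Fin.zero_eta,
      Fin.mk_one, hg', hh']
  · linear_combination ht
  · ring
  · ring
  · linear_combination ht

theorem ne_of_trace (h2 : (2 : F) ≠ 0) {g h : GL (Fin 2) F} (hg : g 0 0 + g 1 1 = 0)
    (ht : g 0 0 * h 0 0 + g 0 1 * h 1 0 + g 1 0 * h 0 1 + g 1 1 * h 1 1 = 0) : mk g ≠ mk h := by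
  intro h'
  obtain ⟨c, hc⟩ := mk_eq_mk_iff_exists_smul.1 h'
  have hc0 : c ≠ 0 := by
    rintro rfl
    have := h.det_ne_zero
    rw [hc] at this
    simp at this
  simp only [hc, Matrix.smul_apply, smul_eq_mul] at ht
  have hd := g.det_ne_zero
  rw [Matrix.det_fin_two] at hd
  have h1 : 2 * c * (g 0 0 * g 1 1 - g 0 1 * g 1 0) = 0 := by
    linear_combination c * (g 0 0 + g 1 1) * hg - ht
  exact (mul_ne_zero (mul_ne_zero h2 hc0) hd) h1

/-- Three pairwise distinct commuting involutions of `PGL₂` lie in a four-group. -/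
theorem eq_mul_of_commute (h2 : (2 : F) ≠ 0) {x y z : PGL(2, F)} (hx : IsInvol x) (hy : IsInvol y)
    (hz : IsInvol z) (hxy : x ≠ y) (hxz : x ≠ z) (hyz : y ≠ z) (cxy : Commute x y)
    (cxz : Commute x z) (cyz : Commute y z) : x = y * z := by
  obtain ⟨a, rfl⟩ := Matrix.ProjGenLinGroup.mk_surjective x
  obtain ⟨b, rfl⟩ := Matrix.ProjGenLinGroup.mk_surjective y
  obtain ⟨c, rfl⟩ := Matrix.ProjGenLinGroup.mk_surjective z
  have h1 := trace_mul_eq_zero h2 hx hy hxy cxy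
  have h3 := trace_mul_eq_zero h2 hx hz hxz cxz
  have h4 := trace_mul_eq_zero h2 hy hz hyz cyz
  have ha := (isInvol_mk_iff h2).1 hx
  have hb := (isInvol_mk_iff h2).1 hy
  have hc := (isInvol_mk_iff h2).1 hz
  -- The traceless matrices form a 3-dimensional space, so the direction orthogonal to `b` and `c`
  -- is that of `b * c`; hence `a * b * c` is scalar.
  have key : mk a * (mk b * mk c) = 1 := by
    rw [← map_mul, ← map_mul, mk_eq_one_iff_apply]
    have ha' : a 1 1 = - a 0 0 := by linear_combination ha
    have hb' : b 1 1 = - b 0 0 := by linear_combination hb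
    have hc' : c 1 1 = - c 0 0 := by linear_combination hc
    rw [ha', hb'] at h1
    rw [ha', hc'] at h3
    rw [hb', hc'] at h4
    simp only [Matrix.GeneralLinearGroup.coe_mul, Matrix.mul_apply, Fin.sum_univ_two, ha', hb', hc']
    refine ⟨?_, ?_, ?_⟩
    · refine (mul_eq_zero.1 (?_ : (2 : F) * _ = 0)).resolve_left h2
      linear_combination a 0 1 * h4 + c 0 1 * h1 - b 0 1 * h3
    · refine (mul_eq_zero.1 (?_ : (2 : F) * _ = 0)).resolve_left h2
      linear_combination a 1 0 * h4 + c 1 0 * h1 - b 1 0 * h3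
    · linear_combination a 0 0 * h4 + c 0 0 * h1 - b 0 0 * h3
  rw [mul_eq_one_iff_eq_inv] at key
  rw [key]
  exact inv_eq_of_mul_eq_one_left (hy.mul_isInvol hz hyz cyz).mul_self

theorem card_le_four_of_isElemAbelian (h2 : (2 : F) ≠ 0) {A : Subgroup PGL(2, F)}
    (hA : IsElemAbelian 2 A) : Nat.card A ≤ 4 := by
  classical
  by_cases h : ∃ z ∈ A, z ≠ 1 ∧ ∃ y ∈ A, y ≠ 1 ∧ y ≠ z
  · obtain ⟨z, hz, hz1, y, hy, hy1, hyz⟩ := h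
    have hsub : (A : Set PGL(2, F)) ⊆ (({1, z, y, y * z} : Finset PGL(2, F)) : Set PGL(2, F)) := by
      intro x hx
      simp only [Finset.coe_insert, Finset.coe_singleton, Set.mem_insert_iff,
        Set.mem_singleton_iff]
      by_contra hcon
      push Not at hcon
      obtain ⟨hx1, hxz, hxy, hxyz⟩ := hcon
      exact hxyz (eq_mul_of_commute h2 ⟨hA.2 x hx, hx1⟩ ⟨hA.2 y hy, hy1⟩ ⟨hA.2 z hz, hz1⟩ hxy hxz
        hyz (hA.1 x hx y hy) (hA.1 x hx z hz) (hA.1 y hy z hz))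
    have h1 := Set.ncard_le_ncard hsub
    rw [Set.ncard_coe_finset] at h1
    exact h1.trans Finset.card_le_four
  · push Not at h
    by_cases h' : ∃ z ∈ A, z ≠ 1
    · obtain ⟨z, hz, hz1⟩ := h'
      have hsub : (A : Set PGL(2, F)) ⊆ (({1, z} : Finset PGL(2, F)) : Set PGL(2, F)) := by
        intro x hx
        simp only [Finset.coe_insert, Finset.coe_singleton, Set.mem_insert_iff,
          Set.mem_singleton_iff]
        by_cases hx1 : x = 1
        · exact Or.inl hx1
        · exact Or.inr (h z hz hz1 x hx hx1)
      have h1 := Set.ncard_le_ncard hsub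
      rw [Set.ncard_coe_finset] at h1
      exact (h1.trans Finset.card_le_two).trans (by norm_num)
    · push Not at h'
      rw [(Subgroup.eq_bot_iff_forall A).2 h', Subgroup.card_bot]
      norm_num

/-- The image of `PSL₂` in `PGL₂`. -/
def pslSubgroup (F : Type u) [Field F] : Subgroup PGL(2, F) :=
  (Matrix.ProjectiveSpecialLinearGroup.toPGL (n := Fin 2) (R := F)).range

/-- Rescaling a `2 × 2` matrix changes its determinant by a square. -/
theorem mk_mem_pslSubgroup {g : GL (Fin 2) F} :
    mk g ∈ pslSubgroup F ↔ IsSquare (g : Matrix (Fin 2) (Fin 2) F).det := by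
  constructor
  · rintro ⟨s, hs⟩
    induction s using QuotientGroup.induction_on with
    | H s =>
      obtain ⟨c, hc⟩ := mk_eq_mk_iff_exists_smul.1 hs
      rw [hc, Matrix.det_smul]
      have : (Matrix.SpecialLinearGroup.toGL s : Matrix (Fin 2) (Fin 2) F).det = 1 := s.2
      rw [this]
      exact ⟨c, by simp [sq]⟩
  · rintro ⟨r, hr⟩
    have hr0 : r ≠ 0 := by
      rintro rfl
      exact g.det_ne_zero (by simpa using hr)
    let s : SL(2, F) := ⟨r⁻¹ • (g : Matrix (Fin 2) (Fin 2) F), by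
      rw [Matrix.det_smul, hr, Fintype.card_fin]
      field_simp⟩
    refine ⟨(s : PSL(2, F)), ?_⟩
    rw [Matrix.ProjectiveSpecialLinearGroup.toPGL_mk, mk_eq_mk_iff_exists_smul]
    refine ⟨r, ?_⟩
    change _ = r • (r⁻¹ • (g : Matrix (Fin 2) (Fin 2) F))
    rw [smul_smul, mul_inv_cancel₀ hr0, one_smul]

instance pslSubgroup_normal : (pslSubgroup F).Normal where
  conj_mem n hn g := by
    obtain ⟨n, rfl⟩ := Matrix.ProjGenLinGroup.mk_surjective n
    obtain ⟨g, rfl⟩ := Matrix.ProjGenLinGroup.mk_surjective g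
    rw [mk_mem_pslSubgroup] at hn
    rw [← map_inv, ← map_mul, ← map_mul, mk_mem_pslSubgroup]
    rw [Matrix.GeneralLinearGroup.coe_mul, Matrix.GeneralLinearGroup.coe_mul, Matrix.det_mul,
      Matrix.det_mul, Matrix.GeneralLinearGroup.coe_inv, Matrix.det_nonsing_inv,
      Ring.inverse_eq_inv, mul_comm, ← mul_assoc, inv_mul_cancel₀ g.det_ne_zero, one_mul]
    exact hn

theorem mul_mem_pslSubgroup [Finite F] {x y : PGL(2, F)} (hx : x ∉ pslSubgroup F)
    (hy : y ∉ pslSubgroup F) : x * y ∈ pslSubgroup F := by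
  classical
  have := Fintype.ofFinite F
  obtain ⟨g, rfl⟩ := Matrix.ProjGenLinGroup.mk_surjective x
  obtain ⟨h, rfl⟩ := Matrix.ProjGenLinGroup.mk_surjective y
  rw [mk_mem_pslSubgroup] at hx hy
  rw [← map_mul, mk_mem_pslSubgroup, Matrix.GeneralLinearGroup.coe_mul, Matrix.det_mul]
  rw [← quadraticChar_neg_one_iff_not_isSquare] at hx hy
  rw [← quadraticChar_one_iff_isSquare (mul_ne_zero g.det_ne_zero h.det_ne_zero), map_mul, hx, hy]
  norm_num

end PGL

/-! ### Four-groups generated by two involutions, and the rank-two criteria for subgroups -/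

section Subgroups

variable {G : Type u} [Group G]

/-- The four-group generated by two commuting involutions. -/
theorem isFour_adjoin {z y : G} (hz : IsInvol z) (hy : IsInvol y) (hne : y ≠ z)
    (hc : ∀ b ∈ Subgroup.zpowers z, Commute y b) :
    IsFour (adjoin y (Subgroup.zpowers z) hy.1 hc) := by
  refine ⟨isElemAbelian_adjoin (isElemAbelian_zpowers hz.1), ?_⟩
  have hyz : y ∉ Subgroup.zpowers z := fun h =>
    ((mem_zpowers_iff_of_sq hz.1).1 h).elim hy.2 hne
  have h1 : (Subgroup.zpowers z).relIndex (adjoin y (Subgroup.zpowers z) hy.1 hc) = 2 := by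
    rw [Subgroup.relIndex_eq_two_iff]
    refine ⟨y, self_mem_adjoin, ?_⟩
    rintro _ ⟨b, hb, rfl | rfl⟩
    · exact Or.inr ⟨hb, fun h => hyz ((Subgroup.mul_mem_cancel_left _ hb).1 h)⟩
    · refine Or.inl ⟨by rwa [(hc b hb).eq, mul_assoc, hy.mul_self, mul_one], fun h =>
        hyz ((Subgroup.mul_mem_cancel_right _ hb).1 h)⟩
  have h2 := Subgroup.relIndex_mul_relIndex ⊥ _ _ bot_le
    (le_adjoin (t := y) (ht := hy.1) (hc := hc))
  rw [Subgroup.relIndex_bot_left, Subgroup.relIndex_bot_left, h1, card_zpowers hz] at h2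
  omega

theorem commute_zpowers {z y : G} (hc : Commute z y) :
    ∀ b ∈ Subgroup.zpowers z, Commute y b := by
  rintro _ ⟨k, rfl⟩
  exact (hc.zpow_left k).symm

/-- The four-group generated by the commuting involutions `z` and `y`. -/
def fourGroup {z y : G} (hy : IsInvol y) (hc : Commute z y) : Subgroup G :=
  adjoin y (Subgroup.zpowers z) hy.1 (commute_zpowers hc)

theorem isFour_fourGroup {z y : G} (hz : IsInvol z) (hy : IsInvol y) (hc : Commute z y)
    (hne : y ≠ z) : IsFour (fourGroup hy hc) := isFour_adjoin hz hy hne _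

theorem mem_fourGroup {z y x : G} (hz : IsInvol z) (hy : IsInvol y) (hc : Commute z y) :
    x ∈ fourGroup hy hc ↔ x = 1 ∨ x = z ∨ x = y ∨ x = z * y := by
  rw [fourGroup, mem_adjoin]
  constructor
  · rintro ⟨b, hb, rfl | rfl⟩
    · rcases (mem_zpowers_iff_of_sq hz.1).1 hb with rfl | rfl <;> simp
    · rcases (mem_zpowers_iff_of_sq hz.1).1 hb with rfl | rfl
      · simp
      · rw [hc.eq]; simp
  · rintro (rfl | rfl | rfl | rfl)
    · exact ⟨1, one_mem _, Or.inl rfl⟩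
    · exact ⟨_, Subgroup.mem_zpowers _, Or.inl rfl⟩
    · exact ⟨1, one_mem _, Or.inr (mul_one _).symm⟩
    · exact ⟨z, Subgroup.mem_zpowers _, Or.inr hc.eq⟩

theorem IsFour.eq_fourGroup [Finite G] {V : Subgroup G} (hV : IsFour V) {z y : G} (hz : IsInvol z)
    (hy : IsInvol y) (hc : Commute z y) (hne : y ≠ z) (hzV : z ∈ V) (hyV : y ∈ V) :
    V = fourGroup hy hc := by
  refine (Subgroup.eq_of_le_of_card_ge (fun x hx => ?_) ?_).symm
  · rcases (mem_fourGroup hz hy hc).1 hx with rfl | rfl | rfl | rfl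
    · exact one_mem _
    · exact hzV
    · exact hyV
    · exact mul_mem hzV hyV
  · rw [hV.2, (isFour_fourGroup hz hy hc hne).2]

theorem IsFour.exists_ne {V : Subgroup G} (hV : IsFour V) (z : G) :
    ∃ y ∈ V, IsInvol y ∧ y ≠ z := by
  by_contra! h
  have h1 := hV.card_ne_one
  have : Subsingleton {x : G // x ∈ V ∧ x ≠ 1} := ⟨fun a b => Subtype.ext
    ((h a a.2.1 (hV.isInvol a.2.1 a.2.2)).trans (h b b.2.1 (hV.isInvol b.2.1 b.2.2)).symm)⟩
  have h2 := Finite.card_le_one_iff_subsingleton.2 this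
  omega

/-- The involution `z` lies in two different four-groups in `S`. -/
def FourPair (S : Subgroup G) (z : G) : Prop :=
  ∃ y₁ ∈ S, ∃ y₂ ∈ S, IsInvol y₁ ∧ IsInvol y₂ ∧ Commute z y₁ ∧ Commute z y₂ ∧ y₁ ≠ z ∧ y₂ ≠ z ∧
    y₂ ≠ y₁ ∧ y₂ ≠ z * y₁

theorem IsInvol.conj {z : G} (hz : IsInvol z) (p : G) : IsInvol (p * z * p⁻¹) :=
  ⟨by rw [conj_pow, hz.1, mul_one, mul_inv_cancel], fun h => hz.2 (conj_eq_one_iff.1 h)⟩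

theorem commute_conj {z y : G} (h : Commute z y) (p : G) :
    Commute (p * z * p⁻¹) (p * y * p⁻¹) := by
  simpa using h.map (MulAut.conj p)

theorem FourPair.conj {S : Subgroup G} [hS : S.Normal] {z : G} (h : FourPair S z) (p : G) :
    FourPair S (p * z * p⁻¹) := by
  obtain ⟨y₁, h1, y₂, h2, i1, i2, c1, c2, n1, n2, n3, n4⟩ := h
  refine ⟨_, hS.conj_mem _ h1 p, _, hS.conj_mem _ h2 p, i1.conj p, i2.conj p, commute_conj c1 p,
    commute_conj c2 p, by simpa using n1, by simpa using n2, by simpa using n3, fun h => n4 ?_⟩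
  rw [conj_mul] at h
  exact (MulAut.conj p).injective h

theorem IsElemAbelian.card_le_of_subtype {S : Subgroup G} {n : ℕ}
    (h4 : ∀ A : Subgroup G, A ≤ S → IsElemAbelian 2 A → Nat.card A ≤ n) (A : Subgroup S)
    (hA : IsElemAbelian 2 A) : Nat.card A ≤ n := by
  have h1 := h4 _ (Subgroup.map_subtype_le A) (hA.map S.subtype)
  rwa [Subgroup.card_map_of_injective S.subtype_injective] at h1

theorem isInvol_coe {S : Subgroup G} {z : S} : IsInvol (z : G) ↔ IsInvol z := by
  rw [IsInvol, IsInvol]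
  norm_cast

theorem quillenDimension_of_fourPair [Finite G] (S : Subgroup G)
    (h4 : ∀ A : Subgroup G, IsElemAbelian 2 A → Nat.card A ≤ 4) (hne : ∃ z ∈ S, IsInvol z)
    (h : ∀ z ∈ S, IsInvol z → FourPair S z) : QuillenDimension 2 S := by
  have key : ∀ z : S, IsInvol z →
      ∃ V W : Subgroup S, IsFour V ∧ IsFour W ∧ z ∈ V ∧ z ∈ W ∧ V ≠ W := by
    intro z hz
    obtain ⟨y₁, h1, y₂, h2, i1, i2, c1, c2, n1, n2, n3, n4⟩ := h z z.2 (isInvol_coe.2 hz)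
    lift y₁ to S using h1
    lift y₂ to S using h2
    rw [isInvol_coe] at i1 i2
    have c1' : Commute z y₁ := Subtype.ext c1
    have c2' : Commute z y₂ := Subtype.ext c2
    norm_cast at n1 n2 n3 n4
    refine ⟨fourGroup i1 c1', fourGroup i2 c2', isFour_fourGroup hz i1 c1' n1,
      isFour_fourGroup hz i2 c2' n2, (mem_fourGroup hz i1 c1').2 (by simp),
      (mem_fourGroup hz i2 c2').2 (by simp), fun hVW => ?_⟩
    have h3 : y₂ ∈ fourGroup i1 c1' := hVW ▸ (mem_fourGroup hz i2 c2').2 (by simp)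
    rcases (mem_fourGroup hz i1 c1').1 h3 with h5 | h5 | h5 | h5
    · exact i2.2 h5
    · exact n2 h5
    · exact n3 h5
    · exact n4 h5
  obtain ⟨z, hzS, hz⟩ := hne
  have hz' : IsInvol (⟨z, hzS⟩ : S) := isInvol_coe.1 hz
  refine quillenDimension_of_two_le (pRank_eq ?_ ?_) ⟨_, hz'⟩ key
  · obtain ⟨V, W, hV, -⟩ := key _ hz'
    exact ⟨V, hV.1, hV.2⟩
  · exact IsElemAbelian.card_le_of_subtype fun A _ hA => h4 A hA

theorem not_quillenDimension_of_eq_or_eq [Finite G] (S : Subgroup G)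
    (h4 : ∀ A : Subgroup G, IsElemAbelian 2 A → Nat.card A ≤ 4)
    (hne : ∃ z ∈ S, ∃ y ∈ S, IsInvol z ∧ IsInvol y ∧ Commute z y ∧ y ≠ z)
    (h : ∀ z ∈ S, ∀ y ∈ S, ∀ y' ∈ S, IsInvol z → IsInvol y → IsInvol y' → Commute z y →
      Commute z y' → y ≠ z → y' ≠ z → y' = y ∨ y' = z * y) : ¬ QuillenDimension 2 S := by
  refine not_quillenDimension_of_unique (pRank_eq ?_ ?_) fun z hz V W hV hW hzV hzW => ?_
  · obtain ⟨z, hzS, y, hyS, hz, hy, hc, hyz⟩ := hne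
    lift z to S using hzS
    lift y to S using hyS
    rw [isInvol_coe] at hz hy
    have hc' : Commute z y := Subtype.ext hc
    norm_cast at hyz
    have h1 := isFour_fourGroup hz hy hc' hyz
    exact ⟨_, h1.1, h1.2⟩
  · exact IsElemAbelian.card_le_of_subtype fun A _ hA => h4 A hA
  · obtain ⟨y, hyV, hy, hyz⟩ := hV.exists_ne z
    obtain ⟨y', hyW, hy', hyz'⟩ := hW.exists_ne z
    have hc : Commute z y := hV.1.1 z hzV y hyV
    have hc' : Commute z y' := hW.1.1 z hzW y' hyW
    have h1 := h z z.2 y y.2 y' y'.2 (isInvol_coe.2 hz) (isInvol_coe.2 hy) (isInvol_coe.2 hy')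
      (congrArg Subtype.val hc) (congrArg Subtype.val hc') (by exact_mod_cast hyz)
      (by exact_mod_cast hyz')
    norm_cast at h1
    rw [hV.eq_fourGroup hz hy' hc' hyz' hzV ?_, hW.eq_fourGroup hz hy' hc' hyz' hzW hyW]
    rcases h1 with h1 | h1
    · exact h1 ▸ hyV
    · exact h1 ▸ mul_mem hzV hyV

end Subgroups

/-! ### The property for `PGL₂(q)` and `PSL₂(q)` -/

section PGL

variable {F : Type u} [Field F]

/-- The invertible matrix with the given entries. -/
def glOf (a b c d : F) (h : a * d - b * c ≠ 0) : GL (Fin 2) F :=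
  Matrix.GeneralLinearGroup.mkOfDetNeZero !![a, b; c, d] (by rwa [Matrix.det_fin_two_of])

section glOf

variable {a b c d : F} {h : a * d - b * c ≠ 0}

theorem coe_glOf : (glOf a b c d h : Matrix (Fin 2) (Fin 2) F) = !![a, b; c, d] := rfl

@[simp] theorem glOf_zero_zero : glOf a b c d h 0 0 = a := rfl
@[simp] theorem glOf_zero_one : glOf a b c d h 0 1 = b := rfl
@[simp] theorem glOf_one_zero : glOf a b c d h 1 0 = c := rfl
@[simp] theorem glOf_one_one : glOf a b c d h 1 1 = d := rfl

theorem mk_glOf_mem_pslSubgroup : mk (glOf a b c d h) ∈ pslSubgroup F ↔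
    IsSquare (a * d - b * c) := by
  rw [mk_mem_pslSubgroup, coe_glOf, Matrix.det_fin_two_of]

theorem isInvol_mk_glOf (h2 : (2 : F) ≠ 0) : IsInvol (mk (glOf a b c d h)) ↔ a + d = 0 :=
  isInvol_mk_iff h2

theorem mk_glOf_eq {a' b' c' d' : F} {h' : a' * d' - b' * c' ≠ 0}
    (H : mk (glOf a b c d h) = mk (glOf a' b' c' d' h')) :
    ∃ k, a' = k * a ∧ b' = k * b ∧ c' = k * c ∧ d' = k * d := by
  obtain ⟨k, hk⟩ := mk_eq_mk_iff_exists_smul.1 H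
  exact ⟨k, congrFun (congrFun hk 0) 0, congrFun (congrFun hk 0) 1, congrFun (congrFun hk 1) 0,
    congrFun (congrFun hk 1) 1⟩

theorem mk_glOf_mul {a' b' c' d' : F} {h' : a' * d' - b' * c' ≠ 0} :
    mk (glOf a b c d h) * mk (glOf a' b' c' d' h') =
      mk (glOf (a * a' + b * c') (a * b' + b * d') (c * a' + d * c') (c * b' + d * d') (by
        have := mul_ne_zero h h'
        intro h0
        apply this
        linear_combination h0)) := by
  rw [← map_mul]
  congr 1
  ext i j
  fin_cases i <;> fin_cases j <;> simp [Matrix.mul_apply, coe_glOf]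

theorem commute_mk_glOf {a' b' c' d' : F} {h' : a' * d' - b' * c' ≠ 0} (hg : a + d = 0)
    (hh : a' + d' = 0) (ht : a * a' + b * c' + c * b' + d * d' = 0) :
    Commute (mk (glOf a b c d h)) (mk (glOf a' b' c' d' h')) :=
  commute_mk_of_trace hg hh ht

theorem exists_glOf (x : PGL(2, F)) : ∃ a b c d, ∃ h : a * d - b * c ≠ 0, x = mk (glOf a b c d h) := by
  obtain ⟨g, rfl⟩ := Matrix.ProjGenLinGroup.mk_surjective x
  refine ⟨g 0 0, g 0 1, g 1 0, g 1 1, ?_, ?_⟩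
  · rw [← Matrix.det_fin_two]
    exact g.det_ne_zero
  · congr 1
    ext i j
    fin_cases i <;> fin_cases j <;> rfl

end glOf

theorem mk_glOf_congr {a b c d a' b' c' d' : F} {h : a * d - b * c ≠ 0}
    {h' : a' * d' - b' * c' ≠ 0} (ha : a = a') (hb : b = b') (hc : c = c') (hd : d = d') :
    mk (glOf a b c d h) = mk (glOf a' b' c' d' h') := by
  subst ha hb hc hd
  rfl

/-- Every involution of `PGL₂` is conjugate to a companion matrix. -/
theorem exists_conj_companion (h2 : (2 : F) ≠ 0) {a b c d δ : F} {h : a * d - b * c ≠ 0}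
    (hz : a + d = 0) (hδ : a * d - b * c = δ) (hδ0 : δ ≠ 0) : ∃ p, mk (glOf a b c d h) =
      p * mk (glOf 0 (-δ) 1 0 (by simpa using hδ0)) * p⁻¹ := by
  -- A cyclic vector `v = (x, y)`: in the basis `v, gv` the matrix becomes the companion matrix,
  -- because `g² = -δ`.
  obtain ⟨x, y, hxy⟩ : ∃ x y : F, x * (c * x + d * y) - y * (a * x + b * y) ≠ 0 := by
    by_cases hc : c = 0
    · by_cases hb : b = 0
      · refine ⟨1, 1, ?_⟩
        subst hb hc
        have hd : d = -a := by linear_combination hz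
        subst hd
        have ha : a ≠ 0 := fun ha => h (by simp [ha])
        intro h0
        exact mul_ne_zero h2 ha (by linear_combination -h0)
      · exact ⟨0, 1, by simpa using hb⟩
    · exact ⟨1, 0, by simpa using hc⟩
  refine ⟨mk (glOf x (a * x + b * y) y (c * x + d * y) (by
    intro h0; apply hxy; linear_combination h0)), ?_⟩
  rw [eq_mul_inv_iff_mul_eq, mk_glOf_mul, mk_glOf_mul]
  have hd : d = -a := by linear_combination hz
  subst hd hδ
  apply mk_glOf_congr <;> ring

theorem exists_mul_ne_zero_of_five_le [Finite F] (hq : 5 ≤ Nat.card F) (δ : F) (hδ : δ ≠ 0) :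
    ∃ m : F, m * (1 + δ * m ^ 2) ≠ 0 := by
  classical
  have := Fintype.ofFinite F
  open Polynomial in
  let f : Polynomial F := X * (1 + C δ * X ^ 2)
  have hf : f.natDegree = 3 := by
    simp only [f]
    compute_degree!
  obtain ⟨m, hm⟩ := Polynomial.exists_eval_ne_zero_of_natDegree_lt_card f
    (fun h => by rw [h] at hf; simp at hf) (by
      rw [hf, Cardinal.mk_fintype, ← Nat.card_eq_fintype_card]
      exact_mod_cast (show 3 < Nat.card F by omega))
  exact ⟨m, by simpa [f] using hm⟩

theorem exists_mul_ne_zero_of_seven_le [Finite F] (hq : 7 ≤ Nat.card F) :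
    ∃ m : F, m * (1 - m ^ 2) * (1 + m ^ 2) ≠ 0 := by
  classical
  have := Fintype.ofFinite F
  open Polynomial in
  let f : Polynomial F := X * (1 - X ^ 2) * (1 + X ^ 2)
  have hf : f.natDegree = 5 := by
    simp only [f]
    compute_degree!
  obtain ⟨m, hm⟩ := Polynomial.exists_eval_ne_zero_of_natDegree_lt_card f
    (fun h => by rw [h] at hf; simp at hf) (by
      rw [hf, Cardinal.mk_fintype, ← Nat.card_eq_fintype_card]
      exact_mod_cast (show 5 < Nat.card F by omega))
  exact ⟨m, by simpa [f] using hm⟩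

/-- For `z` the companion matrix, the involutions commuting with `z` and different from it are the
invertible matrices `(a, δc; c, -a)`. The four-group of `z` and `diag(1, -1)` accounts for `c = 0`
and `a = 0`; a second one comes from `(a, c) = (1, m)` with `m ≠ 0` and `1 + δm² ≠ 0`. -/
theorem fourPair_top [Finite F] (h2 : (2 : F) ≠ 0) (hq : 5 ≤ Nat.card F) {z : PGL(2, F)}
    (hz : IsInvol z) : FourPair ⊤ z := by
  obtain ⟨a, b, c, d, h, rfl⟩ := exists_glOf z
  rw [isInvol_mk_glOf h2] at hz
  obtain ⟨δ, hδ⟩ : ∃ δ, a * d - b * c = δ := ⟨_, rfl⟩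
  have hδ0 : δ ≠ 0 := hδ ▸ h
  obtain ⟨p, hp⟩ := exists_conj_companion h2 (h := h) hz hδ hδ0
  rw [hp]
  apply FourPair.conj
  obtain ⟨m, hm⟩ := exists_mul_ne_zero_of_five_le hq _ hδ0
  have hm0 : m ≠ 0 := left_ne_zero_of_mul hm
  have hm1 := right_ne_zero_of_mul hm
  have hx : (1 : F) * (-1) - 0 * 0 ≠ 0 := by simp
  have hy : (1 : F) * (-1) - (δ * m) * m ≠ 0 := fun h0 => hm1 (by linear_combination -h0)
  refine ⟨mk (glOf 1 0 0 (-1) hx), trivial, mk (glOf 1 (δ * m) m (-1) hy), trivial,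
    (isInvol_mk_glOf h2).2 (by ring), (isInvol_mk_glOf h2).2 (by ring),
    commute_mk_glOf (by ring) (by ring) (by ring), commute_mk_glOf (by ring) (by ring) (by ring),
    fun h => ?_, fun h => ?_, fun h => ?_, fun h => ?_⟩
  · obtain ⟨k, h3, h4, h5, h6⟩ := mk_glOf_eq h
    simp at h5
  · obtain ⟨k, h3, h4, h5, h6⟩ := mk_glOf_eq h
    have : k = 0 := by linear_combination -h3
    simp [this] at h5
  · obtain ⟨k, h3, h4, h5, h6⟩ := mk_glOf_eq h.symm
    exact hm0 (by linear_combination h5)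
  · rw [mk_glOf_mul] at h
    obtain ⟨k, h3, h4, h5, h6⟩ := mk_glOf_eq h.symm
    have : (1 : F) = 0 := by linear_combination h3
    exact one_ne_zero this

theorem exists_sq_add_sq (F : Type u) [Field F] [Finite F] : ∃ x y : F, x ^ 2 + y ^ 2 = -1 := by
  obtain ⟨p, hp⟩ := CharP.exists F
  have := CharP.char_is_prime F p
  have : Fact p.Prime := ⟨‹_›⟩
  obtain ⟨a, b, hab⟩ := CharP.sq_add_sq F p (-1)
  exact ⟨a, b, by simpa using hab⟩

/-- In `PSL₂` the determinant is a square `r²`, and conjugation by `diag(r, 1)` turns the companion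
matrix into a multiple of the rotation. -/
theorem exists_conj_rotation (h2 : (2 : F) ≠ 0) {z : PGL(2, F)} (hz : IsInvol z)
    (hz' : z ∈ pslSubgroup F) :
    ∃ p, z = p * mk (glOf 0 (-1) 1 0 (by simp)) * p⁻¹ := by
  obtain ⟨a, b, c, d, h, rfl⟩ := exists_glOf z
  rw [isInvol_mk_glOf h2] at hz
  rw [mk_glOf_mem_pslSubgroup] at hz'
  obtain ⟨r, hr⟩ := hz'
  have hr0 : r ≠ 0 := by
    rintro rfl
    exact h (by simpa using hr)
  obtain ⟨p, hp⟩ := exists_conj_companion h2 (h := h) hz hr (mul_ne_zero hr0 hr0)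
  refine ⟨p * mk (glOf r 0 0 1 (by simpa using hr0)), ?_⟩
  have key : mk (glOf 0 (-(r * r)) 1 0 (by simpa using hr0)) =
      mk (glOf r 0 0 1 (by simpa using hr0)) * mk (glOf 0 (-1) 1 0 (by simp)) *
        (mk (glOf r 0 0 1 (by simpa using hr0)))⁻¹ := by
    rw [eq_mul_inv_iff_mul_eq, mk_glOf_mul, mk_glOf_mul]
    refine (mk_eq_mk_of_smul r fun i j => ?_).symm
    fin_cases i <;> fin_cases j <;> simp
  rw [hp, key]
  group

/-- The matrices `(x, w; w, -x)` with `x² + w² = -1` commute with the rotation and have determinant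
1. Turning `(x, w)` by a point `(α, β)` of the circle `α² + β² = 1` gives another one; `β = 0` and
`α = 0` would stay in the same four-group. -/
theorem fourPair_pslSubgroup [Finite F] (h2 : (2 : F) ≠ 0) (hq : 7 ≤ Nat.card F) {z : PGL(2, F)}
    (hz : IsInvol z) (hz' : z ∈ pslSubgroup F) : FourPair (pslSubgroup F) z := by
  obtain ⟨p, hp⟩ := exists_conj_rotation h2 hz hz'
  rw [hp]
  apply FourPair.conj
  obtain ⟨m, hm⟩ := exists_mul_ne_zero_of_seven_le (F := F) hq
  obtain ⟨x, w, hxw⟩ := exists_sq_add_sq F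
  have hm0 : m ≠ 0 := left_ne_zero_of_mul (left_ne_zero_of_mul hm)
  have hm1 : 1 - m ^ 2 ≠ 0 := right_ne_zero_of_mul (left_ne_zero_of_mul hm)
  have hm2 : 1 + m ^ 2 ≠ 0 := right_ne_zero_of_mul hm
  -- The rational parametrization of the circle. The excluded values of `m` are the roots of a
  -- quintic, whence the bound 7; for `q = 5` they exhaust the field.
  obtain ⟨α, β, hα, hβ, hαβ⟩ : ∃ α β : F, α ≠ 0 ∧ β ≠ 0 ∧ α ^ 2 + β ^ 2 = 1 :=
    ⟨(1 - m ^ 2) / (1 + m ^ 2), 2 * m / (1 + m ^ 2), div_ne_zero hm1 hm2,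
      div_ne_zero (mul_ne_zero h2 hm0) hm2, by field_simp; ring⟩
  have d1 : x * (-x) - w * w = 1 := by linear_combination -hxw
  have d2 : (α * x - β * w) * (-(α * x - β * w)) - (α * w + β * x) * (α * w + β * x) = 1 := by
    linear_combination -(α ^ 2 + β ^ 2) * hxw + hαβ
  refine ⟨mk (glOf x w w (-x) (by rw [d1]; exact one_ne_zero)), ?_,
    mk (glOf (α * x - β * w) (α * w + β * x) (α * w + β * x) (-(α * x - β * w))
      (by rw [d2]; exact one_ne_zero)), ?_,
    (isInvol_mk_glOf h2).2 (by ring), (isInvol_mk_glOf h2).2 (by ring),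
    commute_mk_glOf (by ring) (by ring) (by ring), commute_mk_glOf (by ring) (by ring) (by ring),
    (ne_of_trace h2 ?_ ?_).symm, (ne_of_trace h2 ?_ ?_).symm, fun h => ?_, fun h => ?_⟩
  · rw [mk_glOf_mem_pslSubgroup, d1]; exact IsSquare.one
  · rw [mk_glOf_mem_pslSubgroup, d2]; exact IsSquare.one
  · simp
  · simp
  · simp
  · simp
  · obtain ⟨k, h3, h4, h5, h6⟩ := mk_glOf_eq h.symm
    exact hβ (by linear_combination β * hxw - (x * h4 - w * h3))
  · rw [mk_glOf_mul] at h
    obtain ⟨k, h3, h4, h5, h6⟩ := mk_glOf_eq h.symm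
    exact hα (by linear_combination α * hxw - (x * h3 + w * h4))

theorem eq_or_eq_rotation_mul [Finite F] (hq : Nat.card F = 5) {y y' : PGL(2, F)}
    (hyS : y ∈ pslSubgroup F) (hyS' : y' ∈ pslSubgroup F) (hy : IsInvol y) (hy' : IsInvol y')
    (hc : Commute (mk (glOf 0 (-1) 1 0 (by simp))) y)
    (hc' : Commute (mk (glOf 0 (-1) 1 0 (by simp))) y')
    (hyz : y ≠ mk (glOf 0 (-1) 1 0 (by simp))) (hyz' : y' ≠ mk (glOf 0 (-1) 1 0 (by simp))) :
    y' = y ∨ y' = mk (glOf 0 (-1) 1 0 (by simp)) * y := by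
  have := Fintype.ofFinite F
  have hq' : Fintype.card F = 5 := by rw [← Nat.card_eq_fintype_card, hq]
  have h5 : (5 : F) = 0 := by
    have := Nat.cast_card_eq_zero F
    rw [hq'] at this
    exact_mod_cast this
  have h2 : (2 : F) ≠ 0 := fun h2 => one_ne_zero (α := F) (by linear_combination h5 - 2 * h2)
  have h3 : (3 : F) ≠ 0 := fun h3 => one_ne_zero (α := F) (by linear_combination 2 * h3 - h5)
  have hJ : IsInvol (mk (glOf (0 : F) (-1) 1 0 (by simp))) := (isInvol_mk_glOf h2).2 (by ring)
  obtain ⟨a, b, c, d, h, rfl⟩ := exists_glOf y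
  obtain ⟨a', b', c', d', h', rfl⟩ := exists_glOf y'
  have t1 := trace_mul_eq_zero h2 hJ hy hyz.symm hc
  have t2 := trace_mul_eq_zero h2 hJ hy' hyz'.symm hc'
  have t3 := (isInvol_mk_glOf h2).1 hy
  have t4 := (isInvol_mk_glOf h2).1 hy'
  simp only [glOf_zero_zero, glOf_zero_one, glOf_one_zero, glOf_one_one] at t1 t2
  obtain rfl : c = b := by linear_combination -t1
  obtain rfl : d = -a := by linear_combination t3
  obtain rfl : c' = b' := by linear_combination -t2
  obtain rfl : d' = -a' := by linear_combination t4
  obtain ⟨r, hr⟩ := mk_glOf_mem_pslSubgroup.1 hyS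
  obtain ⟨r', hr'⟩ := mk_glOf_mem_pslSubgroup.1 hyS'
  have hr0 : r ≠ 0 := by
    rintro rfl
    exact h (by simpa using hr)
  have hr0' : r' ≠ 0 := by
    rintro rfl
    exact h' (by simpa using hr')
  have hsq : ∀ x : F, x ≠ 0 → x ^ 2 = 1 ∨ x ^ 2 = -1 := fun x hx => by
    have h4 := FiniteField.pow_card_sub_one_eq_one x hx
    rw [hq'] at h4
    exact sq_eq_sq_iff_eq_or_eq_neg.1 (by linear_combination h4)
  -- The product formula for sums of two squares. In the field with five elements nonzero squares
  -- are `±1`, and no `±1 ± 1` equals `±1`, so one summand vanishes: the first means `y' = z * y`,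
  -- the second `y' = y`, where `z` is the rotation.
  have hAB : (a * a' + c * c') ^ 2 + (a * c' - c * a') ^ 2 = (r * r') ^ 2 := by
    linear_combination -(a' * -a' - c' * c') * hr * (-1) + r * r * hr'
  by_cases hA : a * a' + c * c' = 0
  · right
    have ht : a * a' + c * c' + c * c' + (-a) * (-a') = 0 := by linear_combination 2 * hA
    exact eq_mul_of_commute h2 hy' hJ hy hyz' (ne_of_trace h2 (by simp) (by
      simpa using ht)).symm hyz.symm hc'.symm (commute_mk_glOf (by ring) (by ring) ht).symm hc
  by_cases hB : a * c' - c * a' = 0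
  · left
    refine (mk_eq_mk_of_smul (-(a * a' + c * c') / (r * r)) fun i j => ?_).symm
    fin_cases i <;> fin_cases j <;> simp <;> field_simp
    · linear_combination -a' * hr + c * hB
    · linear_combination -c' * hr - a * hB
    · linear_combination -c' * hr - a * hB
    · linear_combination -a' * hr + c * hB
  exfalso
  have e1 := hsq _ hA
  have e2 := hsq _ hB
  have e3 := hsq _ (mul_ne_zero hr0 hr0')
  have one0 := one_ne_zero (α := F)
  rcases e1 with e1 | e1 <;> rcases e2 with e2 | e2 <;> rcases e3 with e3 | e3 <;>
    rw [e1, e2, e3] at hAB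
  · exact one0 (by linear_combination hAB)
  · exact h3 (by linear_combination hAB)
  · exact one0 (by linear_combination -hAB)
  · exact one0 (by linear_combination hAB)
  · exact one0 (by linear_combination -hAB)
  · exact one0 (by linear_combination hAB)
  · exact h3 (by linear_combination -hAB)
  · exact one0 (by linear_combination -hAB)

theorem commute_of_conj {G : Type*} [Group G] {p z y : G}
    (h : Commute (p * z * p⁻¹) (p * y * p⁻¹)) : Commute z y := by
  simpa [mul_assoc] using commute_conj h p⁻¹

theorem IsInvol.of_conj {G : Type*} [Group G] {p z : G} (h : IsInvol (p * z * p⁻¹)) :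
    IsInvol z := by
  simpa [mul_assoc] using h.conj p⁻¹

theorem eq_or_eq_mul_of_card_eq_five [Finite F] (hq : Nat.card F = 5) {z y y' : PGL(2, F)}
    (hzS : z ∈ pslSubgroup F) (hyS : y ∈ pslSubgroup F) (hyS' : y' ∈ pslSubgroup F)
    (hz : IsInvol z) (hy : IsInvol y) (hy' : IsInvol y') (hc : Commute z y) (hc' : Commute z y')
    (hyz : y ≠ z) (hyz' : y' ≠ z) : y' = y ∨ y' = z * y := by
  have h2 : (2 : F) ≠ 0 := by
    intro h2
    have := Fintype.ofFinite F
    have := Nat.cast_card_eq_zero F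
    rw [← Nat.card_eq_fintype_card, hq] at this
    push_cast at this
    exact one_ne_zero (α := F) (by linear_combination this - 2 * h2)
  obtain ⟨p, hp⟩ := exists_conj_rotation h2 hz hzS
  obtain ⟨y, rfl⟩ : ∃ x, y = p * x * p⁻¹ := ⟨p⁻¹ * y * p, by group⟩
  obtain ⟨y', rfl⟩ : ∃ x, y' = p * x * p⁻¹ := ⟨p⁻¹ * y' * p, by group⟩
  subst hp
  have hS : ∀ x, p * x * p⁻¹ ∈ pslSubgroup F → x ∈ pslSubgroup F := fun x hx => by
    simpa [mul_assoc] using pslSubgroup_normal.conj_mem _ hx p⁻¹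
  have := eq_or_eq_rotation_mul hq (hS _ hyS) (hS _ hyS') hy.of_conj hy'.of_conj
    (commute_of_conj hc) (commute_of_conj hc') (by simpa using hyz) (by simpa using hyz')
  refine this.imp (fun h => by rw [h]) fun h => by rw [h, conj_mul]

theorem exists_commute_pslSubgroup (F : Type u) [Field F] [Finite F] (h2 : (2 : F) ≠ 0) :
    ∃ z ∈ pslSubgroup F, ∃ y ∈ pslSubgroup F, IsInvol z ∧ IsInvol y ∧ Commute z y ∧ y ≠ z := by
  obtain ⟨x, w, hxw⟩ := exists_sq_add_sq F
  have d1 : x * (-x) - w * w = 1 := by linear_combination -hxw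
  refine ⟨mk (glOf 0 (-1) 1 0 (by simp)), ?_, mk (glOf x w w (-x) (by rw [d1]; exact one_ne_zero)),
    ?_, (isInvol_mk_glOf h2).2 (by ring), (isInvol_mk_glOf h2).2 (by ring),
    commute_mk_glOf (by ring) (by ring) (by ring), (ne_of_trace h2 ?_ ?_).symm⟩
  · rw [mk_glOf_mem_pslSubgroup]; simp
  · rw [mk_glOf_mem_pslSubgroup, d1]; exact IsSquare.one
  · simp
  · simp

instance finite_PGL [Finite F] : Finite PGL(2, F) :=
  Finite.of_surjective mk Matrix.ProjGenLinGroup.mk_surjective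

theorem quillenDimension_PGL [Finite F] (h2 : (2 : F) ≠ 0) (hq : 5 ≤ Nat.card F) :
    QuillenDimension 2 PGL(2, F) := by
  rw [← quillenDimension_congr Subgroup.topEquiv]
  obtain ⟨z, -, -, -, hz, -⟩ := exists_commute_pslSubgroup F h2
  exact quillenDimension_of_fourPair ⊤ (fun A hA => card_le_four_of_isElemAbelian h2 hA)
    ⟨z, trivial, hz⟩ fun z _ hz => fourPair_top h2 hq hz

theorem quillenDimension_pslSubgroup_iff [Finite F] (h2 : (2 : F) ≠ 0) (hq : 5 ≤ Nat.card F)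
    (hq6 : Nat.card F ≠ 6) : QuillenDimension 2 (pslSubgroup F) ↔ Nat.card F ≠ 5 := by
  have h4 : ∀ A : Subgroup PGL(2, F), IsElemAbelian 2 A → Nat.card A ≤ 4 := fun A hA =>
    card_le_four_of_isElemAbelian h2 hA
  obtain ⟨z, hzS, y, hyS, hz, hy, hc, hne⟩ := exists_commute_pslSubgroup F h2
  refine ⟨fun h hq5 => ?_, fun h => ?_⟩
  · exact not_quillenDimension_of_eq_or_eq _ h4 ⟨z, hzS, y, hyS, hz, hy, hc, hne⟩
      (fun z hz y hy y' hy' iz iy iy' cy cy' => eq_or_eq_mul_of_card_eq_five hq5 hz hy hy' iz iy iy'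
        cy cy') h
  · exact quillenDimension_of_fourPair _ h4 ⟨z, hzS, hz⟩ fun z hz hi =>
      fourPair_pslSubgroup h2 (by omega) hi hz

end PGL

/-! ### The field involution and Hilbert 90 -/

section FieldAut

variable {F : Type u} [Field F]

/-- The Galois group over the prime field is cyclic, generated by Frobenius, so its involution is
Frobenius to half the degree. -/
theorem exists_eq_pow_of_involutive [Finite F] {σ : F ≃+* F} (hσ : σ ^ 2 = 1) (h1 : σ ≠ 1) :
    ∃ q₀, q₀ ^ 2 = Nat.card F ∧ ∀ x, σ x = x ^ q₀ := by
  obtain ⟨p, hp⟩ := CharP.exists F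
  have hprime := CharP.char_is_prime F p
  have : Fact p.Prime := ⟨hprime⟩
  let _ : Algebra (ZMod p) F := ZMod.algebra F p
  have hfin : Module.Finite (ZMod p) F := inferInstance
  let τ : F ≃ₐ[ZMod p] F := AlgEquiv.ofRingEquiv (f := σ) fun x => by
    have : (σ : F →+* F).comp (algebraMap (ZMod p) F) = algebraMap (ZMod p) F :=
      Subsingleton.elim _ _
    exact DFunLike.congr_fun this x
  have hτ : τ ^ 2 = 1 := by
    ext x
    exact DFunLike.congr_fun hσ x
  have hτ1 : τ ≠ 1 := fun h => h1 (by
    ext x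
    exact DFunLike.congr_fun h x)
  obtain ⟨⟨n, hlt⟩, hn⟩ := (FiniteField.bijective_frobeniusAlgEquivOfAlgebraic_pow (ZMod p) F).2 τ
  simp only at hn
  have hd : Module.finrank (ZMod p) F ∣ n * 2 := by
    rw [← FiniteField.orderOf_frobeniusAlgEquivOfAlgebraic (ZMod p) F]
    apply orderOf_dvd_of_pow_eq_one
    rw [pow_mul, hn, hτ]
  have hn0 : n ≠ 0 := fun h => hτ1 (by rw [← hn, h, pow_zero])
  have hd2 : Module.finrank (ZMod p) F = n * 2 := by
    obtain ⟨k, hk⟩ := hd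
    have hk1 : k = 1 := by
      have hk0 : k ≠ 0 := by rintro rfl; omega
      by_contra hk1
      have : 2 ≤ k := by omega
      nlinarith
    rw [hk, hk1, mul_one]
  refine ⟨p ^ n, ?_, fun x => ?_⟩
  · rw [Module.natCard_eq_pow_finrank (K := ZMod p) (V := F), hd2, Nat.card_zmod, pow_mul]
  · have h2 : τ x = x ^ (p ^ n) := by
      rw [← hn, AlgEquiv.coe_pow, FiniteField.coe_frobeniusAlgEquivOfAlgebraic_iterate, ZMod.card]
    exact h2

theorem eq_of_involutive [Finite F] {σ τ : F ≃+* F} (hσ : σ ^ 2 = 1) (hσ1 : σ ≠ 1)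
    (hτ : τ ^ 2 = 1) (hτ1 : τ ≠ 1) : σ = τ := by
  obtain ⟨m, hm, hm'⟩ := exists_eq_pow_of_involutive hσ hσ1
  obtain ⟨n, hn, hn'⟩ := exists_eq_pow_of_involutive hτ hτ1
  have : m = n := Nat.pow_left_injective (by norm_num : (2 : ℕ) ≠ 0) (hm.trans hn.symm)
  ext x
  rw [hm', hn', this]

/-- The action of the field automorphisms on `PGL₂`. -/
def pglFieldAutHom (F : Type u) [Field F] : (F ≃+* F) →* MulAut PGL(2, F) where
  toFun := pglFieldAut
  map_one' := by
    ext x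
    obtain ⟨g, rfl⟩ := Matrix.ProjGenLinGroup.mk_surjective x
    rfl
  map_mul' σ τ := by
    ext x
    obtain ⟨g, rfl⟩ := Matrix.ProjGenLinGroup.mk_surjective x
    rfl

/-- The group of projective semilinear transformations of the projective line. -/
abbrev PGammaL (F : Type u) [Field F] : Type u := PGL(2, F) ⋊[pglFieldAutHom F] (F ≃+* F)

theorem pglFieldAutHom_apply_mk (σ : F ≃+* F) (g : GL (Fin 2) F) :
    pglFieldAutHom F σ (mk g) = mk (Matrix.GeneralLinearGroup.map (σ : F →+* F) g) := rfl

theorem pglFieldAutHom_apply_glOf (σ : F ≃+* F) {a b c d : F} (h : a * d - b * c ≠ 0) :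
    pglFieldAutHom F σ (mk (glOf a b c d h)) = mk (glOf (σ a) (σ b) (σ c) (σ d) (by
      simpa using (map_ne_zero σ).2 h)) := by
  rw [pglFieldAutHom_apply_mk]
  congr 1
  ext i j
  fin_cases i <;> fin_cases j <;> rfl

theorem pglFieldAutHom_mem_pslSubgroup (σ : F ≃+* F) {x : PGL(2, F)} (hx : x ∈ pslSubgroup F) :
    pglFieldAutHom F σ x ∈ pslSubgroup F := by
  obtain ⟨a, b, c, d, h, rfl⟩ := exists_glOf x
  rw [pglFieldAutHom_apply_glOf, mk_glOf_mem_pslSubgroup]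
  obtain ⟨r, hr⟩ := mk_glOf_mem_pslSubgroup.1 hx
  exact ⟨σ r, by rw [← map_mul, ← map_mul, ← map_mul, ← map_sub, hr]⟩

/-- The form `2k + 3` records both that `q₀` is odd and that it is at least 3. -/
theorem odd_of_sq_eq_card [Finite F] (h2 : (2 : F) ≠ 0) {q₀ : ℕ} (hq : q₀ ^ 2 = Nat.card F) :
    ∃ k, q₀ = 2 * k + 3 := by
  have := Fintype.ofFinite F
  have hodd : Odd q₀ := by
    by_contra h
    rw [Nat.not_odd_iff_even] at h
    obtain ⟨k, hk⟩ := h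
    have h3 := Nat.cast_card_eq_zero F
    rw [← Nat.card_eq_fintype_card, ← hq, hk] at h3
    push_cast at h3
    have h4 : (2 * (k : F)) ^ 2 = 0 := by rw [← h3]; ring
    have h5 : (k : F) = 0 := by simpa [h2] using h4
    obtain ⟨p, hp⟩ := CharP.exists F
    have hprime := CharP.char_is_prime F p
    have : Fact p.Prime := ⟨hprime⟩
    obtain ⟨n, -, hn⟩ := FiniteField.card F p
    have h6 : 2 ∣ p ^ (n : ℕ) := by
      rw [← hn, ← Nat.card_eq_fintype_card, ← hq, hk]
      exact Dvd.dvd.trans ⟨k, by ring⟩ (dvd_pow_self _ two_ne_zero)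
    have h7 := (Nat.prime_dvd_prime_iff_eq Nat.prime_two hprime).1
      (Nat.prime_two.dvd_of_dvd_pow h6)
    subst h7
    exact h2 (by exact_mod_cast CharP.cast_eq_zero F 2)
  obtain ⟨k, hk⟩ := hodd
  have h1 : 1 < Nat.card F := Finite.one_lt_card
  cases k with
  | zero =>
    have : q₀ = 1 := by omega
    rw [this, one_pow] at hq
    omega
  | succ k => exact ⟨k, by omega⟩

variable {q₀ : ℕ} {σ : F ≃+* F}

/-- The multiplier `l` of a semilinear map whose square is the scalar `l`. -/
theorem exists_multiplier (hσ : σ ^ 2 = 1) {g : GL (Fin 2) F}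
    (hg : mk g * pglFieldAutHom F σ (mk g) = 1) : ∃ l : F, l ≠ 0 ∧ σ l = l ∧
      (g : Matrix (Fin 2) (Fin 2) F) * (g : Matrix (Fin 2) (Fin 2) F).map σ = l • 1 := by
  have hss : ∀ x, σ (σ x) = x := fun x => DFunLike.congr_fun hσ x
  set g' := Matrix.GeneralLinearGroup.map (σ : F →+* F) g with hg'
  have hmap : (g' : Matrix (Fin 2) (Fin 2) F) = (g : Matrix (Fin 2) (Fin 2) F).map σ := rfl
  rw [pglFieldAutHom_apply_mk, ← map_mul, eq_comm, ← map_one mk, mk_eq_mk_iff_exists_smul] at hg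
  obtain ⟨l, hl⟩ := hg
  rw [Matrix.GeneralLinearGroup.coe_mul, Matrix.GeneralLinearGroup.coe_one] at hl
  have hl0 : l ≠ 0 := by
    rintro rfl
    have := (g * g').det_ne_zero
    rw [Matrix.GeneralLinearGroup.coe_mul, hl] at this
    simp at this
  refine ⟨l, hl0, ?_, by rw [← hmap, hl]⟩
  have h1 : ((g : Matrix (Fin 2) (Fin 2) F) * g').map σ = (σ l) • 1 := by
    rw [hl]
    ext i j
    fin_cases i <;> fin_cases j <;> simp
  have h3 : (g' : Matrix (Fin 2) (Fin 2) F) * g = (σ l) • 1 := by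
    rw [← h1, hmap]
    ext i j
    simp [Matrix.mul_apply, hss]
  -- Applying `σ` to `g * g' = l` gives `g' * g = σ l`, and associativity compares the two scalars.
  have h4 : (g : Matrix (Fin 2) (Fin 2) F) * (g' * g) = (g * g') * g := by rw [mul_assoc]
  rw [h3, hl] at h4
  simp only [Matrix.mul_smul, Matrix.smul_mul, mul_one, one_mul] at h4
  by_contra hne
  have h5 : (σ l - l) • (g : Matrix (Fin 2) (Fin 2) F) = 0 := by rw [sub_smul, h4, sub_self]
  have h6 := g.det_ne_zero
  rw [(smul_eq_zero.1 h5).resolve_left (sub_ne_zero.2 hne)] at h6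
  simp at h6

/-- The determinant `d` has norm `d^(1 + q₀) = l²` with `l` in the fixed field. Hence `d^((q - 1) /
2) = l^(q₀ - 1) = 1`, and Euler's criterion applies. -/
theorem mem_pslSubgroup_of_mul_eq_one [Finite F] (h2 : (2 : F) ≠ 0) (hσ : σ ^ 2 = 1)
    (hσ1 : σ ≠ 1) {x : PGL(2, F)} (hx : x * pglFieldAutHom F σ x = 1) : x ∈ pslSubgroup F := by
  have := Fintype.ofFinite F
  obtain ⟨q₀, hq, hpow⟩ := exists_eq_pow_of_involutive hσ hσ1
  obtain ⟨k, hk⟩ := odd_of_sq_eq_card h2 hq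
  obtain ⟨g, rfl⟩ := Matrix.ProjGenLinGroup.mk_surjective x
  obtain ⟨l, hl0, hl, hg⟩ := exists_multiplier hσ hx
  have hdet := congrArg Matrix.det hg
  have hmap : ((g : Matrix (Fin 2) (Fin 2) F).map σ).det = σ (g : Matrix (Fin 2) (Fin 2) F).det := by
    rw [Matrix.det_fin_two, Matrix.det_fin_two]
    simp
  rw [Matrix.det_mul, hmap, Matrix.det_smul, Matrix.det_one, Fintype.card_fin, hpow] at hdet
  rw [mk_mem_pslSubgroup]
  set d := (g : Matrix (Fin 2) (Fin 2) F).det with hd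
  have hchar : ringChar F ≠ 2 := fun h => h2 (by
    have := ringChar.Nat.cast_ringChar (R := F)
    rw [h] at this
    exact_mod_cast this)
  rw [FiniteField.isSquare_iff hchar g.det_ne_zero, ← Nat.card_eq_fintype_card, ← hq, ← hd]
  have hl' : l ^ (2 * k + 2) = 1 := by
    have h1 : l ^ (2 * k + 2) * l = 1 * l := by
      rw [← pow_succ, one_mul, show 2 * k + 2 + 1 = q₀ by omega, ← hpow, hl]
    exact mul_right_cancel₀ hl0 h1
  have e1 : q₀ ^ 2 / 2 = (1 + q₀) * (k + 1) := by
    rw [hk]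
    apply Nat.div_eq_of_lt_le <;> nlinarith
  rw [e1, pow_mul, show d ^ (1 + q₀) = l ^ 2 by rw [pow_add, pow_one, hdet, mul_one], ← pow_mul, show 2 * (k + 1) = 2 * k + 2 by ring,
    hl']

/-- The unit group is cyclic of order `(q₀ - 1)(q₀ + 1)`, so an element killed by `q₀ - 1` is a
power with exponent `q₀ + 1`, that is, a norm. -/
theorem exists_norm_eq [Finite F] (hq : q₀ ^ 2 = Nat.card F) (hq1 : 1 < q₀) {l : F} (hl0 : l ≠ 0)
    (hl : l ^ q₀ = l) : ∃ n : F, n ≠ 0 ∧ n * n ^ q₀ = l := by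
  have := Fintype.ofFinite F
  obtain ⟨γ, hγ⟩ := IsCyclic.exists_generator (α := Fˣ)
  obtain ⟨j, hj⟩ := (mem_powers_iff_mem_zpowers (x := γ)).2 (hγ (Units.mk0 l hl0))
  simp only at hj
  obtain ⟨k, rfl⟩ : ∃ k, q₀ = k + 2 := ⟨q₀ - 2, by omega⟩
  have hord : orderOf γ = (k + 1) * (k + 3) := by
    rw [orderOf_eq_card_of_forall_mem_zpowers hγ, Nat.card_units, ← hq]
    apply Nat.sub_eq_of_eq_add
    ring
  have h1 : γ ^ (j * (k + 1)) = 1 := by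
    rw [pow_mul, hj]
    ext
    have : l ^ (k + 1) * l = 1 * l := by rw [← pow_succ, one_mul, hl]
    simpa using mul_right_cancel₀ hl0 this
  have h3 := orderOf_dvd_of_pow_eq_one h1
  rw [hord, mul_comm j] at h3
  obtain ⟨m, rfl⟩ := Nat.dvd_of_mul_dvd_mul_left (Nat.succ_pos k) h3
  refine ⟨(γ ^ m : Fˣ), Units.ne_zero _, ?_⟩
  have h4 : ((γ ^ ((k + 3) * m) : Fˣ) : F) = l := by rw [hj]; rfl
  rw [← h4]
  push_cast
  ring

/-- Hilbert 90 for `PGL₂` over a quadratic extension of finite fields. -/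
theorem exists_eq_mul_inv_map [Finite F] (h2 : (2 : F) ≠ 0) (hσ : σ ^ 2 = 1) (hσ1 : σ ≠ 1)
    {x : PGL(2, F)} (hx : x * pglFieldAutHom F σ x = 1) :
    ∃ p, x = p * (pglFieldAutHom F σ p)⁻¹ := by
  have := Fintype.ofFinite F
  have hss : ∀ x, σ (σ x) = x := fun x => DFunLike.congr_fun hσ x
  obtain ⟨q₀, hq, hpow⟩ := exists_eq_pow_of_involutive hσ hσ1
  obtain ⟨k, hk⟩ := odd_of_sq_eq_card h2 hq
  obtain ⟨g, rfl⟩ := Matrix.ProjGenLinGroup.mk_surjective x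
  obtain ⟨l, hl0, hl, hg⟩ := exists_multiplier hσ hx
  obtain ⟨n, hn0, hn⟩ := exists_norm_eq hq (by omega) hl0 (by rw [← hpow, hl])
  rw [← hpow] at hn
  -- Dividing by an element of norm `l` turns `g` into a genuine cocycle of matrices.
  set M : Matrix (Fin 2) (Fin 2) F := n⁻¹ • (g : Matrix (Fin 2) (Fin 2) F) with hM
  have hMM : M * M.map σ = 1 := by
    have : M.map σ = (σ n)⁻¹ • (g : Matrix (Fin 2) (Fin 2) F).map σ := by
      ext i j
      simp [hM]
    rw [this, hM, Matrix.smul_mul, Matrix.mul_smul, hg, smul_smul, smul_smul, ← hn]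
    have hσn : σ n ≠ 0 := (map_ne_zero σ).2 hn0
    field_simp
    simp
  open Polynomial in
  -- The value of `f` at `c` is `det(c + σ(c) M)`. Its degree is at most `2q₀ < q₀²`, so some `h = c
  -- + σ(c) M` is invertible, and the cocycle condition gives `M * σ(h) = h`.
  let f : Polynomial F := X ^ 2 + C M.trace * X ^ (q₀ + 1) + C M.det * X ^ (2 * q₀)
  have hf0 : f ≠ 0 := by
    intro h
    have h1 := congrArg (fun p => Polynomial.coeff p 2) h
    simp only [f, Polynomial.coeff_add, Polynomial.coeff_C_mul, Polynomial.coeff_X_pow,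
      Polynomial.coeff_zero] at h1
    rw [if_neg (show ¬ (2 = q₀ + 1) by omega), if_neg (show ¬ (2 = 2 * q₀) by omega)] at h1
    simp at h1
  have hfd : f.natDegree ≤ 2 * q₀ := by
    simp only [f]
    compute_degree
    simp only [Nat.max_le]
    omega
  obtain ⟨c, hc⟩ := Polynomial.exists_eval_ne_zero_of_natDegree_lt_card f hf0 (by
    rw [Cardinal.mk_fintype, ← Nat.card_eq_fintype_card, ← hq]
    have : 2 * q₀ < q₀ ^ 2 := by nlinarith
    exact_mod_cast lt_of_le_of_lt hfd this)
  have hdet : (c • 1 + σ c • M).det ≠ 0 := by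
    intro h0
    apply hc
    rw [← h0, Matrix.det_fin_two]
    simp only [f, hpow, Matrix.trace_fin_two, Matrix.det_fin_two M]
    simp
    ring
  set h := Matrix.GeneralLinearGroup.mkOfDetNeZero _ hdet with hh
  refine ⟨mk h, ?_⟩
  rw [eq_mul_inv_iff_mul_eq, pglFieldAutHom_apply_mk, ← map_mul]
  refine (mk_eq_mk_iff_exists_smul.2 ⟨n, ?_⟩).symm
  have hmap : ((Matrix.GeneralLinearGroup.map (σ : F →+* F) h : GL (Fin 2) F) :
      Matrix (Fin 2) (Fin 2) F) = σ c • 1 + c • M.map σ := by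
    ext i j
    change σ ((c • 1 + σ c • M) i j) = _
    simp only [Matrix.add_apply, Matrix.smul_apply, smul_eq_mul, map_add, map_mul, hss,
      Matrix.map_apply]
    congr 2
    rw [Matrix.one_apply]
    split_ifs <;> simp
  have hgM : (g : Matrix (Fin 2) (Fin 2) F) = n • M := by
    rw [hM, smul_smul, mul_inv_cancel₀ hn0, one_smul]
  rw [Matrix.GeneralLinearGroup.coe_mul, hmap, hgM, Matrix.smul_mul, mul_add, Matrix.mul_smul,
    Matrix.mul_smul, hMM, mul_one]
  change _ = n • (c • 1 + σ c • M)
  rw [add_comm]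

end FieldAut

/-! ### The rank-three criteria for subgroups of an ambient group -/

section Ambient

variable {G : Type u} [Group G] {G' : Type v} [Group G']

theorem IsFour.map {V : Subgroup G} (hV : IsFour V) {f : G →* G'} (hf : Function.Injective f) :
    IsFour (V.map f) :=
  ⟨hV.1.map f, by rw [Subgroup.card_map_of_injective hf, hV.2]⟩

theorem IsElemAbelian.subgroupOf {A : Subgroup G} (hA : IsElemAbelian 2 A) (H : Subgroup G) :
    IsElemAbelian 2 (A.subgroupOf H) :=
  isElemAbelian_two_of_sq fun a ha => Subtype.ext (hA.2 a ha)

theorem card_subgroupOf {A H : Subgroup G} (h : A ≤ H) :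
    Nat.card (A.subgroupOf H) = Nat.card A :=
  Nat.card_congr (Subgroup.subgroupOfEquivOfLe h).toEquiv

theorem IsFour.subgroupOf {V H : Subgroup G} (hV : IsFour V) (h : V ≤ H) :
    IsFour (V.subgroupOf H) :=
  ⟨hV.1.subgroupOf H, by rw [card_subgroupOf h, hV.2]⟩

theorem map_subtype_le_of_le_subgroupOf {H N : Subgroup G} {V : Subgroup H}
    (h : V ≤ N.subgroupOf H) : V.map H.subtype ≤ N := by
  rintro _ ⟨v, hv, rfl⟩
  exact h hv

variable {H N : Subgroup G}

theorem card_le_eight (hN : ∀ x ∈ H, ∀ y ∈ H, x ∉ N → y ∉ N → x * y ∈ N)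
    (h4 : ∀ A : Subgroup G, A ≤ N → IsElemAbelian 2 A → Nat.card A ≤ 4) (A : Subgroup G)
    (hAH : A ≤ H) (hA : IsElemAbelian 2 A) : Nat.card A ≤ 8 := by
  by_cases hAN : A ≤ N
  · exact (h4 A hAN hA).trans (by norm_num)
  · rw [card_eq_two_mul_card_inf (fun x hx y hy => hN x (hAH hx) y (hAH hy)) hAN]
    have := h4 (A ⊓ N) inf_le_right (hA.mono inf_le_left)
    omega

/-- Passing from `N` to `H` at most doubles the order of an elementary abelian subgroup, and `⟨t⟩ ×
V` attains the bound 8. -/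
theorem pRank_eq_three [Finite G] (hNH : N ≤ H) (hN : ∀ x ∈ H, ∀ y ∈ H, x ∉ N → y ∉ N → x * y ∈ N)
    (h4 : ∀ A : Subgroup G, A ≤ N → IsElemAbelian 2 A → Nat.card A ≤ 4)
    (hV : ∃ V ≤ N, IsFour V ∧ ∃ t ∈ H, t ∉ N ∧ IsInvol t ∧ ∀ v ∈ V, Commute t v) :
    pRank 2 H = 3 := by
  obtain ⟨V, hVN, hV, t, htH, htN, ht, htc⟩ := hV
  refine pRank_eq ⟨(adjoin t V ht.1 htc).subgroupOf H, (isElemAbelian_adjoin hV.1).subgroupOf H, ?_⟩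
    (IsElemAbelian.card_le_of_subtype fun A hAH hA => card_le_eight hN h4 A hAH hA)
  have hle : adjoin t V ht.1 htc ≤ H := by
    rintro _ ⟨b, hb, rfl | rfl⟩
    · exact hNH (hVN hb)
    · exact mul_mem htH (hNH (hVN hb))
  have hinf : adjoin t V ht.1 htc ⊓ N = V :=
    le_antisymm (fun x hx => mem_of_mem_adjoin hVN htN hx.1 hx.2) (le_inf le_adjoin hVN)
  rw [card_subgroupOf hle, card_eq_two_mul_card_inf (N := N)
    (fun x hx y hy => hN x (hle hx) y (hle hy)) fun h => htN (h self_mem_adjoin), hinf, hV.2]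
  norm_num

theorem quillenDimension_subgroup_of_outer [Finite G] (hNH : N ≤ H) (hr : pRank 2 H = 3) (M D : ℕ)
    (hne : ∃ z ∈ N, IsInvol z)
    (hV : ∀ V : Subgroup G, V ≤ N → IsFour V →
      ∃ t ∈ H, t ∉ N ∧ IsInvol t ∧ ∀ v ∈ V, Commute t v)
    (hD : ∀ z ∈ N, IsInvol z →
      Nat.card {t : G // t ∈ H ∧ t ∉ N ∧ IsInvol t ∧ Commute t z} ≤ D)
    (hM : ∀ z ∈ N, IsInvol z → M ≤ 4 * Nat.card {V : Subgroup G // (V ≤ N ∧ IsFour V) ∧ z ∈ V})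
    (hMpos : 0 < M) (hMD : 12 * D ≤ 5 * M) : QuillenDimension 2 H := by
  refine quillenDimension_of_outer hr (N.subgroupOf H) M D ?_ ?_ ?_ ?_ hMpos hMD
  · obtain ⟨z, hzN, hz⟩ := hne
    exact ⟨⟨z, hNH hzN⟩, hzN, isInvol_coe.1 hz⟩
  · intro V hVN hV'
    obtain ⟨t, htH, htN, ht, htc⟩ := hV _ (map_subtype_le_of_le_subgroupOf hVN)
      (hV'.map H.subtype_injective)
    exact ⟨⟨t, htH⟩, htN, isInvol_coe.1 ht, fun v hv =>
      Subtype.ext (htc v (Subgroup.mem_map_of_mem H.subtype hv))⟩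
  · intro z hzN hz
    refine le_trans ?_ (hD z hzN (isInvol_coe.2 hz))
    refine Nat.card_le_card_of_injective (fun t => ⟨(t.1 : G), t.1.2, t.2.1, isInvol_coe.2 t.2.2.1,
      congrArg Subtype.val t.2.2.2⟩) fun t t' h => ?_
    exact Subtype.ext (Subtype.ext (by simpa using h))
  · intro z hzN hz
    refine (hM z hzN (isInvol_coe.2 hz)).trans (Nat.mul_le_mul_left 4 ?_)
    refine Nat.card_le_card_of_injective (fun V => ⟨V.1.subgroupOf H,
      ⟨Subgroup.comap_mono V.2.1.1, V.2.1.2.subgroupOf (V.2.1.1.trans hNH)⟩, V.2.2⟩)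
      fun V V' h => ?_
    have h1 := congrArg (fun W => Subgroup.map H.subtype W.1) h
    simp only [Subgroup.subgroupOf_map_subtype] at h1
    rw [inf_eq_left.2 (V.2.1.1.trans hNH), inf_eq_left.2 (V'.2.1.1.trans hNH)] at h1
    exact Subtype.ext h1

theorem not_quillenDimension_subgroup_of_outer [Finite G] (hr : pRank 2 H = 3)
    (hN : ∀ x ∈ H, ∀ y ∈ H, x ∉ N → y ∉ N → x * y ∈ N)
    (h4 : ∀ A : Subgroup G, A ≤ N → IsElemAbelian 2 A → Nat.card A ≤ 4)
    (h : ∀ t ∈ H, t ∉ N → IsInvol t → ForestAt N t) : ¬ QuillenDimension 2 H := by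
  refine not_quillenDimension_of_outer hr (N.subgroupOf H) (fun x y hx hy => hN x x.2 y y.2 hx hy)
    ?_ fun t htN ht => ?_
  · intro A hAN hA
    rw [← Subgroup.card_map_of_injective H.subtype_injective]
    exact h4 _ (map_subtype_le_of_le_subgroupOf hAN) (hA.map _)
  · obtain ⟨S, V₀, hS, hV₀⟩ := h t t.2 htN (isInvol_coe.2 ht)
    have hc : ∀ {V : Subgroup H}, (∀ v ∈ V, Commute t v) →
        ∀ v ∈ V.map H.subtype, Commute (t : G) v := by
      rintro V hV _ ⟨v, hv, rfl⟩
      exact congrArg Subtype.val (hV v hv)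
    refine ⟨{x | (x : G) ∈ S}, V₀.subgroupOf H, ?_, ?_⟩
    · intro z hz V W hVN hWN hV hW hcV hcW hzV hzW
      exact Subgroup.map_injective H.subtype_injective (hS z hz _ _
        (map_subtype_le_of_le_subgroupOf hVN) (map_subtype_le_of_le_subgroupOf hWN)
        (hV.map H.subtype_injective) (hW.map H.subtype_injective) (hc hcV) (hc hcW)
        (Subgroup.mem_map_of_mem H.subtype hzV) (Subgroup.mem_map_of_mem H.subtype hzW))
    · intro V hVN hV hcV hne z hz z' hz' h1 h1' hzz
      refine hV₀ _ (map_subtype_le_of_le_subgroupOf hVN) (hV.map H.subtype_injective) (hc hcV)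
        (fun h => hne ?_) z (Subgroup.mem_map_of_mem H.subtype hz) z'
        (Subgroup.mem_map_of_mem H.subtype hz') (by exact_mod_cast h1) (by exact_mod_cast h1')
        (by exact_mod_cast hzz)
      rw [← h, Subgroup.subgroupOf, Subgroup.comap_map_eq_self_of_injective H.subtype_injective]

theorem ForestAt.conj [hNn : N.Normal] {t : G} (h : ForestAt N t) (p : G) :
    ForestAt N (p * t * p⁻¹) := by
  obtain ⟨S, V₀, hS, hV₀⟩ := h
  let f : G →* G := (MulAut.conj p⁻¹).toMonoidHom
  have hf : ∀ x, f x = p⁻¹ * x * p := fun x => by simp [f]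
  have hinj : Function.Injective f := (MulAut.conj p⁻¹).injective
  have hle : ∀ {V : Subgroup G}, V ≤ N → V.map f ≤ N := by
    rintro V hV _ ⟨v, hv, rfl⟩
    rw [hf]
    simpa using hNn.conj_mem v (hV hv) p⁻¹
  have hc : ∀ {V : Subgroup G}, (∀ v ∈ V, Commute (p * t * p⁻¹) v) →
      ∀ v ∈ V.map f, Commute t v := by
    rintro V hV _ ⟨v, hv, rfl⟩
    have h1 := (hV v hv).map f
    rw [hf (p * t * p⁻¹)] at h1
    simpa [mul_assoc] using h1
  refine ⟨f ⁻¹' S, V₀.comap f, ?_, ?_⟩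
  · intro z hz V W hVN hWN hV hW hcV hcW hzV hzW
    exact Subgroup.map_injective hinj (hS _ hz _ _ (hle hVN) (hle hWN) (hV.map hinj) (hW.map hinj)
      (hc hcV) (hc hcW) (Subgroup.mem_map_of_mem f hzV) (Subgroup.mem_map_of_mem f hzW))
  · intro V hVN hV hcV hne z hz z' hz' h1 h1' hzz
    refine hV₀ _ (hle hVN) (hV.map hinj) (hc hcV) (fun h => hne ?_) _
      (Subgroup.mem_map_of_mem f hz) _ (Subgroup.mem_map_of_mem f hz')
      (fun h => h1 (hinj (h.trans (map_one f).symm)))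
      (fun h => h1' (hinj (h.trans (map_one f).symm))) (fun h => hzz (hinj h))
    rw [← h, Subgroup.comap_map_eq_self_of_injective hinj]

end Ambient

/-! ### Four-groups and outer involutions at a given involution of `PSL₂(q₀²)` -/

section Counting

variable {F : Type u} [Field F] [Finite F] {σ : F ≃+* F} {q₀ : ℕ}

theorem exists_sq_eq_neg_one (h2 : (2 : F) ≠ 0) (hq : q₀ ^ 2 = Nat.card F) :
    ∃ i : F, i * i = -1 := by
  have := Fintype.ofFinite F
  obtain ⟨k, hk⟩ := odd_of_sq_eq_card h2 hq
  have h1 : IsSquare (-1 : F) := by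
    rw [FiniteField.isSquare_neg_one_iff, ← Nat.card_eq_fintype_card, ← hq, hk]
    have : (2 * k + 3) ^ 2 = 1 + 4 * (k ^ 2 + 3 * k + 2) := by ring
    rw [this, Nat.add_mul_mod_self_left]
    norm_num
  obtain ⟨i, hi⟩ := h1
  exact ⟨i, hi.symm⟩

/-- With `i² = -1`, the multiple `diag(i, -i)` of `diag(1, -1)` has determinant 1, so its companion
matrix is the rotation. -/
theorem exists_conj_diag (h2 : (2 : F) ≠ 0) (hq : q₀ ^ 2 = Nat.card F) {z : PGL(2, F)}
    (hz : IsInvol z) (hzS : z ∈ pslSubgroup F) :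
    ∃ p, z = p * mk (glOf 1 0 0 (-1) (by simp)) * p⁻¹ := by
  obtain ⟨i, hi⟩ := exists_sq_eq_neg_one h2 hq
  have hi0 : i ≠ 0 := by
    rintro rfl
    simp at hi
  obtain ⟨p, hp⟩ := exists_conj_rotation h2 hz hzS
  have hd : i * (-i) - 0 * 0 = 1 := by linear_combination -hi
  obtain ⟨r, hr⟩ := exists_conj_companion h2 (a := i) (b := 0) (c := 0) (d := -i)
    (h := by rw [hd]; exact one_ne_zero) (by ring) hd one_ne_zero
  have h1 : mk (glOf (1 : F) 0 0 (-1) (by simp)) =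
      mk (glOf i 0 0 (-i) (by rw [hd]; exact one_ne_zero)) :=
    mk_eq_mk_of_smul i fun a b => by fin_cases a <;> fin_cases b <;> simp
  refine ⟨p * r⁻¹, ?_⟩
  rw [hp, h1, hr]
  group

/-- All four-groups in `PSL₂` are conjugate in `PGL₂`. -/
theorem exists_conj_pair (h2 : (2 : F) ≠ 0) (hq : q₀ ^ 2 = Nat.card F) {z y : PGL(2, F)}
    (hz : IsInvol z) (hy : IsInvol y) (hzS : z ∈ pslSubgroup F) (hyS : y ∈ pslSubgroup F)
    (hc : Commute z y) (hne : z ≠ y) :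
    ∃ p, z = p * mk (glOf 1 0 0 (-1) (by simp)) * p⁻¹ ∧
      y = p * mk (glOf 0 1 (-1) 0 (by simp)) * p⁻¹ := by
  obtain ⟨p, rfl⟩ := exists_conj_diag h2 hq hz hzS
  obtain ⟨y, rfl⟩ : ∃ x, y = p * x * p⁻¹ := ⟨p⁻¹ * y * p, by group⟩
  replace hyS : y ∈ pslSubgroup F := by
    simpa [mul_assoc] using pslSubgroup_normal.conj_mem _ hyS p⁻¹
  replace hc := commute_of_conj hc
  replace hy := hy.of_conj
  replace hz := hz.of_conj
  replace hne : mk (glOf (1 : F) 0 0 (-1) (by simp)) ≠ y := by simpa using hne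
  obtain ⟨a, b, c, d, h, rfl⟩ := exists_glOf y
  have t1 := trace_mul_eq_zero h2 hz hy hne hc
  have t2 := (isInvol_mk_glOf h2).1 hy
  simp only [glOf_zero_zero, glOf_zero_one, glOf_one_zero, glOf_one_one] at t1
  obtain rfl : d = a := by linear_combination -t1
  obtain rfl : d = 0 := by
    refine (mul_eq_zero.1 (?_ : (2 : F) * d = 0)).resolve_left h2
    linear_combination t2
  obtain ⟨r, hr⟩ := mk_glOf_mem_pslSubgroup.1 hyS
  have hb : b ≠ 0 := by
    rintro rfl
    simp at h
  have hr0 : r ≠ 0 := by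
    rintro rfl
    exact h (by simpa using hr)
  -- Since `-bc = r²`, a diagonal matrix, which fixes `diag(1, -1)`, normalizes `y`.
  have key : mk (glOf 0 b c 0 h) = mk (glOf 1 0 0 (r / b) (by simp [hr0, hb])) *
      mk (glOf 0 1 (-1) 0 (by simp)) * (mk (glOf 1 0 0 (r / b) (by simp [hr0, hb])))⁻¹ := by
    rw [eq_mul_inv_iff_mul_eq, mk_glOf_mul, mk_glOf_mul]
    refine (mk_eq_mk_of_smul r fun i j => ?_).symm
    fin_cases i <;> fin_cases j <;> simp
    · field_simp
    · field_simp
      linear_combination -hr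
  have key' : mk (glOf (1 : F) 0 0 (-1) (by simp)) = mk (glOf 1 0 0 (r / b) (by simp [hr0, hb])) *
      mk (glOf 1 0 0 (-1) (by simp)) * (mk (glOf 1 0 0 (r / b) (by simp [hr0, hb])))⁻¹ := by
    rw [eq_mul_inv_iff_mul_eq, mk_glOf_mul, mk_glOf_mul]
    apply mk_glOf_congr <;> ring
  refine ⟨p * mk (glOf 1 0 0 (r / b) (by simp [hr0, hb])), ?_, ?_⟩
  · conv_lhs => rw [key']
    group
  · rw [key]
    group

/-- For `z = diag(1, -1)`, each of the `q - 1` units `s` gives a four-group containing the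
antidiagonal matrix `(0, s; -1/s, 0)`. Two units giving the same four-group satisfy `s'⁴ = s⁴`, so a
four-group arises at most four times. -/
theorem card_sub_one_le (h2 : (2 : F) ≠ 0) (hq : q₀ ^ 2 = Nat.card F) {z : PGL(2, F)}
    (hz : IsInvol z) (hzS : z ∈ pslSubgroup F) :
    Nat.card F - 1 ≤
      4 * Nat.card {V : Subgroup PGL(2, F) // (V ≤ pslSubgroup F ∧ IsFour V) ∧ z ∈ V} := by
  classical
  obtain ⟨p, hp⟩ := exists_conj_diag h2 hq hz hzS
  set z₀ := mk (glOf (1 : F) 0 0 (-1) (by simp)) with hz₀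
  have hinv : IsInvol z₀ := (isInvol_mk_glOf h2).2 (by ring)
  have hzS₀ : z₀ ∈ pslSubgroup F := by
    have := pslSubgroup_normal.conj_mem _ hzS p⁻¹
    rw [hp] at this
    simpa [mul_assoc] using this
  have hle : Nat.card {V : Subgroup PGL(2, F) // (V ≤ pslSubgroup F ∧ IsFour V) ∧ z₀ ∈ V} ≤
      Nat.card {V : Subgroup PGL(2, F) // (V ≤ pslSubgroup F ∧ IsFour V) ∧ z ∈ V} := by
    refine Nat.card_le_card_of_injective (fun V => ⟨V.1.map (MulAut.conj p).toMonoidHom,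
      ⟨?_, V.2.1.2.map (MulAut.conj p).injective⟩, ?_⟩) fun V W h => ?_
    · rintro _ ⟨v, hv, rfl⟩
      exact pslSubgroup_normal.conj_mem _ (V.2.1.1 hv) p
    · rw [hp]
      exact ⟨z₀, V.2.2, rfl⟩
    · exact Subtype.ext (Subgroup.map_injective (MulAut.conj p).injective (congrArg Subtype.val h))
  refine le_trans ?_ (Nat.mul_le_mul_left 4 hle)
  have hy : ∀ s : Fˣ, IsInvol (mk (glOf 0 (s : F) (-(s⁻¹ : Fˣ)) 0 (by simp))) := fun s =>
    (isInvol_mk_glOf h2).2 (by ring)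
  have hc : ∀ s : Fˣ, Commute z₀ (mk (glOf 0 (s : F) (-(s⁻¹ : Fˣ)) 0 (by simp))) := fun s =>
    commute_mk_glOf (by ring) (by ring) (by ring)
  have hne : ∀ s : Fˣ, mk (glOf 0 (s : F) (-(s⁻¹ : Fˣ)) 0 (by simp)) ≠ z₀ := fun s =>
    (ne_of_trace h2 (by simp) (by simp)).symm
  have hyS : ∀ s : Fˣ, mk (glOf 0 (s : F) (-(s⁻¹ : Fˣ)) 0 (by simp)) ∈ pslSubgroup F := fun s => by
    rw [mk_glOf_mem_pslSubgroup]
    simp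
  let f : Fˣ → {V : Subgroup PGL(2, F) // (V ≤ pslSubgroup F ∧ IsFour V) ∧ z₀ ∈ V} := fun s =>
    ⟨fourGroup (hy s) (hc s), ⟨fun x hx => by
      rcases (mem_fourGroup hinv (hy s) (hc s)).1 hx with rfl | rfl | rfl | rfl
      · exact one_mem _
      · exact hzS₀
      · exact hyS s
      · exact mul_mem hzS₀ (hyS s), isFour_fourGroup hinv (hy s) (hc s) (hne s)⟩,
      (mem_fourGroup hinv (hy s) (hc s)).2 (by simp)⟩
  have hf : ∀ s s' : Fˣ, f s' = f s → (s' / s) ^ 4 = 1 := by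
    intro s s' h
    have h1 : mk (glOf 0 (s' : F) (-(s'⁻¹ : Fˣ)) 0 (by simp)) ∈ fourGroup (hy s) (hc s) := by
      have h3 : fourGroup (hy s') (hc s') = fourGroup (hy s) (hc s) := congrArg Subtype.val h
      rw [← h3]
      exact (mem_fourGroup hinv (hy s') (hc s')).2 (by simp)
    have hs : (s : F) ≠ 0 := s.ne_zero
    have hs' : (s' : F) ≠ 0 := s'.ne_zero
    rcases (mem_fourGroup hinv (hy s) (hc s)).1 h1 with h3 | h3 | h3 | h3
    · exact absurd h3 (hy s').2
    · exact absurd h3 (hne s')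
    · obtain ⟨k, -, h4, h5, -⟩ := mk_glOf_eq h3.symm
      simp only [Units.val_inv_eq_inv_val] at h4 h5
      have h6 : (s' : F) ^ 2 = (s : F) ^ 2 := by
        rw [h4] at h5
        have hk : k ≠ 0 := by rintro rfl; exact hs' (by simp [h4])
        field_simp at h5
        rw [h4]
        linear_combination (s : F) ^ 2 * h5
      have h7 : s' ^ 2 = s ^ 2 := by
        ext
        push_cast
        exact h6
      rw [div_pow, show s' ^ 4 = (s' ^ 2) ^ 2 by rw [← pow_mul], h7, ← pow_mul, div_self']
    · rw [hz₀, mk_glOf_mul] at h3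
      obtain ⟨k, -, h4, h5, -⟩ := mk_glOf_eq h3.symm
      simp only [Units.val_inv_eq_inv_val] at h4 h5
      have h6 : (s' : F) ^ 2 = -(s : F) ^ 2 := by
        have h4' : (s' : F) = k * s := by linear_combination h4
        rw [h4'] at h5
        have hk : k ≠ 0 := by rintro rfl; exact hs' (by simp [h4'])
        field_simp at h5
        rw [h4']
        linear_combination -(s : F) ^ 2 * h5
      have h7 : s' ^ 4 = s ^ 4 := by
        ext
        push_cast
        linear_combination ((s' : F) ^ 2 - (s : F) ^ 2) * h6
      rw [div_pow, h7, div_self']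
  have := Fintype.ofFinite F
  have := Fintype.ofFinite {V : Subgroup PGL(2, F) // (V ≤ pslSubgroup F ∧ IsFour V) ∧ z₀ ∈ V}
  have h1 := Finset.card_le_mul_card_image (s := (Finset.univ : Finset Fˣ)) (f := f) 4 (by
    intro V hV
    obtain ⟨s, -, rfl⟩ := Finset.mem_image.1 hV
    have hsub : Finset.univ.filter (fun s' => f s' = f s) ⊆
        (Finset.univ.filter fun r : Fˣ => r ^ 4 = 1).image (fun r => r * s) := by
      intro s' hs'
      refine Finset.mem_image.2 ⟨s' / s, ?_, by simp⟩
      simpa using hf s s' (Finset.mem_filter.1 hs').2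
    refine (Finset.card_le_card hsub).trans (Finset.card_image_le.trans ?_)
    exact IsCyclic.card_pow_eq_one_le (by norm_num))
  rw [Finset.card_univ, Fintype.card_units] at h1
  rw [Nat.card_eq_fintype_card, Nat.card_eq_fintype_card]
  refine h1.trans (Nat.mul_le_mul_left 4 (Finset.card_le_univ _))

/-- The twisted conjugation `x ↦ p⁻¹ x σ(p)` reduces to `z = diag(1, -1)`. Then `x` is diagonal with
ratio `e` satisfying `e^(q₀ + 1) = 1`, or antidiagonal with ratio satisfying `e^(q₀ - 1) = 1`, which
leaves at most `2q₀` possibilities. -/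
theorem card_outer_le (h2 : (2 : F) ≠ 0) (hσ : σ ^ 2 = 1) (hq : q₀ ^ 2 = Nat.card F)
    (hpow : ∀ x, σ x = x ^ q₀) {z : PGL(2, F)} (hz : IsInvol z) (hzS : z ∈ pslSubgroup F) :
    Nat.card {x : PGL(2, F) // x * pglFieldAutHom F σ x = 1 ∧
      x * pglFieldAutHom F σ z = z * x} ≤ 2 * q₀ := by
  classical
  have := Fintype.ofFinite F
  obtain ⟨k, hk⟩ := odd_of_sq_eq_card h2 hq
  obtain ⟨p, rfl⟩ := exists_conj_diag h2 hq hz hzS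
  set τ := pglFieldAutHom F σ with hτ
  have hττ : ∀ x, τ (τ x) = x := fun x => by
    rw [← MulAut.mul_apply, hτ, ← map_mul, ← sq, hσ, map_one, MulAut.one_apply]
  have hfix : τ (mk (glOf 1 0 0 (-1) (by simp))) = mk (glOf 1 0 0 (-1) (by simp)) := by
    rw [hτ, pglFieldAutHom_apply_glOf]
    apply mk_glOf_congr <;> simp
  -- The value at `e = 0` is a dummy; only roots of unity matter.
  let f : F → PGL(2, F) := fun e => if h : e = 0 then 1 else mk (glOf 1 0 0 e (by simpa using h))
  let g : F → PGL(2, F) := fun e => if h : e = 0 then 1 else mk (glOf 0 1 e 0 (by simpa using h))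
  set T : Finset PGL(2, F) := (Polynomial.nthRootsFinset (q₀ + 1) (1 : F)).image f ∪
    (Polynomial.nthRootsFinset (q₀ - 1) (1 : F)).image g with hT
  have hTcard : T.card ≤ 2 * q₀ := by
    have hn : ∀ n, (Polynomial.nthRootsFinset n (1 : F)).card ≤ n := fun n => by
      rw [Polynomial.nthRootsFinset]
      exact (Multiset.toFinset_card_le _).trans (Polynomial.card_nthRoots n 1)
    refine (Finset.card_union_le _ _).trans ?_
    have h1 := (Finset.card_image_le (f := f)).trans (hn (q₀ + 1))
    have h3 := (Finset.card_image_le (f := g)).trans (hn (q₀ - 1))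
    omega
  refine le_trans ?_ hTcard
  rw [← Nat.card_eq_finsetCard]
  refine Nat.card_le_card_of_injective (fun x => ⟨p⁻¹ * x.1 * τ p, ?_⟩) fun x y h => ?_
  · obtain ⟨x, hx1, hxz⟩ := x
    simp only
    have e1 : (p⁻¹ * x * τ p) * τ (p⁻¹ * x * τ p) = 1 := by
      rw [map_mul, map_mul, hττ, map_inv]
      calc _ = p⁻¹ * (x * τ x) * p := by group
        _ = 1 := by rw [hx1]; group
    have e2 : Commute (p⁻¹ * x * τ p) (mk (glOf 1 0 0 (-1) (by simp))) := by
      rw [map_mul, map_mul, map_inv, hfix] at hxz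
      calc _ = p⁻¹ * (x * (τ p * mk (glOf 1 0 0 (-1) (by simp)) * (τ p)⁻¹)) * τ p := by group
        _ = _ := by rw [hxz]; group
    generalize p⁻¹ * x * τ p = w at e1 e2
    obtain ⟨a, b, c, d, h, rfl⟩ := exists_glOf w
    have e3 := e2.eq
    rw [mk_glOf_mul, mk_glOf_mul] at e3
    obtain ⟨l, l1, l2, l3, l4⟩ := mk_glOf_eq e3
    by_cases ha : a = 0
    · have hb : b ≠ 0 := by
        rintro rfl
        simp [ha] at h
      have hc0 : c ≠ 0 := by
        rintro rfl
        simp [ha] at h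
      have hl : l = -1 := by
        have : b * (l + 1) = 0 := by linear_combination l2
        linear_combination (mul_eq_zero.1 this).resolve_left hb
      have hd : d = 0 := by
        refine (mul_eq_zero.1 (?_ : (2 : F) * d = 0)).resolve_left h2
        rw [hl] at l4
        linear_combination -l4
      subst ha hd
      refine Finset.mem_union_right _ (Finset.mem_image.2 ⟨c / b, ?_, ?_⟩)
      · rw [hτ, pglFieldAutHom_apply_glOf, mk_glOf_mul, mk_eq_one_iff_apply] at e1
        have e4 := e1.2.2
        simp only [glOf_zero_zero, glOf_one_one, hpow] at e4
        rw [Polynomial.mem_nthRootsFinset (by omega)]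
        obtain ⟨m, rfl⟩ : ∃ m, q₀ = m + 1 := ⟨q₀ - 1, by omega⟩
        rw [Nat.add_sub_cancel, div_pow, div_eq_one_iff_eq (pow_ne_zero _ hb)]
        have : b * c * (c ^ m - b ^ m) = 0 := by
          linear_combination e4
        linear_combination (mul_eq_zero.1 this).resolve_left (mul_ne_zero hb hc0)
      · simp only [g]
        rw [dif_neg (div_ne_zero hc0 hb)]
        refine mk_eq_mk_of_smul b fun i j => ?_
        fin_cases i <;> fin_cases j <;> simp
        field_simp
    · have hl : l = 1 := by
        have : a * (l - 1) = 0 := by linear_combination -l1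
        linear_combination (mul_eq_zero.1 this).resolve_left ha
      have hb : b = 0 := by
        refine (mul_eq_zero.1 (?_ : (2 : F) * b = 0)).resolve_left h2
        rw [hl] at l2
        linear_combination l2
      have hc0 : c = 0 := by
        refine (mul_eq_zero.1 (?_ : (2 : F) * c = 0)).resolve_left h2
        rw [hl] at l3
        linear_combination -l3
      subst hb hc0
      have hd : d ≠ 0 := by
        rintro rfl
        simp at h
      refine Finset.mem_union_left _ (Finset.mem_image.2 ⟨d / a, ?_, ?_⟩)
      · rw [hτ, pglFieldAutHom_apply_glOf, mk_glOf_mul, mk_eq_one_iff_apply] at e1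
        have e4 := e1.2.2
        simp only [glOf_zero_zero, glOf_one_one, hpow] at e4
        rw [Polynomial.mem_nthRootsFinset (by omega), div_pow,
          div_eq_one_iff_eq (pow_ne_zero _ ha)]
        rw [zero_pow (by omega)] at e4
        linear_combination -e4
      · simp only [f]
        rw [dif_neg (div_ne_zero hd ha)]
        refine mk_eq_mk_of_smul a fun i j => ?_
        fin_cases i <;> fin_cases j <;> simp
        field_simp
  · have h1 : p⁻¹ * x.1 * τ p = p⁻¹ * y.1 * τ p := by simpa using h
    exact Subtype.ext (by simpa using h1)

end Counting

open SemidirectProduct (inl inr)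

/-! ### The extensions by the field involution inside `PΓL₂` -/

section FieldExtension

variable {F : Type u} [Field F]

instance finite_PGammaL [Finite F] : Finite (PGammaL F) := by
  have : Finite (F ≃+* F) := Finite.of_injective (fun σ : F ≃+* F => (σ : F → F)) DFunLike.coe_injective
  exact Finite.of_injective (fun t : PGammaL F => (t.left, t.right)) fun s t h =>
    SemidirectProduct.ext (congrArg Prod.fst h) (congrArg Prod.snd h)

/-- The extension of `PGL₂(F)` by the group generated by the field automorphism `σ`. -/
def pglFieldExt (σ : F ≃+* F) : Subgroup (PGammaL F) :=
  (Subgroup.zpowers σ).comap SemidirectProduct.rightHom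

/-- The extension of `PSL₂(F)` by the group generated by the field automorphism `σ`. -/
def pslFieldExt (σ : F ≃+* F) : Subgroup (PGammaL F) where
  carrier := {t | t.right ∈ Subgroup.zpowers σ ∧ t.left ∈ pslSubgroup F}
  one_mem' := ⟨one_mem _, one_mem _⟩
  mul_mem' hs ht := ⟨mul_mem hs.1 ht.1, mul_mem hs.2 (pglFieldAutHom_mem_pslSubgroup _ ht.2)⟩
  inv_mem' ht := ⟨inv_mem ht.1, pglFieldAutHom_mem_pslSubgroup _ (inv_mem ht.2)⟩

variable {σ : F ≃+* F}

theorem mem_pglFieldExt (hσ : σ ^ 2 = 1) {t : PGammaL F} :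
    t ∈ pglFieldExt σ ↔ t.right = 1 ∨ t.right = σ := by
  rw [← mem_zpowers_iff_of_sq hσ]
  rfl

theorem mem_pslFieldExt (hσ : σ ^ 2 = 1) {t : PGammaL F} :
    t ∈ pslFieldExt σ ↔ (t.right = 1 ∨ t.right = σ) ∧ t.left ∈ pslSubgroup F := by
  rw [← mem_zpowers_iff_of_sq hσ]
  rfl

theorem mem_range_inl {t : PGammaL F} : t ∈ (inl : PGL(2, F) →* PGammaL F).range ↔ t.right = 1 := by
  rw [SemidirectProduct.range_inl_eq_ker_rightHom]
  rfl

theorem mem_map_inl {t : PGammaL F} :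
    t ∈ (pslSubgroup F).map (inl : PGL(2, F) →* PGammaL F) ↔ t.right = 1 ∧ t.left ∈ pslSubgroup F := by
  constructor
  · rintro ⟨x, hx, rfl⟩
    exact ⟨rfl, hx⟩
  · rintro ⟨h1, h2⟩
    exact ⟨t.left, h2, SemidirectProduct.ext rfl h1.symm⟩

theorem map_inl_le_pslFieldExt :
    (pslSubgroup F).map (inl : PGL(2, F) →* PGammaL F) ≤ pslFieldExt σ := by
  rintro _ ⟨x, hx, rfl⟩
  exact ⟨one_mem _, hx⟩

theorem range_inl_le_pglFieldExt : (inl : PGL(2, F) →* PGammaL F).range ≤ pglFieldExt σ := by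
  rintro _ ⟨x, rfl⟩
  exact one_mem (Subgroup.zpowers σ)

instance range_inl_normal : ((inl : PGL(2, F) →* PGammaL F).range).Normal := by
  rw [SemidirectProduct.range_inl_eq_ker_rightHom]
  infer_instance

theorem isInvol_inl {x : PGL(2, F)} : IsInvol (inl x : PGammaL F) ↔ IsInvol x := by
  rw [IsInvol, IsInvol, ← map_pow, ← map_one inl, SemidirectProduct.inl_inj, Ne,
    SemidirectProduct.inl_inj]

theorem isInvol_iff_of_right_eq (hσ : σ ^ 2 = 1) (hσ1 : σ ≠ 1) {t : PGammaL F}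
    (ht : t.right = σ) : IsInvol t ↔ t.left * pglFieldAutHom F σ t.left = 1 := by
  constructor
  · rintro ⟨h, -⟩
    have := congrArg SemidirectProduct.left h
    rwa [sq, SemidirectProduct.mul_left, ht] at this
  · intro h
    refine ⟨SemidirectProduct.ext ?_ ?_, fun h1 => hσ1 ?_⟩
    · rw [sq, SemidirectProduct.mul_left, ht, h]
      rfl
    · rw [sq, SemidirectProduct.mul_right, ht, ← sq, hσ]
      rfl
    · rw [← ht, h1]
      rfl

theorem commute_inl_iff {t : PGammaL F} {z : PGL(2, F)} :
    Commute t (inl z) ↔ t.left * pglFieldAutHom F t.right z = z * t.left := by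
  constructor
  · intro h
    have := congrArg SemidirectProduct.left h.eq
    simpa using this
  · intro h
    refine SemidirectProduct.ext ?_ ?_
    · simpa using h
    · simp

/-- The involutions that induce field automorphisms are conjugate. -/
theorem exists_eq_conj_inr [Finite F] (h2 : (2 : F) ≠ 0) (hσ : σ ^ 2 = 1) (hσ1 : σ ≠ 1)
    {t : PGammaL F} (ht : t.right = σ) (hi : IsInvol t) :
    ∃ p, t = inl p * inr σ * (inl p)⁻¹ := by
  obtain ⟨p, hp⟩ := exists_eq_mul_inv_map h2 hσ hσ1 ((isInvol_iff_of_right_eq hσ hσ1 ht).1 hi)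
  refine ⟨p, SemidirectProduct.ext ?_ ?_⟩
  · rw [← map_inv, hp]
    simp
  · simp [ht]

theorem left_mem_pslSubgroup [Finite F] (h2 : (2 : F) ≠ 0) (hσ : σ ^ 2 = 1) (hσ1 : σ ≠ 1)
    {t : PGammaL F} (ht : t.right = σ) (hi : IsInvol t) : t.left ∈ pslSubgroup F :=
  mem_pslSubgroup_of_mul_eq_one h2 hσ hσ1 ((isInvol_iff_of_right_eq hσ hσ1 ht).1 hi)

/-- Up to conjugation `V` is generated by matrices with entries `0`, `±1`, which `σ` fixes. -/
theorem exists_field_involution [Finite F] (h2 : (2 : F) ≠ 0) (hσ : σ ^ 2 = 1) (hσ1 : σ ≠ 1)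
    {V : Subgroup (PGammaL F)} (hVN : V ≤ (pslSubgroup F).map inl) (hV : IsFour V) :
    ∃ t : PGammaL F, t.right = σ ∧ IsInvol t ∧ ∀ v ∈ V, Commute t v := by
  obtain ⟨q₀, hq, -⟩ := exists_eq_pow_of_involutive hσ hσ1
  obtain ⟨z', hz'V, hz', -⟩ := hV.exists_ne 1
  obtain ⟨y', hy'V, hy', hne⟩ := hV.exists_ne z'
  have hc : Commute z' y' := hV.1.1 _ hz'V _ hy'V
  have hV' := hV.eq_fourGroup hz' hy' hc hne hz'V hy'V
  obtain ⟨z, hzS, rfl⟩ := hVN hz'V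
  obtain ⟨y, hyS, rfl⟩ := hVN hy'V
  have hc' : Commute z y := SemidirectProduct.inl_injective (by simpa using hc.eq)
  obtain ⟨p, rfl, rfl⟩ := exists_conj_pair h2 hq (isInvol_inl.1 hz') (isInvol_inl.1 hy') hzS hyS hc'
    fun h => hne (by rw [h])
  have hfix : ∀ x : PGL(2, F), pglFieldAutHom F σ x = x →
      Commute (inl p * inr σ * (inl p)⁻¹ : PGammaL F) (inl (p * x * p⁻¹)) := by
    intro x hx
    rw [map_mul, map_mul, map_inv]
    refine commute_conj ?_ _
    rw [commute_inl_iff]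
    simpa using hx
  have h1 := hfix _ (show pglFieldAutHom F σ (mk (glOf 1 0 0 (-1) (by simp))) = _ by
    rw [pglFieldAutHom_apply_glOf]
    apply mk_glOf_congr <;> simp)
  have h3 := hfix _ (show pglFieldAutHom F σ (mk (glOf 0 1 (-1) 0 (by simp))) = _ by
    rw [pglFieldAutHom_apply_glOf]
    apply mk_glOf_congr <;> simp)
  have hi : IsInvol (inr σ : PGammaL F) := by
    refine ⟨?_, ?_⟩
    · rw [← map_pow, hσ, map_one]
    · rw [← map_one inr, Ne, SemidirectProduct.inr_inj]
      exact hσ1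
  refine ⟨inl p * inr σ * (inl p)⁻¹, by simp, hi.conj _, ?_⟩
  intro v hv
  rw [hV'] at hv
  rcases (mem_fourGroup hz' hy' hc).1 hv with rfl | rfl | rfl | rfl
  · exact Commute.one_right _
  · exact h1
  · exact h3
  · exact h1.mul_right h3

theorem right_eq_of_notMem_map_inl (hσ : σ ^ 2 = 1) {t : PGammaL F} (ht : t ∈ pslFieldExt σ)
    (htN : t ∉ (pslSubgroup F).map (inl : PGL(2, F) →* PGammaL F)) : t.right = σ := by
  have h1 := (mem_pslFieldExt hσ).1 ht
  exact h1.1.resolve_left fun h => htN (mem_map_inl.2 ⟨h, h1.2⟩)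

theorem right_eq_of_notMem_range_inl (hσ : σ ^ 2 = 1) {t : PGammaL F} (ht : t ∈ pglFieldExt σ)
    (htN : t ∉ (inl : PGL(2, F) →* PGammaL F).range) : t.right = σ :=
  ((mem_pglFieldExt hσ).1 ht).resolve_left fun h => htN (mem_range_inl.2 h)

theorem card_le_four_of_le_range_inl (h2 : (2 : F) ≠ 0) {A : Subgroup (PGammaL F)}
    (hA : A ≤ (inl : PGL(2, F) →* PGammaL F).range) (hA' : IsElemAbelian 2 A) : Nat.card A ≤ 4 := by
  obtain ⟨B, rfl⟩ : ∃ B : Subgroup PGL(2, F), B.map inl = A :=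
    ⟨A.comap inl, by rw [Subgroup.map_comap_eq, inf_eq_right.2 hA]⟩
  rw [Subgroup.card_map_of_injective SemidirectProduct.inl_injective]
  refine card_le_four_of_isElemAbelian h2 (isElemAbelian_two_of_sq fun a ha => ?_)
  have := hA'.2 _ (Subgroup.mem_map_of_mem inl ha)
  rw [← map_pow, ← map_one inl] at this
  exact SemidirectProduct.inl_injective this

theorem map_inl_le_range : (pslSubgroup F).map (inl : PGL(2, F) →* PGammaL F) ≤ inl.range := by
  rintro _ ⟨x, -, rfl⟩
  exact ⟨x, rfl⟩

theorem exists_isFour_le_map_inl [Finite F] (h2 : (2 : F) ≠ 0) :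
    ∃ V : Subgroup (PGammaL F), V ≤ (pslSubgroup F).map inl ∧ IsFour V := by
  obtain ⟨z, hzS, y, hyS, hz, hy, hc, hne⟩ := exists_commute_pslSubgroup F h2
  refine ⟨(fourGroup hy hc).map inl, Subgroup.map_mono fun x hx => ?_,
    (isFour_fourGroup hz hy hc hne).map SemidirectProduct.inl_injective⟩
  rcases (mem_fourGroup hz hy hc).1 hx with rfl | rfl | rfl | rfl
  · exact one_mem _
  · exact hzS
  · exact hyS
  · exact mul_mem hzS hyS

theorem pRank_pslFieldExt [Finite F] (h2 : (2 : F) ≠ 0) (hσ : σ ^ 2 = 1) (hσ1 : σ ≠ 1) :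
    pRank 2 (pslFieldExt σ) = 3 := by
  refine pRank_eq_three map_inl_le_pslFieldExt (fun x hx y hy hxN hyN => ?_)
    (fun A hA hA' => card_le_four_of_le_range_inl h2 (hA.trans map_inl_le_range) hA') ?_
  · have hx' := right_eq_of_notMem_map_inl hσ hx hxN
    have hy' := right_eq_of_notMem_map_inl hσ hy hyN
    refine mem_map_inl.2 ⟨by rw [SemidirectProduct.mul_right, hx', hy', ← sq, hσ], (mul_mem hx hy).2⟩
  · obtain ⟨V, hVN, hV⟩ := exists_isFour_le_map_inl h2
    obtain ⟨t, ht, hi, hc⟩ := exists_field_involution h2 hσ hσ1 hVN hV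
    refine ⟨V, hVN, hV, t, (mem_pslFieldExt hσ).2 ⟨Or.inr ht, left_mem_pslSubgroup h2 hσ hσ1 ht hi⟩,
      fun h => hσ1 ?_, hi, hc⟩
    rw [← ht, (mem_map_inl.1 h).1]

theorem mul_mem_range_inl (hσ : σ ^ 2 = 1) : ∀ x ∈ pglFieldExt σ, ∀ y ∈ pglFieldExt σ,
    x ∉ (inl : PGL(2, F) →* PGammaL F).range → y ∉ (inl : PGL(2, F) →* PGammaL F).range →
      x * y ∈ (inl : PGL(2, F) →* PGammaL F).range := by
  intro x hx y hy hxN hyN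
  rw [mem_range_inl, SemidirectProduct.mul_right, right_eq_of_notMem_range_inl hσ hx hxN,
    right_eq_of_notMem_range_inl hσ hy hyN, ← sq, hσ]

theorem pRank_pglFieldExt [Finite F] (h2 : (2 : F) ≠ 0) (hσ : σ ^ 2 = 1) (hσ1 : σ ≠ 1) :
    pRank 2 (pglFieldExt σ) = 3 := by
  refine pRank_eq_three range_inl_le_pglFieldExt (mul_mem_range_inl hσ)
    (fun A hA hA' => card_le_four_of_le_range_inl h2 hA hA') ?_
  obtain ⟨V, hVN, hV⟩ := exists_isFour_le_map_inl h2
  obtain ⟨t, ht, hi, hc⟩ := exists_field_involution h2 hσ hσ1 hVN hV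
  refine ⟨V, hVN.trans map_inl_le_range, hV, t, (mem_pglFieldExt hσ).2 (Or.inr ht),
    fun h => hσ1 ?_, hi, hc⟩
  rw [← ht, mem_range_inl.1 h]

/-- The counting criterion with `M = q - 1` and `D = 2q₀` requires `24 q₀ ≤ 5 (q₀² - 1)`. This fails
for `q₀ = 3` and holds from `q₀ = 5` on, where it is an equality. -/
theorem quillenDimension_pslFieldExt [Finite F] (h2 : (2 : F) ≠ 0) (hσ : σ ^ 2 = 1) (hσ1 : σ ≠ 1)
    (h9 : Nat.card F ≠ 9) : QuillenDimension 2 (pslFieldExt σ) := by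
  obtain ⟨q₀, hq, hpow⟩ := exists_eq_pow_of_involutive hσ hσ1
  obtain ⟨k, hk⟩ := odd_of_sq_eq_card h2 hq
  have hk1 : 1 ≤ k := by
    by_contra h
    obtain rfl : k = 0 := by omega
    subst hk
    exact h9 hq.symm
  obtain ⟨k, rfl⟩ : ∃ l, k = l + 1 := ⟨k - 1, by omega⟩
  have hcard : Nat.card F - 1 = (2 * k + 4) * (2 * k + 6) := by
    rw [← hq, hk]
    apply Nat.sub_eq_of_eq_add
    ring
  refine quillenDimension_subgroup_of_outer map_inl_le_pslFieldExt (pRank_pslFieldExt h2 hσ hσ1)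
    (Nat.card F - 1) (2 * q₀) ?_ ?_ ?_ ?_ ?_ ?_
  · obtain ⟨z, hzS, -, -, hz, -⟩ := exists_commute_pslSubgroup F h2
    exact ⟨inl z, Subgroup.mem_map_of_mem inl hzS, isInvol_inl.2 hz⟩
  · intro V hVN hV
    obtain ⟨t, ht, hi, hc⟩ := exists_field_involution h2 hσ hσ1 hVN hV
    refine ⟨t, (mem_pslFieldExt hσ).2 ⟨Or.inr ht, left_mem_pslSubgroup h2 hσ hσ1 ht hi⟩,
      fun h => hσ1 ?_, hi, hc⟩
    rw [← ht, (mem_map_inl.1 h).1]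
  · rintro _ ⟨z, hzS, rfl⟩ hz
    refine le_trans ?_ (card_outer_le h2 hσ hq hpow (isInvol_inl.1 hz) hzS)
    have hr : ∀ t : {t : PGammaL F // t ∈ pslFieldExt σ ∧ t ∉ (pslSubgroup F).map inl ∧ IsInvol t ∧
      Commute t (inl z)}, t.1.right = σ := fun t => right_eq_of_notMem_map_inl hσ t.2.1 t.2.2.1
    refine Nat.card_le_card_of_injective (fun t => ⟨t.1.left,
      (isInvol_iff_of_right_eq hσ hσ1 (hr t)).1 t.2.2.2.1, ?_⟩) fun s t h => ?_
    · have := commute_inl_iff.1 t.2.2.2.2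
      rwa [hr t] at this
    · exact Subtype.ext (SemidirectProduct.ext (congrArg Subtype.val h) ((hr s).trans (hr t).symm))
  · rintro _ ⟨z, hzS, rfl⟩ hz
    refine (card_sub_one_le h2 hq (isInvol_inl.1 hz) hzS).trans (Nat.mul_le_mul_left 4 ?_)
    refine Nat.card_le_card_of_injective (fun V => ⟨V.1.map inl, ⟨Subgroup.map_mono V.2.1.1,
      V.2.1.2.map SemidirectProduct.inl_injective⟩, Subgroup.mem_map_of_mem inl V.2.2⟩)
      fun V W h => ?_
    exact Subtype.ext (Subgroup.map_injective SemidirectProduct.inl_injective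
      (congrArg Subtype.val h))
  · rw [hcard]
    positivity
  · rw [hcard, hk]
    nlinarith

end FieldExtension

/-! ### The case `q = 9`: the tree of involutions and four-groups in `PGL₂(3)` -/

section NineElements

set_option maxRecDepth 100000 in
-- The traceless matrices orthogonal to one of determinant `-1` form a hyperbolic plane, which over
-- three elements has only two anisotropic lines, orthogonal to each other. Thus `(x, y, z)` is
-- orthogonal to the second matrix or to its product with the first.
theorem trace_eq_zero_or_of_zmod_three : ∀ a b c : ZMod 3, a * a + b * c = 1 →
    ∀ a' b' c' : ZMod 3, 2 * (a * a') + b * c' + c * b' = 0 → a' * a' + b' * c' ≠ 0 →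
    ∀ x y z : ZMod 3, 2 * (a * x) + b * z + c * y = 0 → x * x + y * z ≠ 0 →
    2 * (x * a') + y * c' + z * b' = 0 ∨
      (a * a' + b * c') * x + (a * b' - b * a') * z + (c * a' - a * c') * y +
        (c * b' + a * a') * (-x) = 0 := by
  decide

/-- The three lines of determinant 1 are the involutions of the normal four-group of `PGL₂(3) ≅ S₄`.
-/
theorem eq_smul_of_zmod_three : ∀ a b c : ZMod 3, a * a + b * c ≠ 0 → a * a + b * c ≠ 1 →
    ∃ k : ZMod 3, k ≠ 0 ∧ (a = k * 0 ∧ b = k * 1 ∧ c = k * (-1) ∨ a = k * 1 ∧ b = k * 1 ∧ c = k * 1 ∨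
      a = k * 1 ∧ b = k * (-1) ∧ c = k * (-1)) := by
  decide

variable {F : Type u} [Field F] (ι : ZMod 3 →+* F)

/-- The involution of `PGL₂` with entries in the field with three elements. -/
def involOf (a b c : ZMod 3) (h : a * a + b * c ≠ 0) : PGL(2, F) :=
  mk (glOf (ι a) (ι b) (ι c) (-ι a) (by
    have := (map_ne_zero ι).2 h
    rw [map_add, map_mul, map_mul] at this
    intro h0
    exact this (by linear_combination -h0)))

variable {ι}

theorem isInvol_involOf (h2 : (2 : F) ≠ 0) {a b c : ZMod 3} {h : a * a + b * c ≠ 0} :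
    IsInvol (involOf ι a b c h) := (isInvol_mk_glOf h2).2 (by ring)

theorem trace_of_commute_involOf (h2 : (2 : F) ≠ 0) {a b c a' b' c' : ZMod 3}
    {h : a * a + b * c ≠ 0} {h' : a' * a' + b' * c' ≠ 0}
    (hc : Commute (involOf ι a b c h) (involOf ι a' b' c' h'))
    (hne : involOf ι a b c h ≠ involOf ι a' b' c' h') : 2 * (a * a') + b * c' + c * b' = 0 := by
  have h1 := trace_mul_eq_zero h2 (isInvol_involOf (h := h) h2) (isInvol_involOf (h := h') h2)
    hne hc
  simp only [glOf_zero_zero, glOf_zero_one, glOf_one_zero, glOf_one_one] at h1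
  apply ι.injective
  rw [map_zero, ← h1]
  simp only [map_add, map_mul, map_ofNat]
  ring

/-- An involution of determinant `-1` lies in only one four-group over the field with three
elements. -/
theorem involOf_eq_or_eq_mul (h2 : (2 : F) ≠ 0) {a b c a' b' c' x y z : ZMod 3}
    {h : a * a + b * c ≠ 0} {h' : a' * a' + b' * c' ≠ 0} {hx : x * x + y * z ≠ 0}
    (hd : a * a + b * c = 1) (hc : Commute (involOf ι a b c h) (involOf ι a' b' c' h'))
    (hne : involOf ι a' b' c' h' ≠ involOf ι a b c h)
    (hcx : Commute (involOf ι a b c h) (involOf ι x y z hx))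
    (hnex : involOf ι x y z hx ≠ involOf ι a b c h) :
    involOf ι x y z hx = involOf ι a' b' c' h' ∨
      involOf ι x y z hx = involOf ι a b c h * involOf ι a' b' c' h' := by
  have i1 : IsInvol (involOf ι a b c h) := isInvol_involOf h2
  have i2 : IsInvol (involOf ι a' b' c' h') := isInvol_involOf h2
  have i3 : IsInvol (involOf ι x y z hx) := isInvol_involOf h2
  have t1 := trace_of_commute_involOf h2 hc hne.symm
  have t2 := trace_of_commute_involOf h2 hcx hnex.symm
  by_cases e1 : involOf ι x y z hx = involOf ι a' b' c' h'
  · exact Or.inl e1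
  by_cases e2 : involOf ι x y z hx = involOf ι a b c h * involOf ι a' b' c' h'
  · exact Or.inr e2
  rcases trace_eq_zero_or_of_zmod_three a b c hd a' b' c' t1 h' x y z t2 hx with t3 | t3
  · right
    refine eq_mul_of_commute h2 i3 i1 i2 hnex e1 hne.symm hcx.symm ?_ hc
    refine commute_mk_glOf (by ring) (by ring) ?_
    have := congrArg ι t3
    simp only [map_add, map_mul, map_ofNat, map_zero] at this
    linear_combination this
  · left
    have i4 := i1.mul_isInvol i2 hne.symm hc
    have hcm : Commute (involOf ι a b c h) (involOf ι a b c h * involOf ι a' b' c' h') :=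
      (Commute.refl _).mul_right hc
    have e3 := eq_mul_of_commute h2 i3 i1 i4 hnex e2 (fun h => i2.2 (by simpa using h)) hcx.symm
      (?_ : Commute _ _) hcm
    · rw [e3, ← mul_assoc, i1.mul_self, one_mul]
    · rw [involOf, involOf, involOf, mk_glOf_mul] at *
      rw [isInvol_mk_glOf h2] at i4
      refine commute_mk_glOf (by ring) i4 ?_
      have := congrArg ι t3
      simp only [map_add, map_sub, map_mul, map_neg, map_zero] at this
      linear_combination this

theorem exists_map_zmod_three_eq {e : F} (he : e ^ 3 = e) : ∃ k : ZMod 3, e = ι k := by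
  have : e * ((e - 1) * (e + 1)) = 0 := by linear_combination he
  rcases mul_eq_zero.1 this with h | h
  · exact ⟨0, by rw [h, map_zero]⟩
  · rcases mul_eq_zero.1 h with h | h
    · exact ⟨1, by rw [map_one]; linear_combination h⟩
    · exact ⟨-1, by rw [map_neg, map_one]; linear_combination h⟩

variable {σ : F ≃+* F}

/-- Here `σ` multiplies the matrix by a scalar; after division by a nonzero entry all entries are
fixed by cubing, so they lie in the prime field. -/
theorem exists_involOf (h2 : (2 : F) ≠ 0) (hpow : ∀ x, σ x = x ^ 3) {x : PGL(2, F)}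
    (hx : IsInvol x) (hfix : pglFieldAutHom F σ x = x) :
    ∃ a b c, ∃ h : a * a + b * c ≠ 0, x = involOf ι a b c h := by
  obtain ⟨a, b, c, d, h, rfl⟩ := exists_glOf x
  obtain rfl : d = -a := by linear_combination (isInvol_mk_glOf h2).1 hx
  rw [pglFieldAutHom_apply_glOf] at hfix
  obtain ⟨k, k1, k2, k3, -⟩ := mk_glOf_eq hfix.symm
  obtain ⟨r, hr0, hr⟩ : ∃ r : F, r ≠ 0 ∧ k * r ^ 3 = r := by
    have key : ∀ e : F, e ≠ 0 → σ e = k * e → ∃ r : F, r ≠ 0 ∧ k * r ^ 3 = r := by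
      intro e he hk
      refine ⟨e⁻¹, inv_ne_zero he, ?_⟩
      have h1 : k = e ^ 2 := by
        rw [hpow] at hk
        apply mul_right_cancel₀ he
        linear_combination -hk
      rw [h1]
      field_simp
    by_cases ha : a = 0
    · have hb : b ≠ 0 := by
        rintro rfl
        simp [ha] at h
      exact key b hb k2
    · exact key a ha k1
  have hfin : ∀ e : F, σ e = k * e → ∃ l : ZMod 3, r * e = ι l := by
    intro e he
    refine exists_map_zmod_three_eq ?_
    rw [mul_pow, ← hpow e, he]
    linear_combination e * hr
  obtain ⟨a', ha'⟩ := hfin a k1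
  obtain ⟨b', hb'⟩ := hfin b k2
  obtain ⟨c', hc'⟩ := hfin c k3
  refine ⟨a', b', c', fun h0 => ?_, ?_⟩
  · have h1 := congrArg ι h0
    rw [map_add, map_mul, map_mul, map_zero, ← ha', ← hb', ← hc'] at h1
    have : r ^ 2 * (a * -a - b * c) = 0 := by linear_combination -h1
    exact (mul_ne_zero (pow_ne_zero 2 hr0) h) this
  · refine mk_eq_mk_of_smul r fun i j => ?_
    fin_cases i <;> fin_cases j <;> simp [← ha', ← hb', ← hc']

/-- The leaves are the involutions of determinant `-1`, the transpositions of `S₄`, and `V₀` is the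
normal four-group. A four-group with two involutions that are not leaves shares two involutions with
`V₀`, so it is `V₀`. -/
theorem forestAt_inr [Finite F] (h2 : (2 : F) ≠ 0) (hpow : ∀ x, σ x = x ^ 3) (ι : ZMod 3 →+* F) :
    ForestAt (inl : PGL(2, F) →* PGammaL F).range (inr σ) := by
  have hex : ∀ V : Subgroup (PGammaL F), V ≤ inl.range → IsFour V →
      (∀ v ∈ V, Commute (inr σ) v) → ∀ v ∈ V, v ≠ 1 →
        ∃ a b c, ∃ h : a * a + b * c ≠ 0, v = inl (involOf ι a b c h) := by
    intro V hVN hV hVc v hvV hv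
    obtain ⟨x, rfl⟩ := hVN hvV
    have h1 := commute_inl_iff.1 (hVc _ hvV)
    simp only [SemidirectProduct.left_inr, SemidirectProduct.right_inr, one_mul, mul_one] at h1
    obtain ⟨a, b, c, h, rfl⟩ := exists_involOf (ι := ι) h2 hpow (isInvol_inl.1 (hV.isInvol hvV hv)) h1
    exact ⟨a, b, c, h, rfl⟩
  have hinl : ∀ {x y : PGL(2, F)}, Commute (inl x : PGammaL F) (inl y) → Commute x y := fun h =>
    SemidirectProduct.inl_injective (by simpa using h.eq)
  have i1 : IsInvol (mk (glOf (0 : F) 1 (-1) 0 (by simp))) := (isInvol_mk_glOf h2).2 (by ring)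
  have hd2 : (1 : F) * (-1) - 1 * 1 ≠ 0 := by
    intro h
    exact h2 (by linear_combination -h)
  have i2 : IsInvol (mk (glOf (1 : F) 1 1 (-1) hd2)) := (isInvol_mk_glOf h2).2 (by ring)
  have hc0 : Commute (mk (glOf (0 : F) 1 (-1) 0 (by simp))) (mk (glOf (1 : F) 1 1 (-1) hd2)) :=
    commute_mk_glOf (by ring) (by ring) (by ring)
  have hne0 : mk (glOf (1 : F) 1 1 (-1) hd2) ≠ mk (glOf (0 : F) 1 (-1) 0 (by simp)) :=
    (ne_of_trace h2 (by simp) (by simp)).symm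
  refine ⟨{t | ∃ a b c, ∃ h : a * a + b * c ≠ 0, a * a + b * c = 1 ∧ t = inl (involOf ι a b c h)},
    (fourGroup i2 hc0).map inl, ?_, ?_⟩
  · rintro _ ⟨a, b, c, h, hd, rfl⟩ V W hVN hWN hV hW hcV hcW hzV hzW
    have iz : IsInvol (inl (involOf ι a b c h) : PGammaL F) := isInvol_inl.2 (isInvol_involOf h2)
    obtain ⟨y, hyV, hy, hyne⟩ := hV.exists_ne (inl (involOf ι a b c h))
    obtain ⟨x, hxW, hx, hxne⟩ := hW.exists_ne (inl (involOf ι a b c h))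
    have hcy := hV.1.1 _ hzV _ hyV
    have hcx := hW.1.1 _ hzW _ hxW
    obtain ⟨a', b', c', h', rfl⟩ := hex V hVN hV hcV y hyV hy.2
    obtain ⟨a'', b'', c'', h'', rfl⟩ := hex W hWN hW hcW x hxW hx.2
    have hxV : (inl (involOf ι a'' b'' c'' h'') : PGammaL F) ∈ V := by
      rcases involOf_eq_or_eq_mul h2 hd (hinl hcy) (fun h => hyne (by rw [h])) (hinl hcx)
        (fun h => hxne (by rw [h])) with h | h
      · rwa [h]
      · rw [h, map_mul]
        exact mul_mem hzV hyV
    rw [hV.eq_fourGroup iz hx hcx hxne hzV hxV, hW.eq_fourGroup iz hx hcx hxne hzW hxW]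
  · intro V hVN hV hcV hVne z hz z' hz' h1 h1' hzz
    by_contra! hcon
    have hmem : ∀ v ∈ V, v ≠ 1 →
        v ∉ {t : PGammaL F | ∃ a b c, ∃ h : a * a + b * c ≠ 0, a * a + b * c = 1 ∧
          t = inl (involOf ι a b c h)} → v ∈ (fourGroup i2 hc0).map (inl : _ →* PGammaL F) := by
      intro v hv hv1 hvS
      obtain ⟨a, b, c, h, rfl⟩ := hex V hVN hV hcV v hv hv1
      refine Subgroup.mem_map_of_mem inl ((mem_fourGroup i1 i2 hc0).2 ?_)
      obtain ⟨k, hk, h3⟩ := eq_smul_of_zmod_three a b c h fun hd => hvS ⟨a, b, c, h, hd, rfl⟩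
      rw [mk_glOf_mul]
      rcases h3 with ⟨rfl, rfl, rfl⟩ | ⟨rfl, rfl, rfl⟩ | ⟨rfl, rfl, rfl⟩
      · refine Or.inr (Or.inl (mk_eq_mk_of_smul (ι k) fun i j => ?_).symm)
        fin_cases i <;> fin_cases j <;> simp
      · refine Or.inr (Or.inr (Or.inl (mk_eq_mk_of_smul (ι k) fun i j => ?_).symm))
        fin_cases i <;> fin_cases j <;> simp
      · refine Or.inr (Or.inr (Or.inr (mk_eq_mk_of_smul (ι k) fun i j => ?_).symm))
        fin_cases i <;> fin_cases j <;> simp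
    have iz := hV.isInvol hz h1
    have iz' := hV.isInvol hz' h1'
    have hc := hV.1.1 _ hz _ hz'
    apply hVne
    rw [hV.eq_fourGroup iz iz' hc hzz.symm hz hz',
      ((isFour_fourGroup i1 i2 hc0 hne0).map SemidirectProduct.inl_injective).eq_fourGroup iz iz' hc
        hzz.symm (hmem z hz h1 hcon.1) (hmem z' hz' h1' hcon.2)]

theorem not_quillenDimension_pglFieldExt [Finite F] (h2 : (2 : F) ≠ 0) (hσ : σ ^ 2 = 1)
    (hσ1 : σ ≠ 1) (h9 : Nat.card F = 9) : ¬ QuillenDimension 2 (pglFieldExt σ) := by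
  obtain ⟨q₀, hq, hpow⟩ := exists_eq_pow_of_involutive hσ hσ1
  obtain rfl : q₀ = 3 := Nat.pow_left_injective (by norm_num : (2 : ℕ) ≠ 0) (by
    simp only
    rw [hq, h9])
  have h3 : (3 : F) = 0 := by
    have := Fintype.ofFinite F
    have h := Nat.cast_card_eq_zero F
    rw [← Nat.card_eq_fintype_card, h9] at h
    have : (3 : F) * 3 = 0 := by
      rw [← h]
      norm_num
    simpa using this
  have : CharP F 3 := (CharP.charP_iff_prime_eq_zero Nat.prime_three).2 (by exact_mod_cast h3)
  refine not_quillenDimension_subgroup_of_outer (pRank_pglFieldExt h2 hσ hσ1) (mul_mem_range_inl hσ)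
    (fun A hA hA' => card_le_four_of_le_range_inl h2 hA hA') fun t htH htN ht => ?_
  obtain ⟨p, rfl⟩ := exists_eq_conj_inr h2 hσ hσ1 (right_eq_of_notMem_range_inl hσ htH htN) ht
  exact (forestAt_inr h2 hpow (ZMod.castHom dvd_rfl F)).conj _

end NineElements

/-! ### Unitriangular generators and unipotent elements -/

section Unipotent

variable {F : Type u} [Field F]

/-- The upper unitriangular matrices in `SL₂`. -/
def upperSL (b : F) : SL(2, F) := ⟨!![1, b; 0, 1], by simp⟩

/-- The lower unitriangular matrices in `SL₂`. -/
def lowerSL (c : F) : SL(2, F) := ⟨!![1, 0; c, 1], by simp⟩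

/-- The upper unitriangular matrices in `PGL₂`. -/
def upper (b : F) : PGL(2, F) := mk (glOf 1 b 0 1 (by simp))

/-- The lower unitriangular matrices in `PGL₂`. -/
def lower (c : F) : PGL(2, F) := mk (glOf 1 0 c 1 (by simp))

theorem coe_upperSL (b : F) : (upperSL b : Matrix (Fin 2) (Fin 2) F) = !![1, b; 0, 1] := rfl

theorem coe_lowerSL (c : F) : (lowerSL c : Matrix (Fin 2) (Fin 2) F) = !![1, 0; c, 1] := rfl

theorem toPGL_upperSL (b : F) : (upperSL b).toPGL = upper b :=
  congrArg mk (Units.ext rfl)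

theorem toPGL_lowerSL (c : F) : (lowerSL c).toPGL = lower c :=
  congrArg mk (Units.ext rfl)

theorem upperSL_mul (a b : F) : upperSL a * upperSL b = upperSL (a + b) := by
  ext i j
  fin_cases i <;> fin_cases j <;> simp [coe_upperSL, add_comm]

theorem lowerSL_mul (a b : F) : lowerSL a * lowerSL b = lowerSL (a + b) := by
  ext i j
  fin_cases i <;> fin_cases j <;> simp [coe_lowerSL]

theorem upperSL_zero : upperSL (0 : F) = 1 := by
  ext i j
  fin_cases i <;> fin_cases j <;> simp [coe_upperSL]

theorem lowerSL_zero : lowerSL (0 : F) = 1 := by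
  ext i j
  fin_cases i <;> fin_cases j <;> simp [coe_lowerSL]

theorem upper_mul (a b : F) : upper a * upper b = upper (a + b) := by
  rw [← toPGL_upperSL, ← toPGL_upperSL, ← map_mul, upperSL_mul, toPGL_upperSL]

theorem upper_injective : Function.Injective (upper (F := F)) := fun a b h => by
  obtain ⟨k, h1, h3, -, -⟩ := mk_glOf_eq h
  rw [h3, ← mul_one k, ← h1, one_mul]

theorem upper_zero : upper (0 : F) = 1 := by
  rw [← toPGL_upperSL, upperSL_zero, map_one]

theorem lower_zero : lower (0 : F) = 1 := by
  rw [← toPGL_lowerSL, lowerSL_zero, map_one]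

theorem upperSL_pow (b : F) (n : ℕ) : upperSL b ^ n = upperSL (n * b) := by
  induction n with
  | zero => rw [pow_zero, Nat.cast_zero, zero_mul, upperSL_zero]
  | succ n ih =>
    rw [pow_succ, ih, upperSL_mul]
    congr 1
    push_cast
    ring

theorem lowerSL_pow (b : F) (n : ℕ) : lowerSL b ^ n = lowerSL (n * b) := by
  induction n with
  | zero => rw [pow_zero, Nat.cast_zero, zero_mul, lowerSL_zero]
  | succ n ih =>
    rw [pow_succ, ih, lowerSL_mul]
    congr 1
    push_cast
    ring

theorem natCast_card_eq_zero [Finite F] : (Nat.card F : F) = 0 := by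
  have := Fintype.ofFinite F
  rw [Nat.card_eq_fintype_card, Nat.cast_card_eq_zero]

theorem upperSL_pow_card [Finite F] (b : F) : upperSL b ^ Nat.card F = 1 := by
  rw [upperSL_pow, natCast_card_eq_zero, zero_mul, upperSL_zero]

theorem lowerSL_pow_card [Finite F] (b : F) : lowerSL b ^ Nat.card F = 1 := by
  rw [lowerSL_pow, natCast_card_eq_zero, zero_mul, lowerSL_zero]

/-- The upper factors clear the diagonal entries with the help of the entry `g 1 0`; the determinant
takes care of the last entry. -/
theorem exists_eq_upperSL_mul {g : SL(2, F)} (hc : g 1 0 ≠ 0) :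
    ∃ x y, g = upperSL x * lowerSL (g 1 0) * upperSL y := by
  have hdet : g 0 0 * g 1 1 - g 0 1 * g 1 0 = 1 := by
    rw [← Matrix.det_fin_two]
    exact g.2
  refine ⟨(g 0 0 - 1) / g 1 0, (g 1 1 - 1) / g 1 0, ?_⟩
  ext i j
  fin_cases i <;> fin_cases j <;> simp [coe_upperSL, coe_lowerSL]
  · field_simp
    ring
  · field_simp
    linear_combination -hdet
  · field_simp
    ring

/-- The unitriangular matrices generate `SL₂`. -/
theorem hom_ext_of_unitriangular {H : Type*} [Group H] {φ ψ : SL(2, F) →* H}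
    (hu : ∀ b, φ (upperSL b) = ψ (upperSL b)) (hl : ∀ c, φ (lowerSL c) = ψ (lowerSL c)) :
    φ = ψ := by
  have key : ∀ g : SL(2, F), g 1 0 ≠ 0 → φ g = ψ g := by
    intro g hg
    obtain ⟨x, y, h⟩ := exists_eq_upperSL_mul hg
    rw [h]
    simp only [map_mul, hu, hl]
  ext g : 1
  by_cases hg : g 1 0 = 0
  · have hdet : g 0 0 * g 1 1 - g 0 1 * g 1 0 = 1 := by
      rw [← Matrix.det_fin_two]
      exact g.2
    have h1 : (lowerSL 1 * g : SL(2, F)) 1 0 ≠ 0 := by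
      have : (lowerSL 1 * g : SL(2, F)) 1 0 = g 0 0 := by
        simp [coe_lowerSL, Matrix.mul_apply, Fin.sum_univ_two, hg]
      rw [this]
      intro h0
      simp [h0, hg] at hdet
    have h3 := key _ h1
    rw [map_mul, map_mul, hl] at h3
    exact mul_left_cancel h3
  · exact key g hg

/-- The elements of `PGL₂` whose order is a power of the characteristic are unipotent. -/
theorem exists_eq_unipotent [Finite F] {x : PGL(2, F)} (hx : x ^ Nat.card F = 1) :
    ∃ a b c, ∃ h : (1 + a) * (1 - a) - b * c ≠ 0, a * a + b * c = 0 ∧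
      x = mk (glOf (1 + a) b c (1 - a) h) := by
  have := Fintype.ofFinite F
  obtain ⟨g, rfl⟩ := Matrix.ProjGenLinGroup.mk_surjective x
  rw [← map_pow, eq_comm, ← map_one mk, mk_eq_mk_iff_exists_smul] at hx
  obtain ⟨k, hk⟩ := hx
  rw [Units.val_pow_eq_pow_val, Matrix.GeneralLinearGroup.coe_one] at hk
  have hk0 : k ≠ 0 := by
    rintro rfl
    have := (g ^ Nat.card F).det_ne_zero
    rw [Units.val_pow_eq_pow_val, hk] at this
    simp at this
  set M : Matrix (Fin 2) (Fin 2) F := k⁻¹ • (g : Matrix (Fin 2) (Fin 2) F) with hM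
  have hMq : M ^ Nat.card F = 1 := by
    rw [hM, smul_pow, hk, smul_smul, inv_pow]
    have : k ^ Nat.card F = k := by rw [Nat.card_eq_fintype_card, FiniteField.pow_card]
    rw [this, inv_mul_cancel₀ hk0, one_smul]
  obtain ⟨p, hp⟩ := CharP.exists F
  have hprime := CharP.char_is_prime F p
  have : Fact p.Prime := ⟨hprime⟩
  obtain ⟨n, -, hn⟩ := FiniteField.card F p
  -- In characteristic `p` the identity `(M - 1)^q = M^q - 1` holds; nilpotency then makes trace and
  -- determinant of `M - 1` vanish.
  have hN : IsNilpotent (M - 1) := by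
    refine ⟨Nat.card F, ?_⟩
    rw [Nat.card_eq_fintype_card, hn, sub_pow_char_pow_of_commute _ _ (Commute.one_right M), ← hn,
      ← Nat.card_eq_fintype_card, hMq, one_pow, sub_self]
  have ht := (Matrix.isNilpotent_trace_of_isNilpotent hN).eq_zero
  have hd : (M - 1).det = 0 := by
    obtain ⟨m, hm⟩ := hN
    have := congrArg Matrix.det hm
    rw [Matrix.det_pow, Matrix.det_zero] at this
    exact eq_zero_of_pow_eq_zero this
  rw [Matrix.trace_fin_two] at ht
  rw [Matrix.det_fin_two] at hd
  simp only [Matrix.sub_apply, Matrix.one_apply_eq, Matrix.one_apply_ne (show (0 : Fin 2) ≠ 1 by simp),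
    Matrix.one_apply_ne (show (1 : Fin 2) ≠ 0 by simp), sub_zero] at ht hd
  have hd' : (M 0 0 - 1) * (M 0 0 - 1) + M 0 1 * M 1 0 = 0 := by
    linear_combination (M 0 0 - 1) * ht - hd
  refine ⟨M 0 0 - 1, M 0 1, M 1 0, ?_, hd', ?_⟩
  · have : (1 + (M 0 0 - 1)) * (1 - (M 0 0 - 1)) - M 0 1 * M 1 0 = 1 := by
      linear_combination -hd'
    rw [this]
    exact one_ne_zero
  · refine mk_eq_mk_of_smul k⁻¹ fun i j => ?_
    fin_cases i <;> fin_cases j <;> simp [hM]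
    simp only [hM, Matrix.smul_apply, smul_eq_mul] at ht
    linear_combination -ht

theorem exists_conj_upper [Finite F] {x : PGL(2, F)} (hx : x ^ Nat.card F = 1) :
    ∃ p b, x = p * upper b * p⁻¹ := by
  obtain ⟨a, b, c, h, h0, rfl⟩ := exists_eq_unipotent hx
  by_cases hc : c = 0
  · subst hc
    have ha : a = 0 := by simpa using h0
    subst ha
    refine ⟨1, b, ?_⟩
    rw [one_mul, inv_one, mul_one]
    apply mk_glOf_congr <;> ring
  -- With `N = x - 1` nilpotent, the columns are the Jordan basis `N e₁, e₁`.
  · refine ⟨mk (glOf a 1 c 0 (by simpa using hc)), 1, ?_⟩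
    rw [eq_mul_inv_iff_mul_eq, upper, mk_glOf_mul, mk_glOf_mul]
    apply mk_glOf_congr
    · linear_combination h0
    · ring
    · ring
    · ring

theorem eq_upper_of_commute [Finite F] {x : PGL(2, F)} (hx : x ^ Nat.card F = 1)
    {t : F} (ht : t ≠ 0) (hc : Commute x (upper t)) : ∃ b, x = upper b := by
  obtain ⟨a, b, c, h, h0, rfl⟩ := exists_eq_unipotent hx
  have h1 := hc.eq
  rw [upper, mk_glOf_mul, mk_glOf_mul] at h1
  obtain ⟨k, k1, k2, k3, k4⟩ := mk_glOf_eq h1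
  have hc0 : c = 0 := by
    by_contra hc0
    have hk : k = 1 := by
      have : c * (k - 1) = 0 := by linear_combination -k3
      linear_combination (mul_eq_zero.1 this).resolve_left hc0
    rw [hk] at k1
    have : t * c = 0 := by linear_combination k1
    exact (mul_ne_zero ht hc0) this
  subst hc0
  have ha : a = 0 := by simpa using h0
  subst ha
  refine ⟨b, ?_⟩
  apply mk_glOf_congr <;> ring

theorem exists_lower_eq_conj (b : F) : mk (glOf (0 : F) 1 (-1) 0 (by simp)) * lower b *
    (mk (glOf (0 : F) 1 (-1) 0 (by simp)))⁻¹ = upper (-b) := by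
  rw [mul_inv_eq_iff_eq_mul, lower, upper, mk_glOf_mul, mk_glOf_mul]
  apply mk_glOf_congr <;> ring

theorem eq_lower_of_commute [Finite F] {x : PGL(2, F)} (hx : x ^ Nat.card F = 1)
    {t : F} (ht : t ≠ 0) (hc : Commute x (lower t)) : ∃ b, x = lower b := by
  set w := mk (glOf (0 : F) 1 (-1) 0 (by simp)) with hw
  have h1 := commute_conj hc w
  rw [exists_lower_eq_conj] at h1
  obtain ⟨b, hb⟩ := eq_upper_of_commute (by rw [conj_pow, hx, mul_one, mul_inv_cancel])
    (neg_ne_zero.2 ht) h1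
  refine ⟨-b, ?_⟩
  rw [← neg_neg b, ← exists_lower_eq_conj, ← hw] at hb
  simpa using hb

end Unipotent

/-! ### Embeddings of `PSL₂` in `PGL₂` are semilinear -/

section Hom

variable {F : Type u} [Field F]

/-- The product of three factors is the Weyl element `(0, a; -1/a, 0)`, which conjugates upper to
lower unitriangular matrices. This relation ties the addition to the multiplication of the field. -/
theorem upperSL_mul_lowerSL_mul {a : F} (ha : a ≠ 0) (b : F) :
    upperSL a * lowerSL (-a⁻¹) * upperSL a * upperSL b =
      lowerSL (-(b * (a ^ 2)⁻¹)) * (upperSL a * lowerSL (-a⁻¹) * upperSL a) := by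
  ext i j
  fin_cases i <;> fin_cases j <;>
    simp [coe_upperSL, coe_lowerSL] <;> field_simp <;> ring_nf <;> simp

/-- The homomorphism is given by a semilinear transformation. -/
def IsSemilinear (β : SL(2, F) →* PGL(2, F)) : Prop :=
  ∃ γ : PGammaL F, ∀ s, inl (β s) = γ * inl s.toPGL * γ⁻¹

theorem IsSemilinear.of_conj {β : SL(2, F) →* PGL(2, F)} (p : PGL(2, F))
    (h : IsSemilinear ((MulAut.conj p⁻¹).toMonoidHom.comp β)) : IsSemilinear β := by
  obtain ⟨γ, hγ⟩ := h
  refine ⟨inl p * γ, fun s => ?_⟩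
  have h1 : inl (p⁻¹ * β s * p) = γ * inl s.toPGL * γ⁻¹ := by
    rw [← hγ]
    simp
  rw [map_mul, map_mul, map_inv] at h1
  calc inl (β s) = inl p * ((inl p)⁻¹ * inl (β s) * inl p) * (inl p)⁻¹ := by group
    _ = _ := by rw [h1]; group

variable [Finite F] {β : SL(2, F) →* PGL(2, F)}

/-- The image of the Weyl relation forces `f(a²) = f(a)²`. As `f` is additive and `2 ≠ 0`,
polarization makes it multiplicative, hence a field automorphism, and then `f' = f`. -/
theorem isSemilinear_of_normalized (h2 : (2 : F) ≠ 0) {f f' : F → F}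
    (hf : ∀ b, β (upperSL b) = upper (f b)) (hf' : ∀ c, β (lowerSL c) = lower (f' c))
    (h0 : ∀ b, f b = 0 → b = 0) (h1 : f 1 = 1) : IsSemilinear β := by
  have hadd : ∀ a b, f (a + b) = f a + f b := fun a b => upper_injective (by
    rw [← hf, ← upperSL_mul, map_mul, hf, hf, upper_mul])
  have hf0 : f 0 = 0 := by simpa using hadd 0 0
  have hf'0 : lower (f' 0) = 1 := by rw [← hf', lowerSL_zero, map_one]
  have key : ∀ a, a ≠ 0 → 1 + f a * f' (-a⁻¹) = 0 ∧ ∀ b,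
      f' (-(b * (a ^ 2)⁻¹)) * f a = f' (-a⁻¹) * f b := by
    intro a ha
    have hrel : ∀ b, upper (f a) * lower (f' (-a⁻¹)) * upper (f a) * upper (f b) =
        lower (f' (-(b * (a ^ 2)⁻¹))) * (upper (f a) * lower (f' (-a⁻¹)) * upper (f a)) := by
      intro b
      simp only [← hf, ← hf', ← map_mul]
      rw [upperSL_mul_lowerSL_mul ha]
    have hx : f a ≠ 0 := fun h => ha (h0 a h)
    generalize f' (-a⁻¹) = y at *
    generalize f a = x at *
    -- The lower factor on one side leaves the first row unchanged, while `upper 1` on the other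
    -- side adds `1 + x * y` to its second entry.
    have e1 : 1 + x * y = 0 := by
      have h3 := hrel 1
      rw [h1] at h3
      simp only [upper, lower, mk_glOf_mul] at h3
      obtain ⟨k, k1, k2, -, -⟩ := mk_glOf_eq h3.symm
      by_contra hne
      have hk : k = 1 := by
        have : (1 + x * y) * (k - 1) = 0 := by linear_combination -k1
        linear_combination (mul_eq_zero.1 this).resolve_left hne
      rw [hk] at k2
      exact hne (by linear_combination k2)
    refine ⟨e1, fun b => ?_⟩
    have h3 := hrel b
    generalize f' (-(b * (a ^ 2)⁻¹)) = w at *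
    simp only [upper, lower, mk_glOf_mul] at h3
    obtain ⟨k, -, k2, k3, k4⟩ := mk_glOf_eq h3.symm
    have hk : k = 1 := by
      have : x * (k - 1) = 0 := by
        linear_combination -k2 + (f b + (1 - k) * x) * e1
      linear_combination (mul_eq_zero.1 this).resolve_left hx
    rw [hk] at k4
    linear_combination -k4 - w * x * e1
  have hsq : ∀ a, f (a ^ 2) = f a ^ 2 := by
    intro a
    by_cases ha : a = 0
    · rw [ha, zero_pow two_ne_zero, hf0, zero_pow two_ne_zero]
    · obtain ⟨k1, -⟩ := key _ (pow_ne_zero 2 ha)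
      obtain ⟨k2, k3⟩ := key _ ha
      have k4 := k3 1
      rw [one_mul, h1] at k4
      generalize f' (-(a ^ 2)⁻¹) = w at *
      generalize f' (-a⁻¹) = y at *
      have hx : f a ≠ 0 := fun h => ha (h0 a h)
      linear_combination (-f a ^ 2) * k1 + f (a ^ 2) * f a * k4 + f (a ^ 2) * k2
  have hmul : ∀ a b, f (a * b) = f a * f b := by
    intro a b
    have h3 := hsq (a + b)
    rw [show (a + b) ^ 2 = a ^ 2 + (a * b + a * b) + b ^ 2 by ring, hadd, hadd, hadd, hadd, hsq,
      hsq] at h3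
    refine mul_left_cancel₀ h2 ?_
    linear_combination h3
  let f₁ : F →+* F :=
    { toFun := f
      map_one' := h1
      map_mul' := hmul
      map_zero' := hf0
      map_add' := hadd }
  let σ : F ≃+* F := RingEquiv.ofBijective f₁ (Finite.injective_iff_bijective.1 f₁.injective)
  have hf'c : ∀ c, lower (f' c) = lower (f c) := by
    intro c
    by_cases hc : c = 0
    · rw [hc, hf'0, hf0, lower_zero]
    · congr 1
      obtain ⟨k1, -⟩ := key (-c⁻¹) (neg_ne_zero.2 (inv_ne_zero hc))
      rw [show -(-c⁻¹)⁻¹ = c by rw [inv_neg, neg_neg, inv_inv]] at k1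
      have k3 : f c * f (-c⁻¹) = -1 := by
        rw [← hmul, mul_neg, mul_inv_cancel₀ hc]
        exact (map_neg f₁ 1).trans (congrArg Neg.neg h1)
      linear_combination -f c * k1 + f' c * k3
  refine ⟨inr σ, fun s => ?_⟩
  have : β = (pglFieldAutHom F σ).toMonoidHom.comp Matrix.SpecialLinearGroup.toPGL := by
    refine hom_ext_of_unitriangular (fun b => ?_) fun c => ?_
    · rw [hf, MonoidHom.comp_apply, toPGL_upperSL]
      change _ = pglFieldAutHom F σ (upper b)
      rw [upper, upper, pglFieldAutHom_apply_glOf]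
      apply mk_glOf_congr
      · rw [map_one]
      · rfl
      · rw [map_zero]
      · rw [map_one]
    · rw [hf', hf'c, MonoidHom.comp_apply, toPGL_lowerSL]
      change _ = pglFieldAutHom F σ (lower c)
      rw [lower, lower, pglFieldAutHom_apply_glOf]
      apply mk_glOf_congr
      · rw [map_one]
      · rw [map_zero]
      · rfl
      · rw [map_one]
  rw [this]
  change inl (pglFieldAutHom F σ s.toPGL) = _
  rw [SemidirectProduct.inl_aut, map_inv]

/-- Every embedding of `PSL₂` in `PGL₂` is given by a semilinear transformation. -/
theorem isSemilinear_of_forall_eq_one (h2 : (2 : F) ≠ 0) (hβ : ∀ s, β s = 1 → s.toPGL = 1) :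
    IsSemilinear β := by
  have hpu : ∀ b, β (upperSL b) ^ Nat.card F = 1 := fun b => by
    rw [← map_pow, upperSL_pow_card, map_one]
  have hcu : ∀ a b : F, Commute (upperSL a) (upperSL b) := fun a b => by
    rw [commute_iff_eq, upperSL_mul, upperSL_mul, add_comm]
  have hcl : ∀ a b : F, Commute (lowerSL a) (lowerSL b) := fun a b => by
    rw [commute_iff_eq, lowerSL_mul, lowerSL_mul, add_comm]
  have hu0 : ∀ b, β (upperSL b) = 1 → b = 0 := fun b hb => by
    have := hβ _ hb
    rw [toPGL_upperSL, ← upper_zero] at this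
    exact upper_injective this
  obtain ⟨p, t, ht⟩ := exists_conj_upper (hpu 1)
  apply IsSemilinear.of_conj p
  have ht0 : t ≠ 0 := by
    rintro rfl
    rw [upper_zero, mul_one, mul_inv_cancel] at ht
    exact one_ne_zero (hu0 1 ht)
  set β₁ := (MulAut.conj p⁻¹).toMonoidHom.comp β with hβ₁
  have hone₁ : ∀ s, β₁ s = 1 → β s = 1 := fun s hs =>
    (MulAut.conj p⁻¹).injective (hs.trans (map_one _).symm)
  have ht₁ : β₁ (upperSL 1) = upper t := by
    rw [hβ₁]
    simp [ht, mul_assoc]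
  -- All upper unitriangular matrices commute with `upperSL 1`, and the unipotent elements commuting
  -- with `upper t` are upper unitriangular.
  have hU : ∀ b, ∃ x, β₁ (upperSL b) = upper x := fun b => by
    refine eq_upper_of_commute ?_ ht0 ?_
    · rw [← map_pow, upperSL_pow_card, map_one]
    · rw [← ht₁]
      exact (hcu b 1).map β₁
  obtain ⟨a, b, c, hdet, hbc, hl⟩ := exists_eq_unipotent (x := β₁ (lowerSL 1)) (by
    rw [← map_pow, lowerSL_pow_card, map_one])
  -- Otherwise the images of `lowerSL 1` and `upperSL 1` would commute, although these matrices do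
  -- not commute modulo scalars.
  have hc : c ≠ 0 := by
    rintro rfl
    have ha : a = 0 := by simpa using hbc
    subst ha
    have h3 : Commute (β₁ (lowerSL 1)) (β₁ (upperSL 1)) := by
      rw [hl, ht₁, upper, commute_iff_eq, mk_glOf_mul, mk_glOf_mul]
      apply mk_glOf_congr <;> ring
    have h4 : β₁ (lowerSL 1 * upperSL 1 * (lowerSL 1)⁻¹ * (upperSL 1)⁻¹) = 1 := by
      rw [map_mul, map_mul, map_mul, map_inv, map_inv, h3.eq]
      group
    have h5 := hβ _ (hone₁ _ h4)
    rw [map_mul, map_inv, mul_inv_eq_one, map_mul, map_inv, map_mul, mul_inv_eq_iff_eq_mul,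
      toPGL_lowerSL, toPGL_upperSL, lower, upper, mk_glOf_mul, mk_glOf_mul] at h5
    obtain ⟨k, k1, k2, k3, k4⟩ := mk_glOf_eq h5
    simp at k1 k2 k3 k4
    rw [← k2] at k4
    simp at k4
  obtain ⟨f₁, hf₁⟩ := Classical.axiom_of_choice hU
  -- This conjugation fixes the upper unitriangular matrices and moves the image of `lowerSL 1` to
  -- `lower c`.
  apply IsSemilinear.of_conj (upper (a / c))
  set β₂ := (MulAut.conj (upper (a / c))⁻¹).toMonoidHom.comp β₁ with hβ₂
  have hone₂ : ∀ s, β₂ s = 1 → β₁ s = 1 := fun s hs =>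
    (MulAut.conj (upper (a / c))⁻¹).injective (hs.trans (map_one _).symm)
  have hf₂ : ∀ b, β₂ (upperSL b) = upper (f₁ b) := fun b => by
    have : β₂ (upperSL b) = (upper (a / c))⁻¹ * β₁ (upperSL b) * upper (a / c) := by simp [hβ₂]
    rw [this, hf₁, mul_assoc, upper_mul, add_comm, ← upper_mul, inv_mul_cancel_left]
  have hl₂ : β₂ (lowerSL 1) = lower c := by
    have : β₂ (lowerSL 1) = (upper (a / c))⁻¹ * β₁ (lowerSL 1) * upper (a / c) := by simp [hβ₂]
    rw [this, hl, mul_assoc, inv_mul_eq_iff_eq_mul, upper, lower, mk_glOf_mul, mk_glOf_mul]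
    apply mk_glOf_congr
    · field_simp
      ring
    · field_simp
      linear_combination hbc
    · ring
    · field_simp
      ring
  obtain ⟨f₂', hf₂'⟩ := Classical.axiom_of_choice
    (fun d => eq_lower_of_commute (x := β₂ (lowerSL d)) (by
      rw [← map_pow, lowerSL_pow_card, map_one]) hc (by
      rw [← hl₂]
      exact (hcl d 1).map β₂))
  have h0 : ∀ b, f₁ b = 0 → b = 0 := fun b hb =>
    hu0 b (hone₁ _ (hone₂ _ (by rw [hf₂, hb, upper_zero])))
  have hs : f₁ 1 ≠ 0 := fun h => one_ne_zero (h0 1 h)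
  -- A diagonal conjugation scales the upper parameter so that 1 is sent to 1.
  apply IsSemilinear.of_conj (mk (glOf (f₁ 1) 0 0 1 (by simpa using hs)))
  refine isSemilinear_of_normalized (f := fun b => f₁ b / f₁ 1) (f' := fun c => f₂' c * f₁ 1) h2
    (fun b => ?_) (fun d => ?_) (fun b hb => h0 b ((div_eq_zero_iff.1 hb).resolve_right hs))
    (div_self hs)
  · have : ∀ x : PGL(2, F), ((MulAut.conj x⁻¹).toMonoidHom.comp β₂) (upperSL b) =
        x⁻¹ * β₂ (upperSL b) * x := fun x => by simp
    rw [this, hf₂, mul_assoc, inv_mul_eq_iff_eq_mul, upper, upper, mk_glOf_mul, mk_glOf_mul]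
    apply mk_glOf_congr
    · ring
    · field_simp
      ring
    · ring
    · ring
  · have : ∀ x : PGL(2, F), ((MulAut.conj x⁻¹).toMonoidHom.comp β₂) (lowerSL d) =
        x⁻¹ * β₂ (lowerSL d) * x := fun x => by simp
    rw [this, hf₂', mul_assoc, inv_mul_eq_iff_eq_mul, lower, lower, mk_glOf_mul, mk_glOf_mul]
    apply mk_glOf_congr <;> ring

end Hom

/-! ### The automorphism groups of `PSL₂` and `PGL₂` -/

section Automorphisms

variable {F : Type u} [Field F]

theorem conj_inl (γ : PGammaL F) (x : PGL(2, F)) :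
    γ * inl x * γ⁻¹ = inl (γ.left * pglFieldAutHom F γ.right x * γ.left⁻¹) := by
  rw [mul_inv_eq_iff_eq_mul]
  refine SemidirectProduct.ext ?_ ?_ <;> simp

/-- Commuting with `upper 1` and `lower 1`, which field automorphisms fix, makes the linear part
scalar; commuting with every `upper b` then makes the field part trivial. -/
theorem eq_one_of_commute_upper_lower {γ : PGammaL F} (hu : ∀ b, Commute γ (inl (upper b)))
    (hl : Commute γ (inl (lower 1))) : γ = 1 := by
  have hfix1 : ∀ σ : F ≃+* F, pglFieldAutHom F σ (lower 1) = lower 1 := fun σ => by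
    rw [lower, pglFieldAutHom_apply_glOf]
    apply mk_glOf_congr <;> simp
  have hfix : ∀ (σ : F ≃+* F) b, pglFieldAutHom F σ (upper b) = upper (σ b) := fun σ b => by
    rw [upper, upper, pglFieldAutHom_apply_glOf]
    apply mk_glOf_congr <;> simp
  have hl' := commute_inl_iff.1 hl
  have hu' := fun b => commute_inl_iff.1 (hu b)
  simp only [hfix, hfix1] at hl' hu'
  have hx : γ.left = 1 := by
    have h1 := hu' 1
    rw [map_one] at h1
    generalize γ.left = x at *
    obtain ⟨a, b, c, d, h, rfl⟩ := exists_glOf x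
    simp only [upper, lower, mk_glOf_mul] at h1 hl'
    obtain ⟨k, k1, k2, k3, k4⟩ := mk_glOf_eq h1
    obtain ⟨l, l1, l2, l3, l4⟩ := mk_glOf_eq hl'
    have hc : c = 0 := by
      by_contra hc
      have : c * (k - 1) = 0 := by linear_combination -k3
      have hk := (mul_eq_zero.1 this).resolve_left hc
      exact hc (by linear_combination k1 + a * hk)
    have hb : b = 0 := by
      by_contra hb
      have : b * (l - 1) = 0 := by linear_combination -l2
      have hl := (mul_eq_zero.1 this).resolve_left hb
      exact hb (by linear_combination -l1 - (a + b) * hl)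
    subst hb hc
    have ha : a ≠ 0 := by
      rintro rfl
      simp at h
    have hk : k - 1 = 0 := by
      have : a * (k - 1) = 0 := by linear_combination -k1
      exact (mul_eq_zero.1 this).resolve_left ha
    rw [mk_eq_one_iff_apply]
    refine ⟨rfl, rfl, ?_⟩
    change a = d
    linear_combination -k2 - a * hk
  refine SemidirectProduct.ext hx (RingEquiv.ext fun b => ?_)
  have h1 := hu' b
  rw [hx, one_mul, mul_one] at h1
  exact upper_injective h1

theorem eq_one_of_commute_toPGL {γ : PGammaL F}
    (h : ∀ s : SL(2, F), Commute γ (inl s.toPGL)) : γ = 1 :=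
  eq_one_of_commute_upper_lower (fun b => toPGL_upperSL b ▸ h (upperSL b))
    (toPGL_lowerSL (1 : F) ▸ h (lowerSL 1))

instance map_inl_normal : ((pslSubgroup F).map (inl : PGL(2, F) →* PGammaL F)).Normal where
  conj_mem := by
    rintro _ ⟨x, hx, rfl⟩ γ
    rw [conj_inl]
    exact Subgroup.mem_map_of_mem inl
      (pslSubgroup_normal.conj_mem _ (pglFieldAutHom_mem_pslSubgroup _ hx) _)

/-- The embedding of `PSL₂` in the group of semilinear transformations. -/
def pslInl (F : Type u) [Field F] : PSL(2, F) →* PGammaL F :=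
  inl.comp Matrix.ProjectiveSpecialLinearGroup.toPGL

theorem pslInl_injective : Function.Injective (pslInl F) :=
  SemidirectProduct.inl_injective.comp Matrix.ProjectiveSpecialLinearGroup.toPGL_injective

theorem range_pslInl : (pslInl F).range = (pslSubgroup F).map inl := MonoidHom.range_comp _ _

/-- Conjugation maps `Γ` to the automorphisms of `K`; a trivial centralizer makes this map
injective. -/
theorem exists_autEquiv {K Γ : Type*} [Group K] [Group Γ] {J : K →* Γ} (hJ : Function.Injective J)
    [J.range.Normal] (hsurj : ∀ α : MulAut K, ∃ γ, ∀ k, J (α k) = γ * J k * γ⁻¹)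
    (hcent : ∀ γ, (∀ k, Commute γ (J k)) → γ = 1) :
    ∃ Ψ : Γ ≃* MulAut K, ∀ γ k, J (Ψ γ k) = γ * J k * γ⁻¹ := by
  let Φ : Γ →* MulAut K :=
    (MulAut.congr (MonoidHom.ofInjective hJ).symm).toMonoidHom.comp MulAut.conjNormal
  have hΦ : ∀ γ k, J (Φ γ k) = γ * J k * γ⁻¹ := by
    intro γ k
    have h1 : MonoidHom.ofInjective hJ (Φ γ k) =
        MulAut.conjNormal γ (MonoidHom.ofInjective hJ k) := by simp [Φ]
    exact congrArg Subtype.val h1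
  refine ⟨MulEquiv.ofBijective Φ ⟨(injective_iff_map_eq_one Φ).2 fun γ hγ => ?_, fun α => ?_⟩, hΦ⟩
  · refine hcent γ fun k => ?_
    have h1 := hΦ γ k
    rw [hγ, MulAut.one_apply, eq_mul_inv_iff_mul_eq] at h1
    exact h1.symm
  · obtain ⟨γ, hγ⟩ := hsurj α
    refine ⟨γ, MulEquiv.ext fun k => hJ ?_⟩
    rw [hΦ, hγ]

/-- The automorphism group of `PSL₂(q)` is the group of semilinear transformations. -/
theorem exists_pslAutEquiv [Finite F] (h2 : (2 : F) ≠ 0) :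
    ∃ Ψ : PGammaL F ≃* MulAut PSL(2, F), (∀ γ k, pslInl F (Ψ γ k) = γ * pslInl F k * γ⁻¹) ∧
      ∀ σ, Ψ (inr σ) = pslFieldAut σ := by
  have : (pslInl F).range.Normal := by
    rw [range_pslInl]
    infer_instance
  have hsurj : ∀ α : MulAut PSL(2, F), ∃ γ, ∀ k, pslInl F (α k) = γ * pslInl F k * γ⁻¹ := by
    intro α
    obtain ⟨γ, hγ⟩ := isSemilinear_of_forall_eq_one h2
      (β := (Matrix.ProjectiveSpecialLinearGroup.toPGL.comp α.toMonoidHom).comp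
        (QuotientGroup.mk' _)) fun s hs => by
      have h1 : α (QuotientGroup.mk' _ s) = 1 :=
        Matrix.ProjectiveSpecialLinearGroup.toPGL_injective (hs.trans (map_one _).symm)
      have h3 := (map_eq_one_iff α α.injective).1 h1
      exact (congrArg Matrix.ProjectiveSpecialLinearGroup.toPGL h3).trans (map_one _)
    refine ⟨γ, fun k => ?_⟩
    induction k using QuotientGroup.induction_on with
    | H s => exact hγ s
  have hcent : ∀ γ, (∀ k, Commute γ (pslInl F k)) → γ = 1 :=
    fun γ hγ => eq_one_of_commute_toPGL fun s => hγ (QuotientGroup.mk' _ s)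
  obtain ⟨Ψ, hΨ⟩ := exists_autEquiv pslInl_injective hsurj hcent
  refine ⟨Ψ, hΨ, fun σ => MulEquiv.ext fun k => pslInl_injective ?_⟩
  rw [hΨ]
  induction k using QuotientGroup.induction_on with
  | H s =>
    change inr σ * inl _ * (inr σ)⁻¹ = inl _
    rw [conj_inl]
    congr 1
    rw [SemidirectProduct.left_inr, one_mul, inv_one, mul_one, SemidirectProduct.right_inr]
    exact congrArg mk (Units.ext rfl)

/-- The automorphism group of `PGL₂(q)` is the group of semilinear transformations. -/
theorem exists_pglAutEquiv [Finite F] (h2 : (2 : F) ≠ 0) :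
    ∃ Ψ : PGammaL F ≃* MulAut PGL(2, F), (∀ γ k, inl (Ψ γ k) = γ * inl k * γ⁻¹) ∧
      ∀ σ, Ψ (inr σ) = pglFieldAut σ := by
  have hsurj : ∀ α : MulAut PGL(2, F), ∃ γ : PGammaL F, ∀ k, inl (α k) = γ * inl k * γ⁻¹ := by
    intro α
    obtain ⟨γ, hγ⟩ := isSemilinear_of_forall_eq_one h2
      (β := α.toMonoidHom.comp Matrix.SpecialLinearGroup.toPGL) fun s hs =>
        (map_eq_one_iff α α.injective).1 hs
    replace hγ : ∀ s : SL(2, F), inl (α s.toPGL) = γ * inl s.toPGL * γ⁻¹ := hγ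
    refine ⟨γ, fun x => ?_⟩
    -- The automorphism and `γ` agree on `PSL₂`, which is normal. So for any `x` the two candidate
    -- images of `x` differ by an element centralizing `PSL₂`, and such an element is trivial.
    rw [eq_mul_inv_iff_mul_eq, ← inv_mul_eq_iff_eq_mul, ← mul_inv_eq_one]
    apply eq_one_of_commute_toPGL
    intro s
    obtain ⟨s', hs'⟩ : ∃ s' : SL(2, F), s'.toPGL = x⁻¹ * s.toPGL * x := by
      have h1 : x⁻¹ * s.toPGL * x⁻¹⁻¹ ∈ pslSubgroup F :=
        pslSubgroup_normal.conj_mem _ ⟨QuotientGroup.mk' _ s, rfl⟩ x⁻¹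
      obtain ⟨k, hk⟩ := h1
      induction k using QuotientGroup.induction_on with
      | H s' => exact ⟨s', by rw [inv_inv] at hk; exact hk⟩
    have h1 := hγ s'
    rw [hs'] at h1
    simp only [map_mul, map_inv] at h1
    rw [hγ s] at h1
    rw [commute_iff_eq]
    generalize (inl (α x) : PGammaL F) = A at *
    generalize (inl x : PGammaL F) = X at *
    generalize (inl s.toPGL : PGammaL F) = S at *
    have h3 : S = γ⁻¹ * (A * (A⁻¹ * (γ * S * γ⁻¹) * A) * A⁻¹) * γ := by group
    rw [h1] at h3
    calc γ⁻¹ * (A * γ) * X⁻¹ * S =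
        γ⁻¹ * (A * (γ * (X⁻¹ * S * X) * γ⁻¹) * A⁻¹) * γ * (γ⁻¹ * (A * γ) * X⁻¹) := by group
      _ = S * (γ⁻¹ * (A * γ) * X⁻¹) := by rw [← h3]
  have hcent : ∀ γ : PGammaL F, (∀ k : PGL(2, F), Commute γ (inl k)) → γ = 1 :=
    fun γ hγ => eq_one_of_commute_toPGL fun s => hγ s.toPGL
  obtain ⟨Ψ, hΨ⟩ := exists_autEquiv SemidirectProduct.inl_injective hsurj hcent
  refine ⟨Ψ, hΨ, fun σ => MulEquiv.ext fun k =>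
    SemidirectProduct.inl_injective (φ := pglFieldAutHom F) ?_⟩
  rw [hΨ, conj_inl]
  congr 1
  rw [SemidirectProduct.left_inr, one_mul, inv_one, mul_one, SemidirectProduct.right_inr]
  rfl

end Automorphisms

/-! ### 2-extensions inside `PΓL₂` and the case distinction -/

section Extensions

variable {F : Type u} [Field F]

theorem IsPExtension.exists_mul {G : Type*} [Group G] {L B : Subgroup G} [L.Normal] {p : ℕ}
    (h : IsPExtension p L B) (g : G) : ∃ l ∈ L, ∃ b ∈ B, g = l * b := by
  obtain ⟨⟨l, b⟩, hlb⟩ := h.split.2 g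
  exact ⟨l, l.2, b, b.2, hlb.symm⟩

theorem IsPExtension.eq_one_of_mem {G : Type*} [Group G] {L B : Subgroup G} [L.Normal] {p : ℕ}
    (h : IsPExtension p L B) {g : G} (hL : g ∈ L) (hB : g ∈ B) : g = 1 :=
  Subgroup.disjoint_def.1 h.split.isCompl.disjoint hL hB

/-- A `p`-extension of `K` embeds in `Γ` if `Γ` is the automorphism group of `K`. -/
theorem IsPExtension.exists_hom {K Γ G : Type*} [Group K] [Group Γ] [Group G] {J : K →* Γ}
    (hJ : Function.Injective J) {Ψ : Γ ≃* MulAut K} (hΨ : ∀ γ k, J (Ψ γ k) = γ * J k * γ⁻¹)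
    {L B : Subgroup G} [L.Normal] {p : ℕ} (h : IsPExtension p L B) (e : L ≃* K) :
    ∃ ρ : G →* Γ, Function.Injective ρ ∧ (∀ l : L, ρ l = J (e l)) ∧
      ∀ g, Ψ (ρ g) = MulAut.congr e (MulAut.conjNormal g) := by
  let ρ : G →* Γ :=
    Ψ.symm.toMonoidHom.comp ((MulAut.congr e).toMonoidHom.comp MulAut.conjNormal)
  have hρ : ∀ g, Ψ (ρ g) = MulAut.congr e (MulAut.conjNormal g) := fun g =>
    Ψ.apply_symm_apply _
  have hL : ∀ l : L, ρ l = J (e l) := by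
    intro l
    apply Ψ.injective
    rw [hρ]
    ext k
    apply hJ
    rw [hΨ, ← map_inv, ← map_mul, ← map_mul]
    congr 1
    apply e.symm.injective
    ext
    simp
  refine ⟨ρ, (injective_iff_map_eq_one ρ).2 fun g hg => ?_, hL, hρ⟩
  obtain ⟨l, hl, b, hb, rfl⟩ := h.exists_mul g
  -- If `l * b` acts trivially, then `b` acts as the inner automorphism of `l⁻¹`.
  have hb1 : b = 1 := by
    refine h.outer b hb ⟨⟨l, hl⟩⁻¹, ?_⟩
    have h1 : ρ b = ρ ((⟨l, hl⟩⁻¹ : L) : G) := by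
      rw [map_mul, mul_eq_one_iff_inv_eq] at hg
      rw [← hg, ← map_inv]
      rfl
    have h3 := congrArg Ψ h1
    rw [hρ, hρ] at h3
    rw [(MulAut.congr e).injective h3]
    ext
    simp
  subst hb1
  rw [mul_one] at hg ⊢
  have h1 := hL ⟨l, hl⟩
  rw [hg, ← map_one J] at h1
  exact congrArg Subtype.val ((map_eq_one_iff e e.injective).1 (hJ h1.symm))

/-- By Hilbert 90 an involution with nontrivial field part is conjugate to its field part, so field
involutions are recognized by this part alone. -/
theorem exists_isConj_inr_iff [Finite F] (h2 : (2 : F) ≠ 0) {γ : PGammaL F} (hγ : IsInvol γ) :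
    (∃ σ : F ≃+* F, σ ≠ 1 ∧ IsConj (inr σ) γ) ↔ γ.right ≠ 1 := by
  constructor
  · rintro ⟨σ, hσ, hc⟩ h1
    obtain ⟨c, hc⟩ := isConj_iff.1 hc
    have h3 := congrArg SemidirectProduct.right hc
    rw [h1] at h3
    simp only [SemidirectProduct.mul_right, SemidirectProduct.right_inr,
      SemidirectProduct.inv_right] at h3
    exact hσ (conj_eq_one_iff.1 h3)
  · intro h1
    have hσ : γ.right ^ 2 = 1 := by
      rw [sq, ← SemidirectProduct.mul_right, ← sq, hγ.1, SemidirectProduct.one_right]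
    obtain ⟨p, hp⟩ := exists_eq_conj_inr h2 hσ h1 rfl hγ
    exact ⟨γ.right, h1, isConj_iff.2 ⟨inl p, hp.symm⟩⟩

theorem IsPExtension.isInvol {G : Type*} [Group G] {L B : Subgroup G} [L.Normal]
    (h : IsPExtension 2 L B) {Γ : Type*} [Group Γ] {ρ : G →* Γ} (hρ : Function.Injective ρ) {b : G}
    (hb : b ∈ B) (hb1 : b ≠ 1) : IsInvol (ρ b) :=
  ⟨by rw [← map_pow, h.elemAbelian.2 b hb, map_one], fun h => hb1 ((map_eq_one_iff ρ hρ).1 h)⟩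

theorem inducesFieldInvolutions_iff [Finite F] (h2 : (2 : F) ≠ 0) {K G : Type*} [Group K] [Group G]
    {fieldAut : (F ≃+* F) → MulAut K} {Ψ : PGammaL F ≃* MulAut K}
    (hΨ : ∀ σ, Ψ (inr σ) = fieldAut σ) {L B : Subgroup G} [L.Normal] (h : IsPExtension 2 L B)
    {e : L ≃* K} {ρ : G →* PGammaL F} (hinj : Function.Injective ρ)
    (hρ : ∀ g, Ψ (ρ g) = MulAut.congr e (MulAut.conjNormal g)) :
    InducesFieldInvolutions fieldAut L B e ↔ B ≠ ⊥ ∧ ∀ b ∈ B, b ≠ 1 → (ρ b).right ≠ 1 := by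
  refine and_congr_right fun _ => forall_congr' fun b => forall_congr' fun hb =>
    forall_congr' fun hb1 => ?_
  have hi := h.isInvol hinj hb hb1
  rw [← exists_isConj_inr_iff h2 hi, IsFieldInvolution, ← hρ, MulEquiv.orderOf_eq, orderOf_eq_prime hi.1 hi.2]
  simp only [← hΨ, true_and]
  refine exists_congr fun σ => and_congr_right fun _ => ?_
  rw [isConj_iff, isConj_iff]
  constructor
  · rintro ⟨c, hc⟩
    refine ⟨Ψ.symm c, Ψ.injective ?_⟩
    rw [map_mul, map_mul, map_inv, Ψ.apply_symm_apply]
    exact hc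
  · rintro ⟨c, hc⟩
    exact ⟨Ψ c, by rw [← map_inv, ← map_mul, ← map_mul, hc]⟩

theorem quillenDimension_iff_range {G : Type*} [Group G] [Finite G] [Finite F]
    {ρ : G →* PGammaL F} (hinj : Function.Injective ρ) :
    QuillenDimension 2 G ↔ QuillenDimension 2 ρ.range :=
  quillenDimension_congr (MonoidHom.ofInjective hinj)

variable {σ : F ≃+* F}

/-- All three groups have rank 3, so nonzero cycles pass upward: existence comes from the smallest
group, vanishing from the largest. -/
theorem quillenDimension_iff_of_le_of_le [Finite F] (h2 : (2 : F) ≠ 0) (hσ : σ ^ 2 = 1)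
    (hσ1 : σ ≠ 1) {R : Subgroup (PGammaL F)} (h1 : pslFieldExt σ ≤ R) (h3 : R ≤ pglFieldExt σ) :
    QuillenDimension 2 R ↔ Nat.card F ≠ 9 := by
  have r1 := pRank_le_of_injective (Subgroup.inclusion h1) (Subgroup.inclusion_injective h1)
  have r3 := pRank_le_of_injective (Subgroup.inclusion h3) (Subgroup.inclusion_injective h3)
  rw [pRank_pslFieldExt h2 hσ hσ1] at r1
  rw [pRank_pglFieldExt h2 hσ hσ1] at r3
  have hr := le_antisymm r3 r1
  constructor
  · intro h h9
    exact not_quillenDimension_pglFieldExt h2 hσ hσ1 h9 (h.of_injective (Subgroup.inclusion h3)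
      (Subgroup.inclusion_injective h3) (hr.trans (pRank_pglFieldExt h2 hσ hσ1).symm))
  · intro h
    exact (quillenDimension_pslFieldExt h2 hσ hσ1 h).of_injective (Subgroup.inclusion h1)
      (Subgroup.inclusion_injective h1) ((pRank_pslFieldExt h2 hσ hσ1).trans hr.symm)

theorem five_le_card [Finite F] (h : Odd (Nat.card F)) (h3 : Nat.card F ≠ 3) : 5 ≤ Nat.card F := by
  have := Finite.one_lt_card (α := F)
  obtain ⟨k, hk⟩ := h
  omega

theorem two_ne_zero_of_odd_card [Finite F] (h : Odd (Nat.card F)) : (2 : F) ≠ 0 := by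
  intro h2
  have h0 : (Nat.card F : F) = 0 := natCast_card_eq_zero
  obtain ⟨k, hk⟩ := h
  rw [hk] at h0
  push_cast at h0
  rw [h2, zero_mul, zero_add] at h0
  exact one_ne_zero h0

theorem right_sq_eq_one {γ : PGammaL F} (hγ : γ ^ 2 = 1) : γ.right ^ 2 = 1 := by
  rw [sq, ← SemidirectProduct.mul_right, ← sq, hγ, SemidirectProduct.one_right]

variable {G : Type v} [Group G] {L B : Subgroup G} [L.Normal]

theorem IsPExtension.range_le (h : IsPExtension 2 L B) {ρ : G →* PGammaL F}
    {R : Subgroup (PGammaL F)} (hL : ∀ l ∈ L, ρ l ∈ R) (hB : ∀ b ∈ B, b ≠ 1 → ρ b ∈ R) :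
    ρ.range ≤ R := by
  rintro _ ⟨g, rfl⟩
  obtain ⟨l, hl, b, hb, rfl⟩ := h.exists_mul g
  rw [map_mul]
  refine mul_mem (hL l hl) ?_
  by_cases hb1 : b = 1
  · rw [hb1, map_one]
    exact one_mem _
  · exact hB b hb hb1

theorem IsPExtension.quillenDimension_range_iff [Finite F] (h2 : (2 : F) ≠ 0)
    (h : IsPExtension 2 L B) {ρ : G →* PGammaL F} (hinj : Function.Injective ρ) {b : G} (hb : b ∈ B)
    (hσ1 : (ρ b).right ≠ 1) (hL : ∀ l ∈ L, (ρ l).right = 1)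
    (hNR : (pslSubgroup F).map inl ≤ ρ.range) :
    QuillenDimension 2 ρ.range ↔ Nat.card F ≠ 9 := by
  have hi := h.isInvol hinj hb fun hb1 => hσ1 (by
    rw [hb1, map_one, SemidirectProduct.one_right])
  have hσ := right_sq_eq_one hi.1
  refine quillenDimension_iff_of_le_of_le h2 hσ hσ1 ?_ ?_
  · intro t ht
    have hbH : ρ b ∈ pslFieldExt (ρ b).right :=
      (mem_pslFieldExt hσ).2 ⟨Or.inr rfl, left_mem_pslSubgroup h2 hσ hσ1 rfl hi⟩
    have hbR : ρ b ∈ ρ.range := ⟨b, rfl⟩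
    rcases ((mem_pslFieldExt hσ).1 ht).1 with h1 | h1
    · exact hNR (mem_map_inl.2 ⟨h1, ht.2⟩)
    · rw [← Subgroup.mul_mem_cancel_right _ hbR]
      refine hNR (mem_map_inl.2 ⟨?_, (mul_mem ht hbH).2⟩)
      rw [SemidirectProduct.mul_right, h1, ← sq, hσ]
  · refine h.range_le (fun l hl => (mem_pglFieldExt hσ).2 (Or.inl (hL l hl))) fun c hc hc1 => ?_
    rw [mem_pglFieldExt hσ]
    by_cases h1 : (ρ c).right = 1
    · exact Or.inl h1
    -- The field has only one involutory automorphism, so all of `B` lies over `⟨σ⟩`.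
    · exact Or.inr (eq_of_involutive (right_sq_eq_one (h.isInvol hinj hc hc1).1) h1 hσ hσ1)

theorem quillenDimension_iff_of_isPExtension_psl [Finite F] [Finite G] (hodd : Odd (Nat.card F))
    (hq3 : Nat.card F ≠ 3) (e : L ≃* PSL(2, F)) (h : IsPExtension 2 L B) :
    QuillenDimension 2 G ↔ ¬ ((Nat.card F = 5 ∧ B = ⊥) ∨
      (Nat.card F = 9 ∧ InducesFieldInvolutions pslFieldAut L B e)) := by
  have h2 := two_ne_zero_of_odd_card hodd
  have h5 := five_le_card hodd hq3
  obtain ⟨Ψ, hΨ, hΨσ⟩ := exists_pslAutEquiv h2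
  obtain ⟨ρ, hinj, hL, hρ⟩ := h.exists_hom pslInl_injective hΨ e
  rw [inducesFieldInvolutions_iff h2 hΨσ h hinj hρ, quillenDimension_iff_range hinj]
  have hmap : L.map ρ = (pslSubgroup F).map inl := by
    rw [← range_pslInl]
    ext x
    constructor
    · rintro ⟨l, hl, rfl⟩
      exact ⟨e ⟨l, hl⟩, (hL ⟨l, hl⟩).symm⟩
    · rintro ⟨k, rfl⟩
      exact ⟨e.symm k, SetLike.coe_mem _, by rw [hL, e.apply_symm_apply]⟩
  have hLN : ∀ l ∈ L, ρ l ∈ (pslSubgroup F).map (inl : _ →* PGammaL F) := fun l hl => by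
    rw [← hmap]
    exact Subgroup.mem_map_of_mem ρ hl
  have hNR : (pslSubgroup F).map (inl : _ →* PGammaL F) ≤ ρ.range := by
    rw [← hmap]
    exact Subgroup.map_le_range ρ L
  have hBN : ∀ b ∈ B, ρ b ∈ (pslSubgroup F).map (inl : _ →* PGammaL F) → b = 1 := by
    intro b hb hbN
    rw [← hmap] at hbN
    exact h.eq_one_of_mem ((Subgroup.mem_map_iff_mem hinj).1 hbN) hb
  by_cases hB : B = ⊥
  · have hR : ρ.range = (pslSubgroup F).map inl := by
      refine le_antisymm (h.range_le hLN fun b hb hb1 => ?_) hNR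
      rw [hB] at hb
      exact absurd hb hb1
    rw [hR, ← quillenDimension_congr ((pslSubgroup F).equivMapOfInjective _
      SemidirectProduct.inl_injective), quillenDimension_pslSubgroup_iff h2 h5 (fun h6 => by
        rw [h6] at hodd
        exact absurd hodd (by decide))]
    simp [hB]
  obtain ⟨b, hb, hb1⟩ := (Subgroup.bot_or_exists_ne_one B).resolve_left hB
  -- If `b` has a field part and `b'` has none, then `b` and `b' * b` are involutions with the same
  -- field part, so both have linear part in `PSL₂`. Then `b'` acts as an element of `PSL₂`, so it
  -- is trivial. Hence `B` cannot mix the two types.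
  have hright : ∀ b ∈ B, (ρ b).right ≠ 1 → ∀ b' ∈ B, b' ≠ 1 → (ρ b').right ≠ 1 := by
    intro b hb hσ1 b' hb' hb1' h1
    have hleft : ∀ c ∈ B, (ρ c).right = (ρ b).right → (ρ c).left ∈ pslSubgroup F := by
      intro c hc hcb
      have hi := h.isInvol hinj hc fun hc1 => hσ1 (by
        rw [← hcb, hc1, map_one, SemidirectProduct.one_right])
      exact left_mem_pslSubgroup h2 (right_sq_eq_one hi.1) (by rwa [hcb]) rfl hi
    have h3 := hleft (b' * b) (mul_mem hb' hb) (by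
      rw [map_mul, SemidirectProduct.mul_right, h1, one_mul])
    rw [map_mul, SemidirectProduct.mul_left, h1, map_one, MulAut.one_apply,
      Subgroup.mul_mem_cancel_right _ (hleft b hb rfl)] at h3
    exact hb1' (hBN b' hb' (mem_map_inl.2 ⟨h1, h3⟩))
  by_cases hσ1 : (ρ b).right = 1
  -- No element of `B` has a field part, so `b` lies in `PGL₂` outside `PSL₂`, which has index two.
  · have hR : ρ.range = (inl : PGL(2, F) →* PGammaL F).range := by
      refine le_antisymm (h.range_le (fun l hl => map_inl_le_range (hLN l hl)) fun b' hb' _ => ?_) ?_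
      · rw [mem_range_inl]
        by_contra h1
        exact hright b' hb' h1 b hb hb1 hσ1
      · rintro _ ⟨x, rfl⟩
        by_cases hx : x ∈ pslSubgroup F
        · exact hNR (Subgroup.mem_map_of_mem inl hx)
        · obtain ⟨y, hy⟩ := mem_range_inl.2 hσ1
          have hyS : y⁻¹ ∉ pslSubgroup F := fun hyS => by
            refine hb1 (hBN b hb ?_)
            rw [← hy]
            exact Subgroup.mem_map_of_mem inl (inv_mem_iff.1 hyS)
          have h1 := mul_mem (hNR (Subgroup.mem_map_of_mem inl (mul_mem_pslSubgroup hx hyS)))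
            (⟨b, rfl⟩ : ρ b ∈ ρ.range)
          rwa [← hy, ← map_mul, inv_mul_cancel_right] at h1
    rw [hR, ← quillenDimension_congr (MonoidHom.ofInjective SemidirectProduct.inl_injective)]
    refine iff_of_true (quillenDimension_PGL h2 h5) ?_
    rintro (⟨-, h1⟩ | ⟨-, -, h1⟩)
    · exact hB h1
    · exact h1 b hb hb1 hσ1
  · rw [h.quillenDimension_range_iff h2 hinj hb hσ1 (fun l hl => (mem_map_inl.1 (hLN l hl)).1) hNR]
    have := hright b hb hσ1
    tauto

theorem quillenDimension_iff_of_isPExtension_pgl [Finite F] [Finite G] (hodd : Odd (Nat.card F))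
    (hq3 : Nat.card F ≠ 3) (e : L ≃* PGL(2, F)) (h : IsPExtension 2 L B) :
    QuillenDimension 2 G ↔
      ¬ (Nat.card F = 9 ∧ InducesFieldInvolutions pglFieldAut L B e) := by
  have h2 := two_ne_zero_of_odd_card hodd
  have h5 := five_le_card hodd hq3
  obtain ⟨Ψ, hΨ, hΨσ⟩ := exists_pglAutEquiv h2
  obtain ⟨ρ, hinj, hL, hρ⟩ := h.exists_hom SemidirectProduct.inl_injective hΨ e
  rw [inducesFieldInvolutions_iff h2 hΨσ h hinj hρ, quillenDimension_iff_range hinj]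
  have hLN : ∀ l ∈ L, ρ l ∈ (inl : PGL(2, F) →* PGammaL F).range := fun l hl =>
    ⟨e ⟨l, hl⟩, (hL ⟨l, hl⟩).symm⟩
  have hNR : (inl : PGL(2, F) →* PGammaL F).range ≤ ρ.range := by
    rintro _ ⟨k, rfl⟩
    exact ⟨e.symm k, by rw [hL, e.apply_symm_apply]⟩
  -- An element of `B` without field part would lie in the image of `L`, which meets that of `B`
  -- trivially.
  have hright : ∀ b ∈ B, b ≠ 1 → (ρ b).right ≠ 1 := by
    intro b hb hb1 h1
    obtain ⟨k, hk⟩ := mem_range_inl.2 h1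
    have h3 := hL (e.symm k)
    rw [e.apply_symm_apply, hk] at h3
    exact hb1 (h.eq_one_of_mem (hinj h3 ▸ SetLike.coe_mem _) hb)
  by_cases hB : B = ⊥
  · have hR : ρ.range = (inl : PGL(2, F) →* PGammaL F).range := by
      refine le_antisymm (h.range_le hLN fun b hb hb1 => ?_) hNR
      rw [hB] at hb
      exact absurd hb hb1
    rw [hR, ← quillenDimension_congr (MonoidHom.ofInjective SemidirectProduct.inl_injective)]
    refine iff_of_true (quillenDimension_PGL h2 h5) ?_
    rintro ⟨-, h1, -⟩
    exact h1 hB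
  obtain ⟨b, hb, hb1⟩ := (Subgroup.bot_or_exists_ne_one B).resolve_left hB
  rw [h.quillenDimension_range_iff h2 hinj hb (hright b hb hb1)
    (fun l hl => mem_range_inl.1 (hLN l hl)) (map_inl_le_range.trans hNR)]
  tauto

end Extensions

end Quillen

theorem proposition4p2 (q : ℕ) (hq : Odd q) (hq3 : q ≠ 3)
    (F : Type*) [Field F] [Finite F] (hF : Nat.card F = q) :
    (∀ (G : Type*) [Group G] [Finite G] (L B : Subgroup G) [L.Normal] (e : L ≃* PSL(2, F)),
      Quillen.IsPExtension 2 L B →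
      (Quillen.QuillenDimension 2 G ↔
        ¬ ((q = 5 ∧ B = ⊥) ∨
          (q = 9 ∧ Quillen.InducesFieldInvolutions Quillen.pslFieldAut L B e)))) ∧
    (∀ (G : Type*) [Group G] [Finite G] (L B : Subgroup G) [L.Normal] (e : L ≃* PGL(2, F)),
      Quillen.IsPExtension 2 L B →
      (Quillen.QuillenDimension 2 G ↔
        ¬ (q = 9 ∧ Quillen.InducesFieldInvolutions Quillen.pglFieldAut L B e))) := by
  subst hF
  exact ⟨fun G _ _ L B _ e h => Quillen.quillenDimension_iff_of_isPExtension_psl hq hq3 e h,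
    fun G _ _ L B _ e h => Quillen.quillenDimension_iff_of_isPExtension_pgl hq hq3 e h⟩
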